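/- All simplicial complexes are finite, of dimension at most $2$, and embedded in some Euclidean space $\mathbb{R}^N$ ($N$ may vary); different embeddings are different complexes. A *simplicial surface* is a $2$-dimensional simplicial complex whose underlying space is a compact surface without boundary. $\operatorname{star}(v,K)$ is the closed star of a vertex $v$ in $K$, and $\chi(K)=f_0-f_1+f_2$ is the Euler characteristic, where $f_i$ is the number of $i$-simplices of $K$. A *pyramid* is a simplicial surface in $\mathbb{R}^3$ obtained by coning a simplicial disk $D\subset\mathbb{R}^2\subset\mathbb{R}^3$ (a simplicial complex in $\mathbb{R}^2$ with underlying space homeomorphic to a closed disk) from a point of $\mathbb{R}^3\setminus\mathbb{R}^2$ and taking the boundary. A *bipyramid* is a simplicial surface in $\mathbb{R}^3$ obtained by suspending a polygonal disk $R\subset\mathbb{R}^2$ (the region bounded by a simple closed polygon, whose vertices are its corners; $R$ need not be subdivided) from two points of $\mathbb{R}^3$ on opposite sides of $\mathbb{R}^2$ and taking the boundary. Let $\mathcal{S}$ be a set of simplicial surfaces that contains all pyramids and bipyramids and contains, with every surface, all its subdivisions. Let $\Lambda$ assign a real number $\Lambda(K)$ to each $K\in\mathcal{S}$. Suppose that $\Lambda$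 is *geometrically locally determined* on $\mathcal{S}$, that is, there is a function $\phi$ that assigns a real number $\phi(v,K)$ to each $K\in\mathcal{S}$ and each vertex $v$ of $K$, such that: 1. (invariance under simplicial isometries of stars) if $K,L\in\mathcal{S}$ have vertices $v$ and $w$ for which some simplicial homeomorphism $|\operatorname{star}(v,K)|\to|\operatorname{star}(w,L)|$ takes $v$ to $w$ and preserves the lengths of edges, then $\phi(v,K)=\phi(w,L)$; 2. (invariance under subdivision) if $K,J\in\mathcal{S}$ and $J$ is a subdivision of $K$, then $\phi(v,K)=\phi(v,J)$ for every vertex $v$ of $K$; 3. (continuity) if $K$ and $K_1,K_2,\dots$ in $\mathcal{S}$ are combinatorially equivalent, lie in the same Euclidean space, and the $K_n$ converge to $K$ (each vertex $u_n$ of $K_n$ that corresponds to a vertex $u$ of $K$ satisfies $u_n\to u$), then $\phi(v_n,K_n)\to\phi(v,K)$ for every vertex $v$ of $K$ with corresponding vertices $v_n$ of $K_n$; 4. (Descartes-Gauss-Bonnet) $\sum_{v}\phi(v,K)=\Lambda(K)$ for every $K\in\mathcal{S}$, the sum being over all vertices of $K$. Suppose also that $\Lambda$ has the same value, denoted $\Lambda(\text{pyramid})$,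 on all pyramids and bipyramids. Then $$\Lambda(K)=\tfrac12\,\Lambda(\text{pyramid})\,\chi(K)\qquad\text{for every }K\in\mathcal{S}.$$ -/

import Mathlib

open Filter Topology

open scoped Classical

noncomputable section

/-- Euclidean space of dimension `N`. -/
abbrev Euc (N : ℕ) : Type := EuclideanSpace ℝ (Fin N)

/-- A finite geometric simplicial complex of dimension at most `2`, embedded in `ℝᴺ`.
Faces are recorded by their finite vertex sets. Differently embedded complexes are different. -/
structure TwoComplex (N : ℕ) extends Geometry.SimplicialComplex ℝ (Euc N) where
  finite_faces : faces.Finite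
  card_le_three : ∀ s ∈ faces, s.card ≤ 3

/-- A set of complexes, each embedded in some Euclidean space: for every `N`, the set of
those members that are embedded in `ℝᴺ`. -/
abbrev ComplexSet : Type := ∀ N : ℕ, Set (TwoComplex N)

/-- A simplicial-complex-supported function; only its values on the set of complexes under
consideration are ever used. -/
abbrev ComplexFunction : Type := ∀ N : ℕ, TwoComplex N → ℝ

/-- A vertex-supported function; only its values at the vertices of the complexes in the set
under consideration are ever used. -/
abbrev VertexFunction : Type := ∀ N : ℕ, TwoComplex N → Euc N → ℝ

namespace TwoComplex

/-- The number of `i`-simplices. -/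
def numFaces {N : ℕ} (K : TwoComplex N) (i : ℕ) : ℕ :=
  {s | s ∈ K.faces ∧ s.card = i + 1}.ncard

/-- The Euler characteristic `f₀ - f₁ + f₂`. -/
def eulerChar {N : ℕ} (K : TwoComplex N) : ℤ :=
  (K.numFaces 0 : ℤ) - (K.numFaces 1 : ℤ) + (K.numFaces 2 : ℤ)

/-- A simplicial surface: a `2`-dimensional complex whose underlying space is a topological
surface without boundary. (The underlying space is automatically compact and metrizable.) -/
def IsSimplicialSurface {N : ℕ} (K : TwoComplex N) : Prop :=
  (∃ s ∈ K.faces, s.card = 3) ∧ Nonempty (ChartedSpace (Euc 2) K.space)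

/-- A simplicial disk in the plane. -/
def IsDisk (D : TwoComplex 2) : Prop :=
  Nonempty (D.space ≃ₜ Metric.closedBall (0 : Euc 2) 1)

/-- `J` is a subdivision of `K`: same underlying space, and every simplex of `J` lies in a
simplex of `K`. -/
def IsSubdivision {N : ℕ} (J K : TwoComplex N) : Prop :=
  J.space = K.space ∧
    ∀ s ∈ J.faces, ∃ t ∈ K.faces, convexHull ℝ (s : Set (Euc N)) ⊆ convexHull ℝ (t : Set (Euc N))

/-- The (closed) star of `v`: all faces of the simplices that contain `v`. -/
def starFaces {N : ℕ} (K : TwoComplex N) (v : Euc N) : Set (Finset (Euc N)) :=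
  {s | s ∈ K.faces ∧ ∃ t ∈ K.faces, v ∈ t ∧ s ⊆ t}

end TwoComplex

/-- The vertex map `f` induces a simplicial isomorphism (equivalently, a simplicial
homeomorphism of the underlying spaces) between the complexes with sets of simplices
`A` and `B`. -/
def IsSimplicialIso {M N : ℕ} (f : Euc M → Euc N)
    (A : Set (Finset (Euc M))) (B : Set (Finset (Euc N))) : Prop :=
  Set.InjOn f {x | {x} ∈ A} ∧ (fun s : Finset (Euc M) => s.image f) '' A = B

/-- The stars of `v` in `K` and of `w` in `L` are simplicially isometric: some simplicial
homeomorphism between them takes `v` to `w` and preserves the lengths of edges. -/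
def StarsIsometric {M N : ℕ} (K : TwoComplex M) (v : Euc M) (L : TwoComplex N) (w : Euc N) :
    Prop :=
  ∃ f : Euc M → Euc N, IsSimplicialIso f (K.starFaces v) (L.starFaces w) ∧ f v = w ∧
    ∀ x y : Euc M, {x, y} ∈ K.starFaces v → dist (f x) (f y) = dist x y

/-- The complexes `Kn n` converge to `K`, where `f n` is the simplicial isomorphism that
identifies `K` with `Kn n`: pointwise convergence at the vertices. -/
def ConvergesTo {N : ℕ} (Kn : ℕ → TwoComplex N) (f : ℕ → Euc N → Euc N) (K : TwoComplex N) :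
    Prop :=
  (∀ n, IsSimplicialIso (f n) K.faces (Kn n).faces) ∧
    ∀ u ∈ K.vertices, Tendsto (fun n => f n u) atTop (𝓝 u)

namespace VertexFunction

/-- Invariance under subdivision, on the set `T` of complexes. -/
def InvariantUnderSubdivision (T : ComplexSet) (φ : VertexFunction) : Prop :=
  ∀ (N : ℕ), ∀ K ∈ T N, ∀ J ∈ T N, J.IsSubdivision K → ∀ v ∈ K.vertices, φ N K v = φ N J v

/-- Invariance under simplicial isometries of stars, on the set `T` of complexes. -/
def InvariantUnderStarIsometries (T : ComplexSet) (φ : VertexFunction) : Prop :=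
  ∀ (M N : ℕ), ∀ K ∈ T M, ∀ L ∈ T N, ∀ v ∈ K.vertices, ∀ w ∈ L.vertices,
    StarsIsometric K v L w → φ M K v = φ N L w

/-- Continuity, on the set `T` of complexes. -/
def IsContinuous (T : ComplexSet) (φ : VertexFunction) : Prop :=
  ∀ (N : ℕ) (K : TwoComplex N) (Kn : ℕ → TwoComplex N) (f : ℕ → Euc N → Euc N),
    K ∈ T N → (∀ n, Kn n ∈ T N) → ConvergesTo Kn f K →
      ∀ v ∈ K.vertices, Tendsto (fun n => φ N (Kn n) (f n v)) atTop (𝓝 (φ N K v))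

/-- The Descartes-Gauss-Bonnet Theorem with respect to `Λ`, on the set `T` of complexes
(the sum is over the finitely many vertices). -/
def SatisfiesDescartesGaussBonnet (T : ComplexSet) (φ : VertexFunction) (Λ : ComplexFunction) :
    Prop :=
  ∀ (N : ℕ), ∀ K ∈ T N, ∑ᶠ v ∈ K.vertices, φ N K v = Λ N K

end VertexFunction

/-- `Λ` is geometrically locally determined on the set `T` of complexes. -/
def GeometricallyLocallyDetermined (T : ComplexSet) (Λ : ComplexFunction) : Prop :=
  ∃ φ : VertexFunction,
    φ.InvariantUnderStarIsometries T ∧ φ.InvariantUnderSubdivision T ∧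
      φ.IsContinuous T ∧ φ.SatisfiesDescartesGaussBonnet T Λ

/-- The inclusion of `ℝ²` in `ℝ³` as the plane in which the last coordinate vanishes. -/
def planeInclusion (p : Euc 2) : Euc 3 := !₂[p 0, p 1, 0]

/-- The simplices of the cone on `D ⊆ ℝ²` from the point `a` of `ℝ³`. -/
def coneFaces (D : TwoComplex 2) (a : Euc 3) : Set (Finset (Euc 3)) :=
  {s | s.Nonempty ∧ ∃ t : Finset (Euc 2), (t = ∅ ∨ t ∈ D.faces) ∧
    (s = t.image planeInclusion ∨ s = insert a (t.image planeInclusion))}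

/-- The boundary of a `3`-dimensional complex with set of simplices `C`: all faces of the
`2`-simplices that lie in exactly one `3`-simplex. -/
def boundaryFaces (C : Set (Finset (Euc 3))) : Set (Finset (Euc 3)) :=
  {s | s.Nonempty ∧ ∃ t ∈ C, s ⊆ t ∧ t.card = 3 ∧ ∃! u, u ∈ C ∧ u.card = 4 ∧ t ⊆ u}

/-- `K` is a pyramid: the boundary of the cone on a simplicial disk in `ℝ²` from a point of
`ℝ³` outside `ℝ²`. -/
def TwoComplex.IsPyramid (K : TwoComplex 3) : Prop :=
  ∃ (D : TwoComplex 2) (a : Euc 3), D.IsDisk ∧ a 2 ≠ 0 ∧ K.faces = boundaryFaces (coneFaces D a)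

/-- A simple closed polygon in the plane, with no straight angle at any vertex, and
with edges meeting only in common endpoints: the boundary of a polygonal disk, listed through
the vertices of that disk. -/
def IsSimplePolygon {n : ℕ} [NeZero n] (P : Polygon (Euc 2) n) : Prop :=
  P.HasNondegenerateVertices ℝ ∧
    ∀ i j : Fin n, i ≠ j → j ≠ finRotate n i → i ≠ finRotate n j →
      Disjoint (P.edgeSet ℝ i) (P.edgeSet ℝ j)

/-- `K` is a bipyramid: the boundary of the suspension of a polygonal disk `R` in `ℝ²` from
two points of `ℝ³` on opposite sides of `ℝ²`. This boundary is the suspension of the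
polygon `P` bounding `R`, so it consists of the triangles spanned by an apex and an edge of `P`,
and of the faces of these triangles. -/
def TwoComplex.IsBipyramid (K : TwoComplex 3) : Prop :=
  ∃ (n : ℕ) (_ : NeZero n) (P : Polygon (Euc 2) n) (x y : Euc 3),
    IsSimplePolygon P ∧ 0 < x 2 ∧ y 2 < 0 ∧
      K.faces = {s | s.Nonempty ∧ ∃ i : Fin n, ∃ a ∈ ({x, y} : Set (Euc 3)),
        s ⊆ {a, planeInclusion (P i), planeInclusion (P (finRotate n i))}}

/-- The set `S` contains, with every complex, all its subdivisions. -/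
def ComplexSet.ClosedUnderSubdivision (S : ComplexSet) : Prop :=
  ∀ (N : ℕ), ∀ K ∈ S N, ∀ J : TwoComplex N, J.IsSubdivision K → J ∈ S N

end

/-! A locally determined vertex function must be a fixed multiple of the angle defect, and angle
defects add up to `2πχ`.

In a surface every edge lies in exactly two triangles and every link is connected, so the star of a
vertex is a cyclic fan of triangles. Dividing an edge opposite to the vertex cuts one angle of the
fan in two; dividing an edge at the vertex shortens a spoke and keeps all angles. Two fans with the
same total angle therefore have subdivisions with equal angle lists and equal spokes, which are
isometric. Hence `φ` is a function `f` of the total angle alone (`TwoComplex.eq_of_totalAngle_eq`).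

Bipyramids determine `f`. Over a regular triangle, apex angles `u` and `v` leave the angle `2π - (u
+ v) / 3` at each base vertex. As the sum of `f` over the vertices is constant, `f u + f v` depends
only on `u + v`. This is Jensen's equation, so by continuity `f` is affine on `(0, 2π)`. Over a
comb-shaped polygon both apexes can have any prescribed angle `θ`, however large, while all base
angles stay below `2π`; this fixes the constants and extends the formula to all `θ > 0`
(`IsAngleFunction.eq_curvature`): `f θ = c (2π - θ) / (4π)`.

Summing, with angle sum `π` in each triangle and `3 f₂ = 2 f₁`, gives `c χ / 2`. The local structure
of surfaces is obtained from winding numbers, computed with the covering `exp`. -/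

/-! ### Logarithms and winding numbers on the punctured plane. -/

/-- The homotopy `f ∘ H` starts at the constant `f q`, so it lifts through the covering `exp` from
the constant `log (f q)`; the lift at time `1` is the logarithm. -/
theorem exists_log_of_contraction {E : Type*} [TopologicalSpace E] {A : Set E} {q : E}
    (H : ℝ × E → E) (hH : ContinuousOn H (Set.Icc 0 1 ×ˢ A))
    (hmaps : ∀ t ∈ Set.Icc (0 : ℝ) 1, ∀ z ∈ A, H (t, z) ∈ A)
    (hzero : ∀ z ∈ A, H (0, z) = q) (hone : ∀ z ∈ A, H (1, z) = z)
    {f : E → ℂ} (hf : ContinuousOn f A) (hf0 : ∀ z ∈ A, f z ≠ 0) :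
    ∃ g : E → ℂ, ContinuousOn g A ∧ ∀ z ∈ A, Complex.exp (g z) = f z := by
  rcases A.eq_empty_or_nonempty with rfl | ⟨a, ha⟩
  · exact ⟨0, by simp, by simp⟩
  have hq : q ∈ A := by
    rw [← hzero a ha]; exact hmaps 0 (by simp) a ha
  let F : C(unitInterval × A, {z : ℂ // z ≠ 0}) :=
    { toFun := fun x => ⟨f (H (x.1, x.2)), hf0 _ (hmaps _ x.1.2 _ x.2.2)⟩
      continuous_toFun := by
        refine Continuous.subtype_mk ?_ _
        have h1 : Continuous fun x : unitInterval × A => H ((x.1 : ℝ), (x.2 : E)) :=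
          hH.comp_continuous (by fun_prop) (fun x => ⟨x.1.2, x.2.2⟩)
        exact hf.comp_continuous h1 (fun x => hmaps _ x.1.2 _ x.2.2) }
  let c : C(A, ℂ) := ContinuousMap.const _ (Complex.log (f q))
  have h0 : ∀ a, F (0, a) = (⟨_, (c a).exp_ne_zero⟩ : {z : ℂ // z ≠ 0}) := by
    intro a
    apply Subtype.ext
    simp [F, c, hzero a a.2, Complex.exp_log (hf0 q hq)]
  let G := Complex.isCoveringMap_exp.liftHomotopy F c h0
  have hG := Complex.isCoveringMap_exp.liftHomotopy_lifts F c h0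
  refine ⟨fun z => if hz : z ∈ A then G (1, ⟨z, hz⟩) else 0, ?_, ?_⟩
  · rw [continuousOn_iff_continuous_domRestrict]
    have : Continuous fun x : A => G (1, x) := by fun_prop
    convert this using 2 with x
    simp
  · intro z hz
    have := congrArg Subtype.val (congrFun hG (1, ⟨z, hz⟩))
    simp only [dif_pos hz]
    exact this.trans (by simp [F, hone z hz])

theorem exists_continuous_log {f : ℂ → ℂ} (hf : Continuous f) (hf0 : ∀ z, f z ≠ 0) :
    ∃ g : ℂ → ℂ, Continuous g ∧ ∀ z, Complex.exp (g z) = f z := by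
  obtain ⟨g, hg, h⟩ := exists_log_of_contraction (A := Set.univ) (q := (0 : ℂ))
    (fun x : ℝ × ℂ => (x.1 : ℂ) * x.2) (by fun_prop) (by simp) (by simp) (by simp)
    hf.continuousOn (by simpa using hf0)
  exact ⟨g, by simpa using hg, by simpa using h⟩

/-- Both `h` and the constant `h 0` lift the constant map `1` through `exp` and agree at `0`, so
they coincide. -/
theorem eq_intCast_mul_of_exp_eq_one {h : ℂ → ℂ} (hc : Continuous h)
    (h1 : ∀ z, Complex.exp (h z) = 1) : ∃ n : ℤ, ∀ z, h z = n * (2 * Real.pi * Complex.I) := by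
  obtain ⟨n, hn⟩ := Complex.exp_eq_one_iff.1 (h1 0)
  refine ⟨n, fun z => ?_⟩
  have := Complex.isCoveringMap_exp.eq_of_comp_eq (g₁ := h) (g₂ := fun _ => h 0) hc
    continuous_const (by ext x; simp [h1]) 0 rfl
  rw [← hn]
  exact congrFun this z

/-- After substituting `exp z`, the function `d z - g (exp z)` is constant. Its values at `0` and
`2πi` differ by `2πi d`, because `g ∘ exp` is periodic. -/
theorem eq_zero_of_zpow_eq_exp {d : ℤ} {g : ℂ → ℂ} (hg : ContinuousOn g {0}ᶜ)
    (h : ∀ z ≠ 0, z ^ d = Complex.exp (g z)) : d = 0 := by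
  have hc : Continuous fun z => g (Complex.exp z) :=
    hg.comp_continuous Complex.continuous_exp (fun z => Complex.exp_ne_zero z)
  obtain ⟨n, hn⟩ := eq_intCast_mul_of_exp_eq_one (h := fun z => d * z - g (Complex.exp z))
    ((continuous_const.mul continuous_id).sub hc) (fun z => by
      rw [Complex.exp_sub, ← h _ (Complex.exp_ne_zero z), Complex.exp_int_mul]
      exact div_self (zpow_ne_zero _ (Complex.exp_ne_zero z)))
  have h0 := hn 0
  have h1 := hn (2 * Real.pi * Complex.I)
  simp only [Complex.exp_zero, Complex.exp_two_pi_mul_I] at h0 h1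
  have : (d : ℂ) * (2 * Real.pi * Complex.I) = 0 := by linear_combination h1 - h0
  simpa [Real.pi_ne_zero] using this

theorem eq_of_zpow_mul_exp_eq {d e : ℤ} {g h : ℂ → ℂ} (hg : ContinuousOn g {0}ᶜ)
    (hh : ContinuousOn h {0}ᶜ)
    (H : ∀ z ≠ 0, z ^ d * Complex.exp (g z) = z ^ e * Complex.exp (h z)) : d = e := by
  have := eq_zero_of_zpow_eq_exp (d := d - e) (g := fun z => h z - g z) (hh.sub hg) (by
    intro z hz
    have hz' := zpow_ne_zero e hz
    rw [zpow_sub₀ hz, Complex.exp_sub, div_eq_div_iff hz' (Complex.exp_ne_zero _), H z hz]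
    ring)
  omega

/-- The exponent `d` is the winding number of `u` about the puncture. A logarithm `G` of `u ∘ exp`
on the universal cover changes by `2πi d` under the translation by `2πi`, so `G z - d z` is periodic
and descends through the quotient map `exp`. -/
theorem exists_eq_zpow_mul_exp {u : ℂ → ℂ} (hu : ContinuousOn u {0}ᶜ) (hu0 : ∀ z ≠ 0, u z ≠ 0) :
    ∃ (d : ℤ) (g : ℂ → ℂ), ContinuousOn g {0}ᶜ ∧ ∀ z ≠ 0, u z = z ^ d * Complex.exp (g z) := by
  have hc : Continuous fun z => u (Complex.exp z) :=
    hu.comp_continuous Complex.continuous_exp (fun z => Complex.exp_ne_zero z)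
  obtain ⟨G, hG, hGu⟩ := exists_continuous_log hc (fun z => hu0 _ (Complex.exp_ne_zero z))
  obtain ⟨d, hd⟩ := eq_intCast_mul_of_exp_eq_one
    (h := fun z => G (z + 2 * Real.pi * Complex.I) - G z) (by fun_prop) (fun z => by
      rw [Complex.exp_sub, hGu, hGu, Complex.exp_add, Complex.exp_two_pi_mul_I, mul_one]
      exact div_self (hu0 _ (Complex.exp_ne_zero z)))
  have hint : ∀ (n : ℕ) z, G (z + n * (2 * Real.pi * Complex.I)) =
      G z + n * (d * (2 * Real.pi * Complex.I)) := by
    intro n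
    induction n with
    | zero => intro z; simp
    | succ k ih =>
      intro z
      have := hd (z + k * (2 * Real.pi * Complex.I))
      rw [ih z] at this
      push_cast
      rw [show z + ((k : ℂ) + 1) * (2 * Real.pi * Complex.I) =
        z + k * (2 * Real.pi * Complex.I) + 2 * Real.pi * Complex.I by ring]
      linear_combination this
  have hper : ∀ (n : ℤ) z, G (z + n * (2 * Real.pi * Complex.I)) =
      G z + n * (d * (2 * Real.pi * Complex.I)) := by
    intro n z
    obtain ⟨m, rfl | rfl⟩ := n.eq_nat_or_neg
    · exact_mod_cast hint m z
    · have := hint m (z + ((-m : ℤ) : ℂ) * (2 * Real.pi * Complex.I))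
      push_cast at this ⊢
      rw [show z + -(m : ℂ) * (2 * Real.pi * Complex.I) + m * (2 * Real.pi * Complex.I) = z
        by ring] at this
      linear_combination -this
  -- The principal branch is discontinuous, but by periodicity of `G z - d z` any other branch would
  -- give the same values.
  set g : ℂ → ℂ := fun w => G (Complex.log w) - d * Complex.log w with hgdef
  have hgexp : ∀ z, g (Complex.exp z) = G z - d * z := by
    intro z
    obtain ⟨n, hn⟩ := Complex.exp_eq_exp_iff_exists_int.1
      (Complex.exp_log (Complex.exp_ne_zero z))
    simp only [hgdef]
    rw [hn, hper]
    ring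
  refine ⟨d, g, ?_, ?_⟩
  · rw [continuousOn_iff_continuous_domRestrict]
    have hq := Complex.isAddQuotientCoveringMap_exp.toIsQuotientMap
    have : Continuous fun x : {z : ℂ // z ≠ 0} => g x := by
      rw [hq.continuous_iff]
      have : Continuous fun z => G z - d * z := by fun_prop
      convert this using 2 with z
      exact hgexp z
    exact this
  · intro z hz
    have := hGu (Complex.log z)
    rw [Complex.exp_log hz] at this
    rw [← this]
    simp only [hgdef]
    rw [Complex.exp_sub, Complex.exp_int_mul, Complex.exp_log hz]
    field_simp [zpow_ne_zero d hz]

/-! ### Points at which a space is not locally a plane: segments, half-disks and books of three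
pages. -/

/-- `X` looks near `p` like the plane near the origin. -/
def LocallyPlanarAt {E : Type*} [TopologicalSpace E] (X : Set E) (p : E) : Prop :=
  ∀ U ∈ 𝓝 p, ∃ j : ℂ → E, IsEmbedding j ∧ j 0 = p ∧ Set.range j ⊆ X ∩ U ∧ Set.range j ∈ 𝓝[X] p

namespace LocallyPlanarAt

variable {E : Type*} [TopologicalSpace E] {X : Set E} {p : E}

theorem not_isolated (h : LocallyPlanarAt X p) {U : Set E} (hU : U ∈ 𝓝 p) :
    ∃ z ∈ X ∩ U, z ≠ p := by
  obtain ⟨j, hj, h0, hr, -⟩ := h U hU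
  exact ⟨j 1, hr ⟨1, rfl⟩, fun h1 => one_ne_zero (hj.injective (h1.trans h0.symm))⟩

/-- A punctured plane is connected, so a continuous function taking both signs on it has a zero. -/
theorem false_of_separated (h : LocallyPlanarAt X p) {f : E → ℝ} (hf : ContinuousOn f X)
    {U : Set E} (hU : U ∈ 𝓝 p) (hne : ∀ z ∈ X ∩ U, z ≠ p → f z ≠ 0)
    (hpos : ∃ᶠ z in 𝓝[X] p, z ≠ p ∧ 0 < f z) (hneg : ∃ᶠ z in 𝓝[X] p, z ≠ p ∧ f z < 0) : False := by
  obtain ⟨j, hj, h0, hr, hn⟩ := h U hU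
  obtain ⟨z1, ⟨hz1, hz1'⟩, ⟨w1, rfl⟩⟩ := (hpos.and_eventually hn).exists
  obtain ⟨z2, ⟨hz2, hz2'⟩, ⟨w2, rfl⟩⟩ := (hneg.and_eventually hn).exists
  have hconn : IsPreconnected ({0}ᶜ : Set ℂ) :=
    (isConnected_compl_singleton_of_one_lt_rank (by
      rw [Complex.rank_real_complex]; norm_num) 0).isPreconnected
  have hc : ContinuousOn (fun w => f (j w)) {0}ᶜ :=
    (hf.comp_continuous hj.continuous (fun w => (hr ⟨w, rfl⟩).1)).continuousOn
  have hw : ∀ w, j w ≠ p → w ∈ ({0}ᶜ : Set ℂ) := by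
    rintro w hw rfl
    exact hw h0
  obtain ⟨w, hw0, hw1⟩ := hconn.intermediate_value (hw w2 hz2) (hw w1 hz1) hc
    (show (0 : ℝ) ∈ Set.Icc _ _ from ⟨hz2'.le, hz1'.le⟩)
  exact hne _ (hr ⟨w, rfl⟩) (fun h1 => hw0 (hj.injective (h1.trans h0.symm))) hw1


end LocallyPlanarAt

/-- Radial projection to the circle of radius `ε` has winding number `1`. Composing with it turns
information valid only near `0` into information on the whole punctured plane. -/
theorem scaled_eq_zpow_mul_exp {ε : ℝ} (hε : 0 < ε) {w : ℂ} (hw : w ≠ 0) :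
    ((ε / ‖w‖ : ℝ) : ℂ) * w = w ^ (1 : ℤ) * Complex.exp (Real.log (ε / ‖w‖) : ℝ) := by
  rw [← Complex.ofReal_exp, Real.exp_log (by positivity), zpow_one, mul_comm]

theorem continuousOn_scaled (ε : ℝ) :
    ContinuousOn (fun w : ℂ => ((ε / ‖w‖ : ℝ) : ℂ) * w) {0}ᶜ := by
  refine ContinuousOn.mul (Complex.continuous_ofReal.comp_continuousOn ?_) continuousOn_id
  exact continuousOn_const.div continuous_norm.continuousOn (fun w hw => by simpa using hw)

theorem continuousOn_log_scaled {ε : ℝ} (hε : 0 < ε) :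
    ContinuousOn (fun w : ℂ => ((Real.log (ε / ‖w‖) : ℝ) : ℂ)) {0}ᶜ := by
  refine Complex.continuous_ofReal.comp_continuousOn (ContinuousOn.log ?_ ?_)
  · exact continuousOn_const.div continuous_norm.continuousOn (fun w hw => by simpa using hw)
  · intro w hw
    have : w ≠ 0 := hw
    positivity

theorem norm_scaled {ε : ℝ} (hε : 0 < ε) {w : ℂ} (hw : w ≠ 0) :
    ‖((ε / ‖w‖ : ℝ) : ℂ) * w‖ = ε := by
  rw [norm_mul, Complex.norm_real, Real.norm_of_nonneg (by positivity)]
  exact div_mul_cancel₀ _ (norm_ne_zero_iff.2 hw)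

theorem continuousOn_invFun {E : Type*} [TopologicalSpace E] {j : ℂ → E} (hj : IsEmbedding j) :
    ContinuousOn (Function.invFun j) (Set.range j) := by
  rw [hj.isInducing.continuousOn_iff]
  refine continuousOn_id.congr ?_
  rintro _ ⟨w, rfl⟩
  simp [Function.leftInverse_invFun hj.injective w]

namespace LocallyPlanarAt

/-- A point on the boundary of a half-disk is not a planar point. -/
theorem false_of_convex {E : Type*} [NormedAddCommGroup E] [NormedSpace ℝ E] {X : Set E} {p : E}
    (h : LocallyPlanarAt X p) {O : Set E} (hO : O ∈ 𝓝 p) (hp : p ∈ X)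
    (hconv : Convex ℝ (O ∩ X)) {q : E} (hq : q ∈ O ∩ X) (hqp : q ≠ p)
    (hseg : ∀ z ∈ O ∩ X, z ≠ p → p ∉ openSegment ℝ z q) : False := by
  obtain ⟨j, hj, h0, hr, hn⟩ := h O hO
  obtain ⟨δ, hδ, hδj⟩ := Metric.mem_nhdsWithin_iff.1 hn
  have hpO : p ∈ O ∩ X := ⟨mem_of_mem_nhds hO, hp⟩
  have hqd : 0 < ‖q - p‖ := norm_pos_iff.2 (sub_ne_zero.2 hqp)
  obtain ⟨s, hs0, hs1, hsδ⟩ : ∃ s : ℝ, 0 < s ∧ s ≤ 1 ∧ s * ‖q - p‖ < δ := by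
    refine ⟨min 1 (δ / 2 / ‖q - p‖), by positivity, min_le_left _ _, ?_⟩
    calc min 1 (δ / 2 / ‖q - p‖) * ‖q - p‖ ≤ (δ / 2 / ‖q - p‖) * ‖q - p‖ := by
          gcongr; exact min_le_right _ _
      _ = δ / 2 := div_mul_cancel₀ _ hqd.ne'
      _ < δ := by linarith
  -- The point `q` may lie outside the range of the chart, so it is pulled towards `p` along the
  -- segment.
  set c := p + s • (q - p) with hc
  set B := Metric.ball p δ ∩ (O ∩ X) with hB
  have hBc : Convex ℝ B := (convex_ball p δ).inter hconv
  have hcB : c ∈ B := by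
    refine ⟨?_, ?_⟩
    · simp [hc, norm_smul, abs_of_pos hs0, hsδ]
    · have := hconv hpO hq (a := 1 - s) (b := s) (by linarith) hs0.le (by ring)
      convert this using 1
      simp only [hc]
      module
  have hcp : c ≠ p := by
    simp [hc, hs0.ne', sub_eq_zero, hqp]
  have hcseg : ∀ z ∈ B, z ≠ p → ∀ t : ℝ, 0 ≤ t → t ≤ 1 → (1 - t) • c + t • z ≠ p := by
    intro z hz hzp t ht0 ht1 he
    rcases ht0.eq_or_lt with rfl | ht0
    · exact hcp (by simpa using he)
    rcases ht1.eq_or_lt with rfl | ht1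
    · exact hzp (by simpa using he)
    refine hseg z hz.2 hzp ⟨t / (t + (1 - t) * s), (1 - t) * s / (t + (1 - t) * s), ?_, ?_, ?_, ?_⟩
    · have : 0 < (1 - t) * s := mul_pos (by linarith) hs0
      positivity
    · have : 0 < (1 - t) * s := mul_pos (by linarith) hs0
      positivity
    · have : 0 < (1 - t) * s := mul_pos (by linarith) hs0
      rw [← add_div, div_self (by positivity)]
    · have hpos : 0 < (1 - t) * s := mul_pos (by linarith) hs0
      have hD : t + (1 - t) * s ≠ 0 := by positivity
      have key : t • z + ((1 - t) * s) • q = (t + (1 - t) * s) • p := by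
        have h2 : t • z + ((1 - t) * s) • q - (t + (1 - t) * s) • p =
            ((1 - t) • c + t • z) - p := by
          simp only [hc]; module
        rwa [he, sub_self, sub_eq_zero] at h2
      rw [div_eq_inv_mul, div_eq_inv_mul, mul_smul, mul_smul, ← smul_add, key, smul_smul,
        inv_mul_cancel₀ hD, one_smul]
  have hBr : B ⊆ Set.range j := fun z hz => hδj ⟨hz.1, hz.2.2⟩
  have hinv : ∀ w, Function.invFun j (j w) = w := Function.leftInverse_invFun hj.injective
  -- The set `B \ {p}` is star-shaped about `c`, so the inverse chart has a logarithm there. On a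
  -- small circle about `0` in the chart this forces the identity, of winding number `1`, to have
  -- winding number `0`.
  obtain ⟨g, hg, hgexp⟩ := exists_log_of_contraction (A := B \ {p}) (q := c)
    (fun x : ℝ × E => (1 - x.1) • c + x.1 • x.2) (by fun_prop)
    (fun t ht z hz => ⟨hBc hcB hz.1 (by linarith [ht.2]) ht.1 (by ring),
      hcseg z hz.1 hz.2 t ht.1 ht.2⟩) (by simp) (by simp)
    (f := Function.invFun j) ((continuousOn_invFun hj).mono (Set.sdiff_subset.trans hBr))
    (by
      rintro z ⟨hz, hzp⟩ hz0
      obtain ⟨w, rfl⟩ := hBr hz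
      rw [hinv] at hz0
      exact hzp (by rw [hz0]; exact h0))
  have hnear : ∀ᶠ w in 𝓝 (0 : ℂ), j w ∈ Metric.ball p δ :=
    hj.continuous.continuousAt.eventually_mem (by rw [h0]; exact Metric.ball_mem_nhds p hδ)
  obtain ⟨ε, hε, hεj⟩ := Metric.nhds_basis_closedBall.eventually_iff.1 hnear
  have hmem : ∀ w : ℂ, w ≠ 0 → j (((ε / ‖w‖ : ℝ) : ℂ) * w) ∈ B \ {p} := by
    intro w hw
    refine ⟨⟨hεj (by simp only [Metric.mem_closedBall, dist_zero_right, norm_scaled hε hw, le_refl]),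
      (hr ⟨_, rfl⟩).symm⟩, ?_⟩
    intro he
    have := hj.injective ((show _ = p from he).trans h0.symm)
    have h2 := norm_scaled hε hw
    rw [this] at h2
    simp at h2
    exact hε.ne h2
  have h1 := eq_of_zpow_mul_exp_eq (d := 1) (e := 0)
    (g := fun w : ℂ => ((Real.log (ε / ‖w‖) : ℝ) : ℂ))
    (h := fun w => g (j (((ε / ‖w‖ : ℝ) : ℂ) * w))) (continuousOn_log_scaled hε)
    (hg.comp (hj.continuous.comp_continuousOn (continuousOn_scaled ε)) hmem)
    (fun w hw => by
      rw [hgexp _ (hmem w hw), hinv, ← scaled_eq_zpow_mul_exp hε hw]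
      simp)
  exact one_ne_zero h1

end LocallyPlanarAt

/-- Winding numbers multiply under composition: `ρ` winds `a` times in the chart `j`, and `u` has
degree `d` in that chart. -/
theorem mul_eq_of_winding {E : Type*} [TopologicalSpace E] {j : ℂ → E} {ρ : ℂ → E} {u : E → ℂ}
    {a d e : ℤ} {α g h : ℂ → ℂ} (hα : ContinuousOn α {0}ᶜ) (hg : ContinuousOn g {0}ᶜ)
    (hh : ContinuousOn h {0}ᶜ) (hρ : ∀ w ≠ 0, ρ w = j (w ^ a * Complex.exp (α w)))
    (hu : ∀ z ≠ 0, u (j z) = z ^ d * Complex.exp (g z))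
    (huρ : ∀ w ≠ 0, u (ρ w) = w ^ e * Complex.exp (h w)) : a * d = e := by
  have hne : ∀ w : ℂ, w ≠ 0 → w ^ a * Complex.exp (α w) ≠ 0 := fun w hw =>
    mul_ne_zero (zpow_ne_zero _ hw) (Complex.exp_ne_zero _)
  refine eq_of_zpow_mul_exp_eq (g := fun w => d * α w + g (w ^ a * Complex.exp (α w))) (h := h)
    ?_ hh ?_
  · refine (continuousOn_const.mul hα).add (hg.comp ?_ hne)
    exact ContinuousOn.mul (fun w hw => (continuousAt_zpow₀ w a (Or.inl hw)).continuousWithinAt)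
      (Complex.continuous_exp.comp_continuousOn hα)
  · intro w hw
    rw [← huρ w hw, hρ w hw, hu _ (hne w hw), mul_zpow, ← zpow_mul, Complex.exp_add,
      Complex.exp_int_mul]
    ring

theorem exists_winding {E : Type*} [TopologicalSpace E] {j : ℂ → E} (hj : IsEmbedding j)
    {ρ : ℂ → E} (hρ : ContinuousOn ρ {0}ᶜ) (hmem : ∀ w ≠ 0, ρ w ∈ Set.range j)
    (hne : ∀ w ≠ 0, ρ w ≠ j 0) :
    ∃ (a : ℤ) (α : ℂ → ℂ), ContinuousOn α {0}ᶜ ∧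
      ∀ w ≠ 0, ρ w = j (w ^ a * Complex.exp (α w)) := by
  have hinv : ∀ w ≠ 0, j (Function.invFun j (ρ w)) = ρ w := fun w hw =>
    Function.invFun_eq (hmem w hw)
  obtain ⟨a, α, hα, h⟩ := exists_eq_zpow_mul_exp (u := fun w => Function.invFun j (ρ w))
    ((continuousOn_invFun hj).comp hρ hmem)
    (fun w hw h0 => hne w hw (by rw [← hinv w hw, h0]))
  exact ⟨a, α, hα, fun w hw => by rw [← h w hw, hinv w hw]⟩

/-- The sheets `m` and `m'` are two ways of laying a disk in the book. If their loops wind `a` and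
`b` times in a planar chart and `u₁`, `u₂` have degrees `d₁`, `d₂`, then `a d₁ = b d₁ = 1`, `a d₂ =
-1` and `b d₂ = 0`. The last equation needs `b = 0` or `d₂ = 0`, and the others exclude both. -/
theorem LocallyPlanarAt.false_of_book {E : Type*} [TopologicalSpace E] {X : Set E} {p : E}
    (h : LocallyPlanarAt X p) {u₁ u₂ : E → ℂ} (hu₁ : ContinuousOn u₁ X) (hu₂ : ContinuousOn u₂ X)
    {U : Set E} (hU : U ∈ 𝓝 p) (hne₁ : ∀ z ∈ X ∩ U, z ≠ p → u₁ z ≠ 0)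
    (hne₂ : ∀ z ∈ X ∩ U, z ≠ p → u₂ z ≠ 0) {m m' : ℂ → E} (hm : Continuous m)
    (hm' : Continuous m') (hm0 : m 0 = p) (hm0' : m' 0 = p)
    (hmX : ∀ᶠ w in 𝓝 0, m w ∈ X) (hmX' : ∀ᶠ w in 𝓝 0, m' w ∈ X)
    (h₁ : ∀ᶠ w in 𝓝 0, u₁ (m w) = w) (h₁' : ∀ᶠ w in 𝓝 0, u₁ (m' w) = w)
    (h₂ : ∀ᶠ w in 𝓝 0, u₂ (m w) = (starRingEnd ℂ) w)
    (h₂' : ∀ᶠ w in 𝓝 0, u₂ (m' w) = w.re - |w.im| * Complex.I) : False := by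
  obtain ⟨j, hj, h0, hr, hn⟩ := h U hU
  have key : ∀ n : ℂ → E, Continuous n → n 0 = p → (∀ᶠ w in 𝓝 0, n w ∈ X) →
      ∀ᶠ w in 𝓝 0, n w ∈ Set.range j := by
    intro n hn' hn0 hnX
    have : Tendsto n (𝓝 0) (𝓝[X] p) :=
      tendsto_nhdsWithin_iff.2 ⟨hn0 ▸ hn'.tendsto 0, hnX⟩
    exact this.eventually hn
  obtain ⟨ε, hε, H⟩ := Metric.nhds_basis_closedBall.eventually_iff.1
    (((key m hm hm0 hmX).and (key m' hm' hm0' hmX')).and ((h₁.and h₁').and (h₂.and h₂')))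
  have hp : u₁ p = 0 := by
    have := h₁.self_of_nhds
    rwa [hm0] at this
  set σ : ℂ → ℂ := fun w => ((ε / ‖w‖ : ℝ) : ℂ) * w with hσ
  have hσc : ContinuousOn σ {0}ᶜ := continuousOn_scaled ε
  have hσn : ∀ w ≠ 0, ‖σ w‖ = ε := fun w hw => norm_scaled hε hw
  have hσ0 : ∀ w ≠ 0, σ w ≠ 0 := fun w hw h => by
    have := hσn w hw
    rw [h] at this
    simp at this
    exact hε.ne this
  have Hσ := fun (w : ℂ) (hw : w ≠ 0) =>
    H (x := σ w) (mem_closedBall_zero_iff.2 (hσn w hw).le)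
  have hlog := continuousOn_log_scaled hε
  obtain ⟨a, α, hα, ha⟩ := exists_winding hj (ρ := fun w => m (σ w)) (hm.comp_continuousOn hσc)
    (fun w hw => (Hσ w hw).1.1) (fun w hw he => by
      have h1 := (Hσ w hw).2.1.1
      rw [he, h0, hp] at h1
      exact hσ0 w hw h1.symm)
  obtain ⟨b, β, hβ, hb⟩ := exists_winding hj (ρ := fun w => m' (σ w)) (hm'.comp_continuousOn hσc)
    (fun w hw => (Hσ w hw).1.2) (fun w hw he => by
      have h1 := (Hσ w hw).2.1.2
      rw [he, h0, hp] at h1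
      exact hσ0 w hw h1.symm)
  have hjX : ∀ w, j w ∈ X := fun w => (hr ⟨w, rfl⟩).1
  have hjp : ∀ w ≠ 0, j w ≠ p := fun w hw he => hw (hj.injective (he.trans h0.symm))
  obtain ⟨d₁, g₁, hg₁, hd₁⟩ := exists_eq_zpow_mul_exp (u := fun w => u₁ (j w))
    (hu₁.comp_continuous hj.continuous hjX).continuousOn
    (fun w hw => hne₁ _ (hr ⟨w, rfl⟩) (hjp w hw))
  obtain ⟨d₂, g₂, hg₂, hd₂⟩ := exists_eq_zpow_mul_exp (u := fun w => u₂ (j w))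
    (hu₂.comp_continuous hj.continuous hjX).continuousOn
    (fun w hw => hne₂ _ (hr ⟨w, rfl⟩) (hjp w hw))
  have e1 : a * d₁ = 1 := mul_eq_of_winding hα hg₁ hlog ha hd₁
    (fun w hw => (Hσ w hw).2.1.1.trans (scaled_eq_zpow_mul_exp hε hw))
  have e2 : b * d₁ = 1 := mul_eq_of_winding hβ hg₁ hlog hb hd₁
    (fun w hw => (Hσ w hw).2.1.2.trans (scaled_eq_zpow_mul_exp hε hw))
  have e3 : a * d₂ = -1 := by
    -- The conjugate of `(ε / ‖w‖) w` is `ε ‖w‖ w⁻¹`.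
    refine mul_eq_of_winding hα hg₂ (h := fun w => ((Real.log (ε * ‖w‖) : ℝ) : ℂ)) ?_ ha hd₂
      (fun w hw => (Hσ w hw).2.2.1.trans ?_)
    · refine Complex.continuous_ofReal.comp_continuousOn (ContinuousOn.log (by fun_prop) ?_)
      intro w hw
      have : w ≠ 0 := hw
      positivity
    · have hw' : ‖w‖ ≠ 0 := norm_ne_zero_iff.2 hw
      have hw'' : (‖w‖ : ℂ) ≠ 0 := Complex.ofReal_ne_zero.2 hw'
      rw [← Complex.ofReal_exp, Real.exp_log (by positivity), zpow_neg_one]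
      simp only [hσ, map_mul, Complex.conj_ofReal]
      have h3 : (starRingEnd ℂ) w * w = (‖w‖ : ℂ) ^ 2 := Complex.conj_mul' w
      push_cast
      field_simp
      linear_combination ε * h3
  have e4 : b * d₂ = 0 := by
    -- The folded sheet only reaches the closed lower half-plane. Multiplication by `I` carries this
    -- to the closed right half-plane, on which the principal logarithm is continuous away from `0`.
    refine mul_eq_of_winding hβ hg₂ (h := fun w => Complex.log
      (|(σ w).im| + (σ w).re * Complex.I) - Complex.log Complex.I) ?_ hb hd₂
      (fun w hw => (Hσ w hw).2.2.2.trans ?_)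
    · refine ContinuousOn.sub (ContinuousOn.clog ?_ ?_) continuousOn_const
      · have h1 : ContinuousOn (fun w => ((|(σ w).im| : ℝ) : ℂ)) {0}ᶜ :=
          Complex.continuous_ofReal.comp_continuousOn
            (continuous_abs.comp_continuousOn (Complex.continuous_im.comp_continuousOn hσc))
        have h2 : ContinuousOn (fun w => (((σ w).re : ℝ) : ℂ)) {0}ᶜ :=
          Complex.continuous_ofReal.comp_continuousOn (Complex.continuous_re.comp_continuousOn hσc)
        exact h1.add (h2.mul continuousOn_const)
      · intro w hw
        rw [Complex.mem_slitPlane_iff]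
        by_contra! hcon
        have h1 : (σ w).re = 0 := by simpa using hcon.2
        have h2 : |(σ w).im| ≤ 0 := by simpa using hcon.1
        exact hσ0 w hw (Complex.ext h1 (abs_nonpos_iff.1 h2))
    · have hne : ((|(σ w).im| : ℝ) : ℂ) + (σ w).re * Complex.I ≠ 0 := by
        intro he
        have h1 := congrArg Complex.re he
        have h2 := congrArg Complex.im he
        simp at h1 h2
        exact hσ0 w hw (Complex.ext h2 h1)
      rw [zpow_zero, one_mul, Complex.exp_sub, Complex.exp_log hne, Complex.exp_log Complex.I_ne_zero,
        eq_div_iff Complex.I_ne_zero]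
      linear_combination -((|(σ w).im| : ℝ) : ℂ) * Complex.I_sq
  rcases mul_eq_zero.1 e4 with h | h
  · simp [h] at e2
  · simp [h] at e3

/-! ### Barycentric coordinates on two-dimensional complexes. -/

/-- `w` is the vector of barycentric coordinates of `z` in the convex hull of `s`. -/
structure IsWeight {N : ℕ} (s : Finset (Euc N)) (w : Euc N → ℝ) (z : Euc N) : Prop where
  nonneg : ∀ v, 0 ≤ w v
  support : ∀ v, v ∉ s → w v = 0
  sum_one : ∑ v ∈ s, w v = 1
  sum_smul : ∑ v ∈ s, w v • v = z

namespace IsWeight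

variable {N : ℕ} {s t : Finset (Euc N)} {w : Euc N → ℝ} {z : Euc N}

theorem mono (h : IsWeight s w z) (hst : s ⊆ t) : IsWeight t w z where
  nonneg := h.nonneg
  support v hv := h.support v (fun hs => hv (hst hs))
  sum_one := by
    rw [← h.sum_one]
    exact (Finset.sum_subset hst (fun v _ hv => h.support v hv)).symm
  sum_smul := by
    rw [← h.sum_smul]
    exact (Finset.sum_subset hst (fun v _ hv => by rw [h.support v hv, zero_smul])).symm

theorem of_subset (h : IsWeight t w z) (hst : s ⊆ t) (hs : ∀ v, v ∉ s → w v = 0) :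
    IsWeight s w z where
  nonneg := h.nonneg
  support := hs
  sum_one := by
    rw [← h.sum_one]
    exact Finset.sum_subset hst (fun v _ hv => hs v hv)
  sum_smul := by
    rw [← h.sum_smul]
    exact Finset.sum_subset hst (fun v _ hv => by rw [hs v hv, zero_smul])

theorem mem_convexHull (h : IsWeight s w z) : z ∈ convexHull ℝ (s : Set (Euc N)) := by
  rw [← h.sum_smul]
  exact (convex_convexHull ℝ _).sum_mem (fun v _ => h.nonneg v) h.sum_one
    (fun v hv => subset_convexHull ℝ _ hv)

theorem exists_iff : (∃ w, IsWeight s w z) ↔ z ∈ convexHull ℝ (s : Set (Euc N)) := by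
  refine ⟨fun ⟨w, h⟩ => h.mem_convexHull, fun h => ?_⟩
  obtain ⟨w, h0, h1, h2⟩ := Finset.mem_convexHull'.1 h
  refine ⟨fun v => if v ∈ s then w v else 0, ?_, ?_, ?_, ?_⟩
  · intro v
    split_ifs with hv
    exacts [h0 v hv, le_rfl]
  · intro v hv
    simp [hv]
  · rw [← h1]
    exact Finset.sum_congr rfl (fun v hv => by simp [hv])
  · rw [← h2]
    exact Finset.sum_congr rfl (fun v hv => by simp [hv])

theorem eq_of_affineIndependent (hs : AffineIndependent ℝ ((↑) : s → Euc N)) {w' : Euc N → ℝ}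
    (h : IsWeight s w z) (h' : IsWeight s w' z) : w = w' := by
  have key := affineIndependent_iff.1 hs Finset.univ (fun v => w v - w' v)
    (by
      rw [Finset.sum_sub_distrib, Finset.sum_coe_sort s w, Finset.sum_coe_sort s w', h.sum_one,
        h'.sum_one, sub_self])
    (by
      simp only [sub_smul]
      rw [Finset.sum_sub_distrib, Finset.sum_coe_sort s (fun v => w v • v),
        Finset.sum_coe_sort s (fun v => w' v • v), h.sum_smul, h'.sum_smul, sub_self])
  ext v
  by_cases hv : v ∈ s
  · exact sub_eq_zero.1 (key ⟨v, hv⟩ (Finset.mem_univ _))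
  · rw [h.support v hv, h'.support v hv]

theorem vertex {v : Euc N} : IsWeight {v} (fun x => if x = v then 1 else 0) v where
  nonneg x := by split_ifs <;> norm_num
  support x hx := by simpa using hx
  sum_one := by simp
  sum_smul := by simp

end IsWeight

/-- Barycentric coordinates are unique across the simplices of the family `A`. -/
def UniqueWeights {N : ℕ} (A : Set (Finset (Euc N))) : Prop :=
  ∀ s ∈ A, ∀ t ∈ A, ∀ (w w' : Euc N → ℝ) (z : Euc N), IsWeight s w z → IsWeight t w' z → w = w'

namespace TwoComplex

variable {N : ℕ}

/-- A common point of two simplices lies in the hull of their common vertices. Its coordinates there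
serve for both simplices, in each of which coordinates are unique. -/
theorem uniqueWeights (K : TwoComplex N) : UniqueWeights K.faces := by
  intro s hs t ht w w' z h h'
  have hz := K.inter_subset_convexHull hs ht ⟨h.mem_convexHull, h'.mem_convexHull⟩
  rw [← Finset.coe_inter] at hz
  obtain ⟨u, hu⟩ := IsWeight.exists_iff.2 hz
  rw [IsWeight.eq_of_affineIndependent (K.indep hs) h (hu.mono Finset.inter_subset_left),
    IsWeight.eq_of_affineIndependent (K.indep ht) h' (hu.mono Finset.inter_subset_right)]

/-- A nontrivial affine dependence could be added, suitably scaled, to the equal weights of the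
barycenter, giving a second set of weights for the same point. -/
theorem affineIndependent_of_uniqueWeights {s : Finset (Euc N)}
    (H : ∀ (w w' : Euc N → ℝ) (z : Euc N), IsWeight s w z → IsWeight s w' z → w = w') :
    AffineIndependent ℝ ((↑) : s → Euc N) := by
  rcases s.eq_empty_or_nonempty with rfl | hne
  · exact affineIndependent_of_subsingleton ℝ _
  rw [affineIndependent_iff]
  intro t c hc0 hc1 v hv
  set c' : Euc N → ℝ := fun x => if hx : x ∈ s then (if (⟨x, hx⟩ : s) ∈ t then c ⟨x, hx⟩ else 0)
    else 0 with hc'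
  have hsum : ∀ {M : Type} [AddCommMonoid M] [Module ℝ M] (f : Euc N → M),
      ∑ x ∈ s, c' x • f x = ∑ x ∈ t, c x • f x := by
    intro M _ _ f
    rw [← Finset.sum_coe_sort s (fun x => c' x • f x),
      ← Finset.sum_subset (Finset.subset_univ t)]
    · exact Finset.sum_congr rfl (fun x hx => by simp [hc', hx])
    · intro x _ hx
      simp [hc', hx]
  have h0 : ∑ x ∈ s, c' x = 0 := by
    have := hsum (fun _ => (1 : ℝ))
    simpa [hc0] using this
  have h1 : ∑ x ∈ s, c' x • x = 0 := by
    rw [hsum (fun x => x)]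
    exact hc1
  obtain ⟨B, hB0, hB⟩ : ∃ B : ℝ, 0 < B ∧ ∀ x ∈ s, |c' x| ≤ B :=
    ⟨1 + ∑ x ∈ s, |c' x|, by positivity, fun x hx => by
      linarith [Finset.single_le_sum (f := fun x => |c' x|) (fun _ _ => abs_nonneg _) hx]⟩
  have hcard : (0 : ℝ) < s.card := by exact_mod_cast hne.card_pos
  have hw : IsWeight s (fun x => if x ∈ s then (s.card : ℝ)⁻¹ else 0)
      (∑ x ∈ s, (s.card : ℝ)⁻¹ • x) := by
    refine ⟨fun x => ?_, fun x hx => by simp [hx], ?_, ?_⟩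
    · split_ifs <;> positivity
    · rw [Finset.sum_congr rfl (fun x hx => if_pos hx)]
      simp [hcard.ne']
    · exact Finset.sum_congr rfl (fun x hx => by simp [hx])
  -- As `B` bounds all `|c' x|`, the perturbation never exceeds the weight `1 / s.card` in size.
  have hw' : IsWeight s (fun x => if x ∈ s then (s.card : ℝ)⁻¹ + (s.card : ℝ)⁻¹ / B * c' x else 0)
      (∑ x ∈ s, (s.card : ℝ)⁻¹ • x) := by
    refine ⟨fun x => ?_, fun x hx => by simp [hx], ?_, ?_⟩
    · split_ifs with hx
      · have h2 := abs_le.1 (hB x hx)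
        have : (s.card : ℝ)⁻¹ + (s.card : ℝ)⁻¹ / B * c' x = (s.card : ℝ)⁻¹ / B * (B + c' x) := by
          field_simp
        rw [this]
        exact mul_nonneg (by positivity) (by linarith)
      · exact le_rfl
    · rw [Finset.sum_congr rfl (fun x hx => if_pos hx), Finset.sum_add_distrib, ← Finset.mul_sum,
        h0]
      simp [hcard.ne']
    · rw [Finset.sum_congr rfl (g := fun x => (s.card : ℝ)⁻¹ • x +
        ((s.card : ℝ)⁻¹ / B) • (c' x • x)) (fun x hx => by
          rw [if_pos hx, add_smul, mul_smul]),
        Finset.sum_add_distrib, ← Finset.smul_sum (r := (s.card : ℝ)⁻¹ / B), h1, smul_zero, add_zero]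
  have := congrFun (H _ _ _ hw hw') v
  simp only [if_pos v.2] at this
  have h3 : (s.card : ℝ)⁻¹ / B * c' v = 0 := by linarith
  have h4 : c' v = 0 := (mul_eq_zero.1 h3).resolve_left (div_pos (inv_pos.2 hcard) hB0).ne'
  have h5 : c' v = c v := by
    simp only [hc']
    rw [dif_pos v.2, if_pos hv]
  rwa [h5] at h4

/-- A finite down-closed family of sets of at most three points with unique barycentric
coordinates is a complex. -/
def ofUniqueWeights (A : Set (Finset (Euc N))) (hfin : A.Finite)
    (hcard : ∀ s ∈ A, s.card ≤ 3) (hne : ∀ s ∈ A, s.Nonempty)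
    (hdown : ∀ s ∈ A, ∀ t ⊆ s, t.Nonempty → t ∈ A) (huniq : UniqueWeights A) : TwoComplex N where
  faces := A
  isRelLowerSet_faces := fun s hs => ⟨hne s hs, fun t hts ht => hdown s hs t hts ht⟩
  indep hs := affineIndependent_of_uniqueWeights (fun w w' z => huniq _ hs _ hs w w' z)
  inter_subset_convexHull := by
    rintro s t hs ht z ⟨hzs, hzt⟩
    obtain ⟨w, hw⟩ := IsWeight.exists_iff.2 hzs
    obtain ⟨w', hw'⟩ := IsWeight.exists_iff.2 hzt
    obtain rfl := huniq s hs t ht w w' z hw hw'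
    rw [← Finset.coe_inter]
    refine (hw.of_subset Finset.inter_subset_left ?_).mem_convexHull
    intro v hv
    rw [Finset.mem_inter, not_and_or] at hv
    exact hv.elim (hw.support v) (hw'.support v)
  finite_faces := hfin
  card_le_three := hcard

/-- Barycentric coordinates of the points of `K`. -/
noncomputable def bary (K : TwoComplex N) (z : Euc N) : Euc N → ℝ :=
  if h : ∃ w, ∃ s ∈ K.faces, IsWeight s w z then h.choose else 0

theorem bary_eq (K : TwoComplex N) {s : Finset (Euc N)} (hs : s ∈ K.faces) {w : Euc N → ℝ}
    {z : Euc N} (h : IsWeight s w z) : K.bary z = w := by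
  have hex : ∃ w, ∃ s ∈ K.faces, IsWeight s w z := ⟨w, s, hs, h⟩
  obtain ⟨t, ht, h'⟩ := hex.choose_spec
  rw [bary, dif_pos hex]
  exact K.uniqueWeights t ht s hs _ _ z h' h

theorem isWeight_bary (K : TwoComplex N) {s : Finset (Euc N)} (hs : s ∈ K.faces) {z : Euc N}
    (hz : z ∈ convexHull ℝ (s : Set (Euc N))) : IsWeight s (K.bary z) z := by
  obtain ⟨w, hw⟩ := IsWeight.exists_iff.2 hz
  rwa [K.bary_eq hs hw]

/-- The carrier of `z`, the simplex with `z` in its relative interior, is spanned by the vertices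
with positive coordinate. -/
theorem exists_carrier (K : TwoComplex N) {z : Euc N} (hz : z ∈ K.space) :
    ∃ s ∈ K.faces, IsWeight s (K.bary z) z ∧ ∀ v, v ∈ s ↔ 0 < K.bary z v := by
  obtain ⟨s, hs, hz⟩ := Geometry.SimplicialComplex.mem_space_iff.1 hz
  have h := K.isWeight_bary hs hz
  have hmem : ∀ v, v ∈ s.filter (fun v => 0 < K.bary z v) ↔ 0 < K.bary z v := by
    intro v
    rw [Finset.mem_filter, and_iff_right_iff_imp]
    intro hv
    by_contra hvs
    rw [h.support v hvs] at hv
    exact hv.false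
  have hw := h.of_subset (Finset.filter_subset (fun v => 0 < K.bary z v) s) (fun v hv => by
    rw [hmem] at hv
    exact le_antisymm (not_lt.1 hv) (h.nonneg v))
  refine ⟨_, K.down_closed hs (Finset.filter_subset _ _) ?_, hw, hmem⟩
  by_contra hne
  have := hw.sum_one
  rw [Finset.not_nonempty_iff_eq_empty.1 hne] at this
  simp at this

/-- The set is a finite union, over the simplices, of continuous images of compact subsets of
standard simplices. This yields continuity of the coordinates across simplices. -/
theorem isClosed_bary_preimage (K : TwoComplex N) (v : Euc N) {C : Set ℝ} (hC : IsClosed C) :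
    IsClosed {z | z ∈ K.space ∧ K.bary z v ∈ C} := by
  have : {z | z ∈ K.space ∧ K.bary z v ∈ C} = ⋃ s ∈ K.faces,
      (fun w : s → ℝ => ∑ x, w x • (x : Euc N)) ''
        {w | w ∈ stdSimplex ℝ s ∧ (if h : v ∈ s then w ⟨v, h⟩ else 0) ∈ C} := by
    ext z
    simp only [Set.mem_ofPred_eq, Set.mem_iUnion, Set.mem_image, exists_prop]
    constructor
    · rintro ⟨hz, hC⟩
      obtain ⟨s, hs, h, -⟩ := K.exists_carrier hz
      refine ⟨s, hs, fun x => K.bary z x, ⟨⟨fun x => h.nonneg x, ?_⟩, ?_⟩, ?_⟩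
      · rw [Finset.sum_coe_sort s (K.bary z), h.sum_one]
      · split_ifs with hv
        · exact hC
        · rwa [h.support v hv] at hC
      · rw [Finset.sum_coe_sort s (fun x => K.bary z x • x), h.sum_smul]
    · rintro ⟨s, hs, w, ⟨⟨hw0, hw1⟩, hwC⟩, rfl⟩
      have h : IsWeight s (fun x => if h : x ∈ s then w ⟨x, h⟩ else 0)
          (∑ x, w x • (x : Euc N)) := by
        refine ⟨fun x => ?_, fun x hx => by simp [hx], ?_, ?_⟩
        · split_ifs with hx
          exacts [hw0 _, le_rfl]
        · rw [← hw1, ← Finset.sum_coe_sort s]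
          simp
        · rw [← Finset.sum_coe_sort s]
          simp
      refine ⟨K.convexHull_subset_space hs h.mem_convexHull, ?_⟩
      rw [K.bary_eq hs h]
      exact hwC
  rw [this]
  refine K.finite_faces.isClosed_biUnion (fun s _ => ?_)
  have hcpt : IsCompact {w : s → ℝ | w ∈ stdSimplex ℝ s ∧ (if h : v ∈ s then w ⟨v, h⟩ else 0) ∈ C} := by
    refine (isCompact_stdSimplex ℝ s).inter_right (IsClosed.preimage ?_ hC)
    split_ifs with h <;> fun_prop
  exact (hcpt.image (by fun_prop)).isClosed

theorem continuousOn_bary (K : TwoComplex N) (v : Euc N) :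
    ContinuousOn (fun z => K.bary z v) K.space := by
  rw [continuousOn_iff_isClosed]
  intro C hC
  refine ⟨_, K.isClosed_bary_preimage v hC, ?_⟩
  ext z
  simp [and_comm]

/-- A chart is restricted to the preimage of a small ball inside the given neighborhood, and the
open ball is stretched to the whole plane. -/
theorem locallyPlanarAt (K : TwoComplex N) (hK : K.IsSimplicialSurface) {p : Euc N}
    (hp : p ∈ K.space) : LocallyPlanarAt K.space p := by
  intro U hU
  obtain ⟨-, ⟨hch⟩⟩ := hK
  let e : OpenPartialHomeomorph K.space (Euc 2) := chartAt (Euc 2) (⟨p, hp⟩ : K.space)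
  have hpe : (⟨p, hp⟩ : K.space) ∈ e.source := mem_chart_source _ _
  obtain ⟨V, hVU, hV, hpV⟩ := mem_nhds_iff.1 hU
  have hW : e.symm.source ∩ e.symm ⁻¹' ((↑) ⁻¹' V) ∈ 𝓝 (e ⟨p, hp⟩) := by
    refine (e.symm.isOpen_inter_preimage (hV.preimage continuous_subtype_val)).mem_nhds ⟨?_, ?_⟩
    · exact e.map_source hpe
    · simpa [e.left_inv hpe] using hpV
  obtain ⟨δ, hδ, hball⟩ := Metric.mem_nhds_iff.1 hW
  let b := OpenPartialHomeomorph.univBall (e ⟨p, hp⟩) δ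
  have hbs : b.source = Set.univ := OpenPartialHomeomorph.univBall_source _ _
  have hbt : b.target = Metric.ball (e ⟨p, hp⟩) δ := OpenPartialHomeomorph.univBall_target _ hδ
  let i : ℂ ≃ₜ Euc 2 := Complex.orthonormalBasisOneI.repr.toHomeomorph
  let F := b.trans e.symm
  have hF : F.source = Set.univ := by
    rw [OpenPartialHomeomorph.trans_source, hbs, Set.univ_inter, Set.eq_univ_iff_forall]
    intro x
    have := b.map_source (x := x) (by simp [hbs])
    rw [hbt] at this
    exact (hball this).1
  have hFe : IsOpenEmbedding F := F.isOpenEmbedding hF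
  have hF0 : F 0 = ⟨p, hp⟩ := by
    simp [F, b, e.left_inv hpe]
  have hj : IsOpenEmbedding (fun z => F (i z)) := hFe.comp i.isOpenEmbedding
  have hi0 : i 0 = 0 := map_zero Complex.orthonormalBasisOneI.repr
  refine ⟨fun z => (F (i z) : Euc N), IsEmbedding.subtypeVal.comp hj.isEmbedding, ?_, ?_, ?_⟩
  · simp only [hi0, hF0]
  · rintro _ ⟨z, rfl⟩
    refine ⟨(F (i z)).2, hVU ?_⟩
    have := b.map_source (x := i z) (by simp [hbs])
    rw [hbt] at this
    exact (hball this).2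
  · have h1 : Set.range (fun z => F (i z)) ∈ 𝓝 (⟨p, hp⟩ : K.space) :=
      hj.isOpen_range.mem_nhds ⟨0, by simp only [hi0, hF0]⟩
    rw [nhdsWithin_eq_map_subtype_coe hp]
    refine Filter.mem_map.2 (Filter.mem_of_superset h1 ?_)
    rintro _ ⟨z, rfl⟩
    exact ⟨z, rfl⟩

end TwoComplex

theorem Finset.pair_subset {α : Type*} [DecidableEq α] {s : Finset α} {a b : α} (ha : a ∈ s)
    (hb : b ∈ s) : {a, b} ⊆ s := by
  simp [Finset.insert_subset_iff, ha, hb]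

theorem Finset.triple_subset {α : Type*} [DecidableEq α] {s : Finset α} {a b c : α} (ha : a ∈ s)
    (hb : b ∈ s) (hc : c ∈ s) : {a, b, c} ⊆ s := by
  simp [Finset.insert_subset_iff, ha, hb, hc]

theorem Finset.triple_rotate {α : Type*} [DecidableEq α] (a b c : α) :
    ({a, b, c} : Finset α) = {c, a, b} := by
  ext x; simp; tauto

theorem IsWeight.convexComb {N : ℕ} {s : Finset (Euc N)} {w w' : Euc N → ℝ} {z z' : Euc N}
    (h : IsWeight s w z) (h' : IsWeight s w' z') {α β : ℝ} (hα : 0 ≤ α) (hβ : 0 ≤ β)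
    (hαβ : α + β = 1) : IsWeight s (fun v => α * w v + β * w' v) (α • z + β • z') where
  nonneg v := add_nonneg (mul_nonneg hα (h.nonneg v)) (mul_nonneg hβ (h'.nonneg v))
  support v hv := by simp [h.support v hv, h'.support v hv]
  sum_one := by
    rw [Finset.sum_add_distrib, ← Finset.mul_sum, ← Finset.mul_sum, h.sum_one, h'.sum_one]
    linarith
  sum_smul := by
    simp only [add_smul, mul_smul]
    rw [Finset.sum_add_distrib, ← Finset.smul_sum, ← Finset.smul_sum, h.sum_smul, h'.sum_smul]

/-! ### Local structure of a surface: connected links, two triangles at each edge. -/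

/-- `a` and `b` span a triangle with `v`. -/
def TwoComplex.LinkAdj {N : ℕ} (K : TwoComplex N) (v a b : Euc N) : Prop :=
  a ≠ v ∧ b ≠ v ∧ a ≠ b ∧ {v, a, b} ∈ K.faces

/-- `a` is the other endpoint of an edge at `v`. -/
def TwoComplex.IsNeighbor {N : ℕ} (K : TwoComplex N) (v a : Euc N) : Prop :=
  a ≠ v ∧ {v, a} ∈ K.faces

namespace TwoComplex

variable {N : ℕ} {K : TwoComplex N}

theorem LinkAdj.symm {v a b : Euc N} (h : K.LinkAdj v a b) : K.LinkAdj v b a :=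
  ⟨h.2.1, h.1, h.2.2.1.symm, by rw [Finset.pair_comm b a]; exact h.2.2.2⟩

theorem LinkAdj.rotate {v a b : Euc N} (h : K.LinkAdj v a b) : K.LinkAdj a b v :=
  ⟨h.2.2.1.symm, h.1.symm, h.2.1, by
    rw [Finset.triple_rotate]; exact h.2.2.2⟩

theorem LinkAdj.isNeighbor {v a b : Euc N} (h : K.LinkAdj v a b) : K.IsNeighbor v a :=
  ⟨h.1, K.down_closed h.2.2.2 (Finset.pair_subset (by simp) (by simp)) (by simp)⟩

theorem IsNeighbor.symm {v a : Euc N} (h : K.IsNeighbor v a) : K.IsNeighbor a v :=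
  ⟨h.1.symm, by rw [Finset.pair_comm]; exact h.2⟩

theorem mem_vertices_of_mem {s : Finset (Euc N)} (hs : s ∈ K.faces) {a : Euc N} (ha : a ∈ s) :
    a ∈ K.vertices :=
  K.down_closed hs (Finset.singleton_subset_iff.2 ha) (by simp)

theorem IsNeighbor.mem_vertices {v a : Euc N} (h : K.IsNeighbor v a) : a ∈ K.vertices :=
  mem_vertices_of_mem h.2 (by simp)

theorem finite_vertices (K : TwoComplex N) : K.vertices.Finite := by
  refine Set.Finite.subset (K.finite_faces.biUnion (fun s _ => s.finite_toSet)) ?_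
  intro a ha
  exact Set.mem_biUnion (show {a} ∈ K.faces from ha) (by simp)

theorem bary_vertex {v : Euc N} (hv : v ∈ K.vertices) :
    K.bary v = fun x => if x = v then 1 else 0 :=
  K.bary_eq hv IsWeight.vertex

theorem isWeight_pair {a b : Euc N} (hab : a ≠ b) {x y : ℝ} (hx : 0 ≤ x) (hy : 0 ≤ y)
    (hxy : x + y = 1) :
    IsWeight {a, b} (fun v => if v = a then x else if v = b then y else 0) (x • a + y • b) where
  nonneg v := by split_ifs <;> first | assumption | exact le_rfl
  support v hv := by simp_all
  sum_one := by rw [Finset.sum_pair hab]; simp [hab.symm, hxy]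
  sum_smul := by rw [Finset.sum_pair hab]; simp [hab.symm]

theorem isWeight_triple {a b c : Euc N} (hab : a ≠ b) (hac : a ≠ c) (hbc : b ≠ c) {x y z : ℝ}
    (hx : 0 ≤ x) (hy : 0 ≤ y) (hz : 0 ≤ z) (hxyz : x + y + z = 1) :
    IsWeight {a, b, c} (fun v => if v = a then x else if v = b then y else if v = c then z else 0)
      (x • a + y • b + z • c) where
  nonneg v := by split_ifs <;> first | assumption | exact le_rfl
  support v hv := by simp_all
  sum_one := by
    rw [Finset.sum_insert (by simp [hab, hac]), Finset.sum_pair hbc]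
    simp [hab.symm, hac.symm, hbc.symm, ← hxyz, add_assoc]
  sum_smul := by
    rw [Finset.sum_insert (by simp [hab, hac]), Finset.sum_pair hbc]
    simp [hab.symm, hac.symm, hbc.symm, add_assoc]

theorem mem_segment_space {v a : Euc N} (h : K.IsNeighbor v a) {t : ℝ} (ht0 : 0 ≤ t)
    (ht1 : t ≤ 1) : (1 - t) • v + t • a ∈ K.space :=
  K.convexHull_subset_space h.2
    (isWeight_pair h.1.symm (by linarith) ht0 (by ring)).mem_convexHull

theorem bary_segment {v a : Euc N} (h : K.IsNeighbor v a) {t : ℝ} (ht0 : 0 ≤ t)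
    (ht1 : t ≤ 1) (x : Euc N) : K.bary ((1 - t) • v + t • a) x =
      if x = v then 1 - t else if x = a then t else 0 := by
  rw [K.bary_eq h.2 (isWeight_pair h.1.symm (by linarith) ht0 (by ring))]

/-- Within `K.space` this neighborhood is the open star of `v`. -/
theorem nhds_bary_pos {p v : Euc N} (hp : 0 < K.bary p v) :
    {z | z ∈ K.space ∧ K.bary z v ∈ Set.Iic (0 : ℝ)}ᶜ ∈ 𝓝 p :=
  (K.isClosed_bary_preimage v isClosed_Iic).isOpen_compl.mem_nhds (fun h => not_le.2 hp h.2)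

theorem eq_of_carrier_vertex {v z : Euc N} (hz : z ∈ K.space)
    (h : ∀ a, 0 < K.bary z a → a = v) : z = v := by
  obtain ⟨s, hs, hw, hmem⟩ := K.exists_carrier hz
  have hsub : s ⊆ {v} := fun a ha => by simpa using h a ((hmem a).1 ha)
  have h2 := hw.mono hsub
  have h3 := h2.sum_one
  have h4 := h2.sum_smul
  simp only [Finset.sum_singleton] at h3 h4
  rw [← h4, h3, one_smul]

/-- Every edge path in the link of a vertex of a surface stays in one piece. -/
theorem link_connected (hK : K.IsSimplicialSurface) {v : Euc N} (hv : v ∈ K.vertices)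
    (A : Set (Euc N)) (hA : ∀ a b, K.LinkAdj v a b → a ∈ A → b ∈ A)
    {a b : Euc N} (ha : K.IsNeighbor v a) (haA : a ∈ A) (hb : K.IsNeighbor v b) : b ∈ A := by
  by_contra hbA
  have hvs : v ∈ K.space := K.vertices_subset_space hv
  let V := K.finite_vertices.toFinset.filter (fun x => x ≠ v)
  have hV : ∀ x, x ∈ V ↔ x ∈ K.vertices ∧ x ≠ v := fun x => by simp [V]
  -- In a simplex at `v` the vertices other than `v` are all in `A` or all outside `A`. So near `v`
  -- the function vanishes only at `v`, while it takes both signs along the edges to `a` and `b`.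
  let f : Euc N → ℝ := fun z => ∑ x ∈ V, (if x ∈ A then 1 else -1) * K.bary z x
  have hf : ContinuousOn f K.space :=
    continuousOn_finsetSum _ (fun x _ => continuousOn_const.mul (K.continuousOn_bary x))
  have hfreq : ∀ c, K.IsNeighbor v c → ∀ P : Euc N → Prop,
      (∀ t : ℝ, 0 < t → t < 1 → P ((1 - t) • v + t • c)) → ∃ᶠ z in 𝓝[K.space] v, P z := by
    intro c hc P hP
    have h1 : Tendsto (fun t : ℝ => (1 - t) • v + t • c) (𝓝[>] 0) (𝓝[K.space] v) := by
      refine tendsto_nhdsWithin_iff.2 ⟨?_, ?_⟩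
      · have : Continuous (fun t : ℝ => (1 - t) • v + t • c) := by fun_prop
        exact (this.tendsto' 0 v (by simp)).mono_left nhdsWithin_le_nhds
      · filter_upwards [Ioo_mem_nhdsGT (zero_lt_one' ℝ)] with t ht
        exact mem_segment_space hc ht.1.le ht.2.le
    refine h1.frequently (Eventually.frequently ?_)
    filter_upwards [Ioo_mem_nhdsGT (zero_lt_one' ℝ)] with t ht
    exact hP t ht.1 ht.2
  have hfseg : ∀ c, K.IsNeighbor v c → ∀ t : ℝ, 0 < t → t < 1 →
      f ((1 - t) • v + t • c) = (if c ∈ A then 1 else -1) * t := by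
    intro c hc t ht0 ht1
    simp only [f]
    rw [Finset.sum_eq_single_of_mem c ((hV c).2 ⟨hc.mem_vertices, hc.1⟩)]
    · rw [bary_segment hc ht0.le ht1.le, if_neg hc.1, if_pos rfl]
    · intro x hx hxc
      rw [bary_segment hc ht0.le ht1.le, if_neg ((hV x).1 hx).2, if_neg hxc, mul_zero]
  have hne : ∀ c, K.IsNeighbor v c → ∀ t : ℝ, 0 < t → (1 - t) • v + t • c ≠ v := by
    intro c hc t ht he
    have : t • (c - v) = 0 := by
      have : (1 - t) • v + t • c - v = t • (c - v) := by module
      rw [← this, he, sub_self]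
    rcases smul_eq_zero.1 this with h | h
    · exact ht.ne' h
    · exact hc.1 (sub_eq_zero.1 h)
  have hbv : 0 < K.bary v v := by rw [bary_vertex hv]; simp
  refine (K.locallyPlanarAt hK hvs).false_of_separated hf (nhds_bary_pos hbv) ?_
    (hfreq a ha _ fun t ht0 ht1 => ⟨hne a ha t ht0, ?_⟩)
    (hfreq b hb _ fun t ht0 ht1 => ⟨hne b hb t ht0, ?_⟩)
  · rintro z ⟨hz, hzU⟩ hzv
    have hzpos : 0 < K.bary z v := by
      by_contra h
      exact hzU ⟨hz, not_lt.1 h⟩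
    obtain ⟨s, hs, hw, hmem⟩ := K.exists_carrier hz
    have hvs := (hmem v).2 hzpos
    obtain ⟨c, hcpos, hcv⟩ : ∃ c, 0 < K.bary z c ∧ c ≠ v := by
      by_contra! h
      exact hzv (eq_of_carrier_vertex hz h)
    have hcs := (hmem c).2 hcpos
    have hcV : c ∈ V := (hV c).2 ⟨mem_vertices_of_mem hs hcs, hcv⟩
    have hsame : ∀ x ∈ V, 0 < K.bary z x → (x ∈ A ↔ c ∈ A) := by
      intro x hx hxpos
      by_cases hxc : x = c
      · rw [hxc]
      have hxs := (hmem x).2 hxpos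
      have hadj : K.LinkAdj v x c :=
        ⟨((hV x).1 hx).2, hcv, hxc, K.down_closed hs (Finset.triple_subset hvs hxs hcs) (by simp)⟩
      exact ⟨hA x c hadj, hA c x hadj.symm⟩
    have hval : f z = (if c ∈ A then 1 else -1) * ∑ x ∈ V, K.bary z x := by
      rw [Finset.mul_sum]
      refine Finset.sum_congr rfl (fun x hx => ?_)
      rcases (hw.nonneg x).eq_or_lt with h | h
      · rw [← h]; simp
      · simp only [hsame x hx h]
    have hsum : 0 < ∑ x ∈ V, K.bary z x :=
      Finset.sum_pos' (fun x _ => hw.nonneg x) ⟨c, hcV, hcpos⟩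
    rw [hval]
    split_ifs <;> simp [hsum.ne']
  · rw [hfseg a ha t ht0 ht1, if_pos haA]; linarith
  · rw [hfseg b hb t ht0 ht1, if_neg hbA]; linarith

theorem exists_neighbor (hK : K.IsSimplicialSurface) {v : Euc N} (hv : v ∈ K.vertices) :
    ∃ a, K.IsNeighbor v a := by
  have hvs : v ∈ K.space := K.vertices_subset_space hv
  have hbv : 0 < K.bary v v := by rw [bary_vertex hv]; simp
  obtain ⟨z, ⟨hz, hzU⟩, hzv⟩ := (K.locallyPlanarAt hK hvs).not_isolated (nhds_bary_pos hbv)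
  have hzpos : 0 < K.bary z v := by
    by_contra h
    exact hzU ⟨hz, not_lt.1 h⟩
  obtain ⟨s, hs, hw, hmem⟩ := K.exists_carrier hz
  obtain ⟨c, hcpos, hcv⟩ : ∃ c, 0 < K.bary z c ∧ c ≠ v := by
    by_contra! h
    exact hzv (eq_of_carrier_vertex hz h)
  exact ⟨c, hcv, K.down_closed hs (Finset.pair_subset ((hmem v).2 hzpos) ((hmem c).2 hcpos)) (by simp)⟩

section Edge

variable {a b : Euc N}

/-- A neighborhood of the open edge from `a` to `b` that meets only the simplices at this edge. -/
def edgeNhd (K : TwoComplex N) (a b : Euc N) : Set (Euc N) :=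
  {z | z ∈ K.space ∧ K.bary z a ∈ Set.Iic (0 : ℝ)}ᶜ ∩
    {z | z ∈ K.space ∧ K.bary z b ∈ Set.Iic (0 : ℝ)}ᶜ

theorem mem_edgeNhd_inter {z : Euc N} :
    z ∈ K.edgeNhd a b ∩ K.space ↔ z ∈ K.space ∧ 0 < K.bary z a ∧ 0 < K.bary z b := by
  simp only [edgeNhd, Set.mem_inter_iff, Set.mem_compl_iff, Set.mem_ofPred_eq, Set.mem_Iic, not_and,
    not_le]
  tauto

/-- The midpoint of an edge. -/
noncomputable def edgeMid (a b : Euc N) : Euc N := (1 / 2 : ℝ) • a + (1 / 2 : ℝ) • b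

theorem bary_edgeMid (h : K.IsNeighbor a b) (x : Euc N) :
    K.bary (edgeMid a b) x = if x = a then 1 / 2 else if x = b then 1 / 2 else 0 := by
  rw [edgeMid, K.bary_eq h.2 (isWeight_pair h.1.symm (by norm_num) (by norm_num) (by norm_num))]

theorem edgeMid_mem_space (h : K.IsNeighbor a b) : edgeMid a b ∈ K.space :=
  K.convexHull_subset_space h.2
    (isWeight_pair h.1.symm (by norm_num) (by norm_num) (by norm_num)).mem_convexHull

theorem edgeNhd_mem_nhds (h : K.IsNeighbor a b) : K.edgeNhd a b ∈ 𝓝 (edgeMid a b) := by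
  refine inter_mem (nhds_bary_pos ?_) (nhds_bary_pos ?_)
  · rw [bary_edgeMid h]; simp
  · rw [bary_edgeMid h]; simp [h.1]

/-- The triangles at an edge are the only simplices that meet its neighborhood. -/
theorem carrier_edgeNhd (h : K.IsNeighbor a b) {z : Euc N} (hz : z ∈ K.edgeNhd a b ∩ K.space) :
    IsWeight {a, b} (K.bary z) z ∨ ∃ c, K.LinkAdj a b c ∧ IsWeight {a, b, c} (K.bary z) z ∧
      0 < K.bary z c := by
  obtain ⟨hzs, hza, hzb⟩ := mem_edgeNhd_inter.1 hz
  obtain ⟨s, hs, hw, hmem⟩ := K.exists_carrier hzs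
  have ha := (hmem a).2 hza
  have hb := (hmem b).2 hzb
  by_cases hex : ∃ c ∈ s, c ≠ a ∧ c ≠ b
  · obtain ⟨c, hc, hca, hcb⟩ := hex
    right
    have hsub : ({a, b, c} : Finset (Euc N)) ⊆ s := Finset.triple_subset ha hb hc
    have hcard : ({a, b, c} : Finset (Euc N)).card = 3 :=
      Finset.card_eq_three.2 ⟨a, b, c, h.1.symm, hca.symm, hcb.symm, rfl⟩
    have heq : ({a, b, c} : Finset (Euc N)) = s :=
      Finset.eq_of_subset_of_card_le hsub (by rw [hcard]; exact K.card_le_three s hs)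
    exact ⟨c, ⟨h.1, hca, hcb.symm, heq ▸ hs⟩, heq ▸ hw, (hmem c).1 hc⟩
  · push Not at hex
    left
    have heq : s = {a, b} := by
      ext x
      by_cases hxa : x = a
      · simp [hxa, ha]
      · constructor
        · intro hx; simp [hex x hx hxa]
        · intro hx
          have : x = b := by simpa [hxa] using hx
          rwa [this]
    exact heq ▸ hw

theorem eq_edgeMid (h : K.IsNeighbor a b) {z : Euc N} (hz : z ∈ K.edgeNhd a b ∩ K.space)
    (h1 : K.bary z a = K.bary z b) (h2 : K.bary z a + K.bary z b = 1) : z = edgeMid a b := by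
  have h3 : K.bary z a = 1 / 2 := by linarith
  have h4 : K.bary z b = 1 / 2 := by linarith
  rcases carrier_edgeNhd h hz with hw | ⟨c, hc, hw, hcpos⟩
  · have := hw.sum_smul
    rw [Finset.sum_pair h.1.symm, h3, h4] at this
    exact this.symm
  · have := hw.sum_one
    rw [Finset.sum_insert (by simp [h.1.symm, hc.2.1.symm]), Finset.sum_pair hc.2.2.1] at this
    linarith

/-- Without a triangle at the edge, the surface near the midpoint would be an open segment, which
the midpoint separates; the difference of the coordinates at `a` and `b` detects the two sides. -/
theorem exists_linkAdj (hK : K.IsSimplicialSurface) (h : K.IsNeighbor a b) :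
    ∃ c, K.LinkAdj a b c := by
  by_contra! hno
  have hp := edgeMid_mem_space h
  have hfreq : ∀ P : Euc N → Prop, ∀ r : ℝ,
      (∀ t : ℝ, 0 < t → t < 1 → P ((1 / 2 + r * t) • a + (1 / 2 - r * t) • b)) → |r| ≤ 1 / 2 →
        ∃ᶠ z in 𝓝[K.space] (edgeMid a b), P z := by
    intro P r hP hr
    have hr' := abs_le.1 hr
    have h1 : Tendsto (fun t : ℝ => (1 / 2 + r * t) • a + (1 / 2 - r * t) • b) (𝓝[>] 0)
        (𝓝[K.space] (edgeMid a b)) := by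
      refine tendsto_nhdsWithin_iff.2 ⟨?_, ?_⟩
      · have : Continuous (fun t : ℝ => (1 / 2 + r * t) • a + (1 / 2 - r * t) • b) := by fun_prop
        exact (this.tendsto' 0 (edgeMid a b) (by simp [edgeMid])).mono_left nhdsWithin_le_nhds
      · filter_upwards [Ioo_mem_nhdsGT (zero_lt_one' ℝ)] with t ht
        refine K.convexHull_subset_space h.2 (isWeight_pair h.1.symm ?_ ?_ (by ring)).mem_convexHull
        · nlinarith [ht.1, ht.2]
        · nlinarith [ht.1, ht.2]
    refine h1.frequently (Eventually.frequently ?_)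
    filter_upwards [Ioo_mem_nhdsGT (zero_lt_one' ℝ)] with t ht
    exact hP t ht.1 ht.2
  have hval : ∀ t : ℝ, -(1 / 2) ≤ t → t ≤ 1 / 2 →
      K.bary ((1 / 2 + t) • a + (1 / 2 - t) • b) a -
        K.bary ((1 / 2 + t) • a + (1 / 2 - t) • b) b = 2 * t := by
    intro t h1 h2
    rw [K.bary_eq h.2 (isWeight_pair h.1.symm (by linarith) (by linarith) (by ring))]
    simp only [if_pos, if_neg h.1]
    ring
  have hmid : K.bary (edgeMid a b) a - K.bary (edgeMid a b) b = 0 := by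
    simp [bary_edgeMid h]
  have hstep : ∀ r : ℝ, |r| = 1 / 2 → ∀ t : ℝ, 0 < t → t < 1 →
      K.bary ((1 / 2 + r * t) • a + (1 / 2 - r * t) • b) a -
        K.bary ((1 / 2 + r * t) • a + (1 / 2 - r * t) • b) b = 2 * (r * t) := by
    intro r hr t ht0 ht1
    have hr' := abs_le.1 hr.le
    exact hval _ (by nlinarith) (by nlinarith)
  refine (K.locallyPlanarAt hK hp).false_of_separated
    (f := fun z => K.bary z a - K.bary z b)
    ((K.continuousOn_bary a).sub (K.continuousOn_bary b)) (edgeNhd_mem_nhds h) ?_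
    (hfreq _ (1 / 2) (fun t ht0 ht1 => ?_) (by norm_num))
    (hfreq _ (-(1 / 2)) (fun t ht0 ht1 => ?_) (by norm_num))
  · rintro z ⟨hz, hzU⟩ hne h0
    rcases carrier_edgeNhd h ⟨hzU, hz⟩ with hw | ⟨c, hc, -⟩
    · refine hne (eq_edgeMid h ⟨hzU, hz⟩ (sub_eq_zero.1 h0) ?_)
      have := hw.sum_one
      rwa [Finset.sum_pair h.1.symm] at this
    · exact hno c hc
  · have := hstep (1 / 2) (by norm_num) t ht0 ht1
    refine ⟨fun he => ?_, by linarith⟩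
    rw [he, hmid] at this
    linarith
  · have := hstep (-(1 / 2)) (by norm_num) t ht0 ht1
    refine ⟨fun he => ?_, by linarith⟩
    rw [he, hmid] at this
    linarith

/-- With a single triangle, the surface near the midpoint of the edge would be a half-disk with the
midpoint on its boundary. The barycenter of the triangle serves as the inner point, since the
coordinate at `c` is positive there and zero at the midpoint. -/
theorem exists_linkAdj_ne (hK : K.IsSimplicialSurface) {c : Euc N} (hc : K.LinkAdj a b c) :
    ∃ d, d ≠ c ∧ K.LinkAdj a b d := by
  by_contra! hno
  have h := hc.isNeighbor
  have hp := edgeMid_mem_space h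
  have hab := h.1.symm
  have hac := hc.2.1.symm
  have hbc := hc.2.2.1
  have hwt : ∀ z ∈ K.edgeNhd a b ∩ K.space, IsWeight {a, b, c} (K.bary z) z := by
    intro z hz
    rcases carrier_edgeNhd h hz with hw | ⟨d, hd, hw, -⟩
    · exact hw.mono (Finset.pair_subset (by simp) (by simp))
    · by_cases hdc : d = c
      · rwa [← hdc]
      · exact absurd hd (hno d hdc)
  have hq := isWeight_triple hab hac hbc (x := 1 / 3) (y := 1 / 3) (z := 1 / 3) (by norm_num)
    (by norm_num) (by norm_num) (by norm_num)
  have hqb := K.bary_eq hc.2.2.2 hq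
  refine (K.locallyPlanarAt hK hp).false_of_convex (edgeNhd_mem_nhds h) hp ?_
    (q := (1 / 3 : ℝ) • a + (1 / 3 : ℝ) • b + (1 / 3 : ℝ) • c) ?_ ?_ ?_
  · intro z hz z' hz' α β hα hβ hαβ
    have hw := (hwt z hz).convexComb (hwt z' hz') hα hβ hαβ
    have hb := K.bary_eq hc.2.2.2 hw
    rw [mem_edgeNhd_inter] at hz hz' ⊢
    refine ⟨K.convexHull_subset_space hc.2.2.2 hw.mem_convexHull, ?_, ?_⟩
    · rw [hb]
      rcases hα.eq_or_lt with rfl | hα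
      · have : β = 1 := by linarith
        simp [this, hz'.2.1]
      · exact add_pos_of_pos_of_nonneg (mul_pos hα hz.2.1) (mul_nonneg hβ hz'.2.1.le)
    · rw [hb]
      rcases hα.eq_or_lt with rfl | hα
      · have : β = 1 := by linarith
        simp [this, hz'.2.2]
      · exact add_pos_of_pos_of_nonneg (mul_pos hα hz.2.2) (mul_nonneg hβ hz'.2.2.le)
  · rw [mem_edgeNhd_inter, hqb]
    exact ⟨K.convexHull_subset_space hc.2.2.2 hq.mem_convexHull, by simp, by simp [hab.symm]⟩
  · intro he
    have := congrFun hqb c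
    rw [he, bary_edgeMid h] at this
    simp [hac.symm, hbc.symm] at this
  · rintro z hz - ⟨α, β, hα, hβ, hαβ, he⟩
    have hw := (hwt z hz).convexComb hq hα.le hβ.le hαβ
    have hb := congrFun (K.bary_eq hc.2.2.2 hw) c
    rw [he, bary_edgeMid h] at hb
    simp only [if_neg hac.symm, if_neg hbc.symm, if_true] at hb
    have := mul_nonneg hα.le ((hwt z hz).nonneg c)
    linarith

/-- Two pages of the book of triangles at an edge, parametrized by the plane. -/
noncomputable def bookMap (a b c d : Euc N) (w : ℂ) : Euc N :=
  ((1 - |w.im| + w.re) / 2) • a + ((1 - |w.im| - w.re) / 2) • b + max w.im 0 • c +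
    max (-w.im) 0 • d

theorem continuous_bookMap (a b c d : Euc N) : Continuous (bookMap a b c d) := by
  unfold bookMap
  fun_prop

theorem bookMap_zero (a b c d : Euc N) : bookMap a b c d 0 = edgeMid a b := by
  simp [bookMap, edgeMid]

theorem bary_bookMap {c d : Euc N} (hc : K.LinkAdj a b c) (hd : K.LinkAdj a b d) (hcd : c ≠ d) :
    ∀ᶠ w : ℂ in 𝓝 0, bookMap a b c d w ∈ K.space ∧
      K.bary (bookMap a b c d w) a = (1 - |w.im| + w.re) / 2 ∧
      K.bary (bookMap a b c d w) b = (1 - |w.im| - w.re) / 2 ∧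
      K.bary (bookMap a b c d w) c = max w.im 0 ∧ K.bary (bookMap a b c d w) d = max (-w.im) 0 ∧
      ∀ e, e ≠ a → e ≠ b → e ≠ c → e ≠ d → K.bary (bookMap a b c d w) e = 0 := by
  have hab := hc.1.symm
  have hac := hc.2.1.symm
  have hbc := hc.2.2.1
  have had := hd.2.1.symm
  have hbd := hd.2.2.1
  have hcont : ∀ᶠ w : ℂ in 𝓝 0, |w.im| + |w.re| < 1 :=
    (show Continuous fun w : ℂ => |w.im| + |w.re| by fun_prop).continuousAt.eventually_lt
      continuousAt_const (by simp)
  filter_upwards [hcont] with w hw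
  have h1 := neg_abs_le w.re
  have h2 := le_abs_self w.re
  rcases le_total 0 w.im with hi | hi
  · have e1 : max w.im 0 = w.im := max_eq_left hi
    have e2 : max (-w.im) 0 = 0 := max_eq_right (by linarith)
    have e3 : |w.im| = w.im := abs_of_nonneg hi
    rw [e3] at hw
    have hwt := isWeight_triple hab hac hbc (x := (1 - w.im + w.re) / 2)
      (y := (1 - w.im - w.re) / 2) (z := w.im) (by linarith) (by linarith) hi (by ring)
    have hz : bookMap a b c d w = ((1 - w.im + w.re) / 2) • a + ((1 - w.im - w.re) / 2) • b +
        w.im • c := by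
      rw [bookMap, e1, e2, e3, zero_smul, add_zero]
    rw [hz, K.bary_eq hc.2.2.2 hwt, e1, e2, e3]
    refine ⟨K.convexHull_subset_space hc.2.2.2 hwt.mem_convexHull, by simp, by simp [hab.symm],
      by simp [hac.symm, hbc.symm], by simp [had.symm, hbd.symm, hcd.symm], ?_⟩
    intro e ha hb hc hd
    simp [ha, hb, hc]
  · have e1 : max w.im 0 = 0 := max_eq_right hi
    have e2 : max (-w.im) 0 = -w.im := max_eq_left (by linarith)
    have e3 : |w.im| = -w.im := abs_of_nonpos hi
    rw [e3] at hw
    have hwt := isWeight_triple hab had hbd (x := (1 - -w.im + w.re) / 2)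
      (y := (1 - -w.im - w.re) / 2) (z := -w.im) (by linarith) (by linarith) (by linarith) (by ring)
    have hz : bookMap a b c d w = ((1 - -w.im + w.re) / 2) • a + ((1 - -w.im - w.re) / 2) • b +
        (-w.im) • d := by
      rw [bookMap, e1, e2, e3, zero_smul, add_zero]
    rw [hz, K.bary_eq hd.2.2.2 hwt, e1, e2, e3]
    refine ⟨K.convexHull_subset_space hd.2.2.2 hwt.mem_convexHull, by simp, by simp [hab.symm],
      by simp [hac.symm, hbc.symm, hcd], by simp [had.symm, hbd.symm], ?_⟩
    intro e ha hb hc hd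
    simp [ha, hb, hd]

/-- Three triangles at an edge form a book that is not planar at the midpoint: one sheet is laid
through the pages `c` and `d`, another through `c` and `e`. -/
theorem linkAdj_eq_or_eq (hK : K.IsSimplicialSurface) {c d e : Euc N} (hc : K.LinkAdj a b c)
    (hd : K.LinkAdj a b d) (he : K.LinkAdj a b e) (hcd : c ≠ d) : e = c ∨ e = d := by
  by_contra! hne
  obtain ⟨hec, hed⟩ := hne
  have h := hc.isNeighbor
  have hp := edgeMid_mem_space h
  -- The map `u x` lays the page `x` onto the upper half-plane and every other page onto the lower
  -- one. Hence `u c` unfolds both sheets, whereas `u d` reflects the first and folds the second.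
  let u : Euc N → Euc N → ℂ := fun x z => ((K.bary z a - K.bary z b : ℝ) : ℂ) +
    ((2 * K.bary z x - (1 - K.bary z a - K.bary z b) : ℝ) : ℂ) * Complex.I
  have hu : ∀ x, ContinuousOn (u x) K.space := by
    intro x
    have ha := K.continuousOn_bary a
    have hb := K.continuousOn_bary b
    have hx := K.continuousOn_bary x
    refine (Complex.continuous_ofReal.comp_continuousOn (ha.sub hb)).add
      ((Complex.continuous_ofReal.comp_continuousOn ?_).mul continuousOn_const)
    exact (continuousOn_const.mul hx).sub ((continuousOn_const.sub ha).sub hb)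
  have hu0 : ∀ x, K.LinkAdj a b x → ∀ z ∈ K.space ∩ K.edgeNhd a b, z ≠ edgeMid a b → u x z ≠ 0 := by
    rintro x hx z ⟨hz, hzU⟩ hne h0
    have hre := congrArg Complex.re h0
    have him := congrArg Complex.im h0
    simp [u] at hre him
    refine hne (eq_edgeMid h ⟨hzU, hz⟩ (sub_eq_zero.1 hre) ?_)
    rcases carrier_edgeNhd h ⟨hzU, hz⟩ with hw | ⟨y, hy, hw, hypos⟩
    · have := hw.sum_one
      rwa [Finset.sum_pair h.1.symm] at this
    · have h1 := hw.sum_one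
      rw [Finset.sum_insert (by simp [h.1.symm, hy.2.1.symm]), Finset.sum_pair hy.2.2.1] at h1
      by_cases hxy : x = y
      · subst hxy; linarith
      · have := hw.support x (by simp [hx.2.1, hx.2.2.1.symm, hxy])
        linarith
  refine (K.locallyPlanarAt hK hp).false_of_book (hu c) (hu d) (edgeNhd_mem_nhds h) (hu0 c hc)
    (hu0 d hd) (continuous_bookMap a b c d) (continuous_bookMap a b c e) (bookMap_zero a b c d)
    (bookMap_zero a b c e) ?_ ?_ ?_ ?_ ?_ ?_
  · filter_upwards [bary_bookMap hc hd hcd] with w hw using hw.1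
  · filter_upwards [bary_bookMap hc he hec.symm] with w hw using hw.1
  · filter_upwards [bary_bookMap hc hd hcd] with w hw
    obtain ⟨-, ha, hb, h1, h2, h3⟩ := hw
    simp only [u, ha, hb, h1]
    rcases le_total 0 w.im with hi | hi
    · rw [max_eq_left hi, abs_of_nonneg hi]
      apply Complex.ext <;> simp <;> ring
    · rw [max_eq_right hi, abs_of_nonpos hi]
      apply Complex.ext <;> simp <;> ring
  · filter_upwards [bary_bookMap hc he hec.symm] with w hw
    obtain ⟨-, ha, hb, h1, h2, h3⟩ := hw
    simp only [u, ha, hb, h1]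
    rcases le_total 0 w.im with hi | hi
    · rw [max_eq_left hi, abs_of_nonneg hi]
      apply Complex.ext <;> simp <;> ring
    · rw [max_eq_right hi, abs_of_nonpos hi]
      apply Complex.ext <;> simp <;> ring
  · filter_upwards [bary_bookMap hc hd hcd] with w hw
    obtain ⟨-, ha, hb, h1, h2, h3⟩ := hw
    simp only [u, ha, hb, h2]
    rcases le_total 0 w.im with hi | hi
    · rw [max_eq_right (by linarith : -w.im ≤ 0), abs_of_nonneg hi]
      apply Complex.ext <;> simp <;> ring
    · rw [max_eq_left (by linarith : 0 ≤ -w.im), abs_of_nonpos hi]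
      apply Complex.ext <;> simp <;> ring
  · filter_upwards [bary_bookMap hc he hec.symm] with w hw
    obtain ⟨-, ha, hb, h1, h2, h3⟩ := hw
    have := h3 d hd.2.1 hd.2.2.1.symm hcd.symm hed.symm
    simp only [u, ha, hb, this]
    apply Complex.ext <;> simp <;> ring

/-- In a surface, every edge lies in exactly two triangles. -/
theorem ncard_linkAdj (hK : K.IsSimplicialSurface) (h : K.IsNeighbor a b) :
    {c | K.LinkAdj a b c}.ncard = 2 := by
  obtain ⟨c, hc⟩ := exists_linkAdj hK h
  obtain ⟨d, hdc, hd⟩ := exists_linkAdj_ne hK hc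
  rw [Set.ncard_eq_two]
  refine ⟨c, d, hdc.symm, ?_⟩
  ext e
  constructor
  · intro he
    simpa using linkAdj_eq_or_eq hK hc hd he hdc.symm
  · rintro (rfl | rfl)
    exacts [hc, hd]

end Edge

end TwoComplex

/-! ### Links as cyclic lists, and total angles. -/

/-- `l` lists the vertices of the link of `v` in cyclic order, the first vertex being repeated at
the end. -/
structure TwoComplex.IsStarList {N : ℕ} (K : TwoComplex N) (v : Euc N) (l : List (Euc N)) :
    Prop where
  closed : l.head? = l.getLast?
  nodup : l.tail.Nodup
  length : 4 ≤ l.length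
  adj : ∀ a b, K.LinkAdj v a b ↔ (a, b) ∈ l.zip l.tail ∨ (b, a) ∈ l.zip l.tail

theorem List.mem_zip_tail_iff {α : Type*} {l : List α} {a b : α} :
    (a, b) ∈ l.zip l.tail ↔ ∃ (i : ℕ) (h : i + 1 < l.length), l[i] = a ∧ l[i + 1] = b := by
  rw [List.mem_iff_getElem]
  constructor
  · rintro ⟨i, hi, he⟩
    have hi' : i + 1 < l.length := by simp at hi; omega
    refine ⟨i, hi', ?_⟩
    simpa using he
  · rintro ⟨i, hi, rfl, rfl⟩
    exact ⟨i, by simp; omega, by simp⟩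

theorem List.eq_of_getElem_eq_of_closed {α : Type*} {l : List α} (hc : l.head? = l.getLast?)
    (hn : l.tail.Nodup) {i j : ℕ} (hi : i < l.length) (hj : j < l.length) (he : l[i] = l[j]) :
    i = j ∨ (i = 0 ∧ j + 1 = l.length) ∨ (j = 0 ∧ i + 1 = l.length) := by
  have hinj : ∀ i j (hi : i + 1 < l.length) (hj : j + 1 < l.length), l[i + 1] = l[j + 1] → i = j := by
    intro i j hi hj h
    have := List.Nodup.getElem_inj_iff hn (i := i) (j := j) (hi := by simp; omega)
      (hj := by simp; omega)
    simpa [h] using this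
  have h0 : ∀ (h : 0 < l.length), l[0] = l[l.length - 1] := by
    intro h
    rw [List.head?_eq_getElem?, List.getLast?_eq_getElem?, List.getElem?_eq_getElem h,
      List.getElem?_eq_getElem (by omega)] at hc
    exact Option.some.inj hc
  rcases i with _ | i <;> rcases j with _ | j
  · exact Or.inl rfl
  · right; left
    obtain ⟨k, hk⟩ : ∃ k, l.length = k + 1 + 1 := ⟨l.length - 2, by omega⟩
    have h1 := h0 hi
    have : l[k + 1] = l[j + 1] := by
      rw [← he, h1]; congr 1; omega
    have := hinj k j (by omega) hj this
    omega
  · right; right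
    obtain ⟨k, hk⟩ : ∃ k, l.length = k + 1 + 1 := ⟨l.length - 2, by omega⟩
    have h1 := h0 hj
    have : l[k + 1] = l[i + 1] := by
      rw [he, h1]; congr 1; omega
    have := hinj k i (by omega) hi this
    omega
  · have := hinj i j hi hj he
    omega

namespace TwoComplex

variable {N : ℕ} {K : TwoComplex N}

/-- The link of a vertex, as a graph. -/
def linkGraph (K : TwoComplex N) (v : Euc N) : SimpleGraph {a // K.IsNeighbor v a} where
  Adj a b := K.LinkAdj v a b
  symm := ⟨fun _ _ h => h.symm⟩
  loopless := ⟨fun _ h => h.2.2.1 rfl⟩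

/-- The link is a connected graph in which every vertex has degree two, so it is one cycle; the list
is the support of a closed walk around it. -/
theorem exists_isStarList (hK : K.IsSimplicialSurface) {v : Euc N} (hv : v ∈ K.vertices) :
    ∃ l, K.IsStarList v l := by
  have hfin : Finite {a // K.IsNeighbor v a} :=
    (K.finite_vertices.subset (fun a ha => IsNeighbor.mem_vertices ha) :
      {a | K.IsNeighbor v a}.Finite)
  have hcard : ∀ a, ((K.linkGraph v).neighborSet a).ncard = 2 := by
    intro a
    rw [← ncard_linkAdj hK a.2, ← Set.ncard_image_of_injective _ Subtype.val_injective]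
    congr 1
    ext c
    constructor
    · rintro ⟨b, hb, rfl⟩; exact hb
    · intro hc
      exact ⟨⟨c, hc.symm.isNeighbor⟩, hc, rfl⟩
  have hcyc : (K.linkGraph v).IsCycles := fun a _ => hcard a
  obtain ⟨a, ha⟩ := exists_neighbor hK hv
  obtain ⟨p, hp, hverts⟩ := hcyc.exists_cycle_toSubgraph_verts_eq_connectedComponentSupp
    (v := ⟨a, ha⟩) (c := (K.linkGraph v).connectedComponentMk ⟨a, ha⟩) rfl
    (Set.nonempty_of_ncard_ne_zero (by rw [hcard]; norm_num))
  have hall : ∀ b, b ∈ p.support := by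
    intro b
    rw [← SimpleGraph.Walk.mem_verts_toSubgraph, hverts]
    have := link_connected hK hv {x | ∃ h : K.IsNeighbor v x,
      (⟨x, h⟩ : {a // K.IsNeighbor v a}) ∈ ((K.linkGraph v).connectedComponentMk ⟨a, ha⟩).supp}
      (by
        rintro x y hxy ⟨hx, hx'⟩
        refine ⟨hxy.symm.isNeighbor, ?_⟩
        have hadj : (K.linkGraph v).Adj ⟨x, hx⟩ ⟨y, hxy.symm.isNeighbor⟩ := hxy
        rw [SimpleGraph.ConnectedComponent.mem_supp_iff] at hx' ⊢
        rw [← hx']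
        exact (SimpleGraph.ConnectedComponent.connectedComponentMk_eq_of_adj hadj).symm)
      ha ⟨ha, rfl⟩ b.2
    exact this.2
  -- The cycle already uses two neighbors of each vertex, and there are only two, so no edge of the
  -- link is left out.
  have hadj : ∀ b c, (K.linkGraph v).Adj b c ↔ s(b, c) ∈ p.edges := by
    intro b c
    rw [← SimpleGraph.Walk.mem_edges_toSubgraph, SimpleGraph.Subgraph.mem_edgeSet]
    refine ⟨fun h => ?_, fun h => h.adj_sub⟩
    have h1 : p.toSubgraph.neighborSet b = (K.linkGraph v).neighborSet b := by
      refine Set.eq_of_subset_of_ncard_le (p.toSubgraph.neighborSet_subset b) ?_ (Set.toFinite _)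
      rw [hcard, hp.ncard_neighborSet_toSubgraph_eq_two (hall b)]
    have : c ∈ p.toSubgraph.neighborSet b := by rw [h1]; exact h
    exact this
  have hmem : ∀ b c, s(b, c) ∈ p.edges ↔
      (b, c) ∈ p.support.zip p.support.tail ∨ (c, b) ∈ p.support.zip p.support.tail := by
    intro b c
    rw [SimpleGraph.Walk.edges_eq_zipWith_support, ← List.map_uncurry_zip_eq_zipWith, List.mem_map]
    constructor
    · rintro ⟨⟨x, y⟩, hxy, he⟩
      rcases Sym2.eq_iff.1 he with ⟨rfl, rfl⟩ | ⟨rfl, rfl⟩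
      exacts [Or.inl hxy, Or.inr hxy]
    · rintro (h | h)
      exacts [⟨_, h, rfl⟩, ⟨_, h, Sym2.eq_swap⟩]
  refine ⟨p.support.map (↑), ?_, ?_, ?_, ?_⟩
  · rw [List.head?_map, List.getLast?_map]
    congr 1
    rw [List.head?_eq_some_head (SimpleGraph.Walk.support_ne_nil p),
      List.getLast?_eq_some_getLast (SimpleGraph.Walk.support_ne_nil p),
      SimpleGraph.Walk.head_support, SimpleGraph.Walk.getLast_support]
  · rw [← List.map_tail]
    exact hp.support_nodup.map Subtype.val_injective
  · rw [List.length_map, SimpleGraph.Walk.length_support]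
    have := hp.three_le_length
    omega
  · intro x y
    rw [← List.map_tail, List.zip_map]
    constructor
    · intro h
      have h1 : (K.linkGraph v).Adj ⟨x, h.isNeighbor⟩ ⟨y, h.symm.isNeighbor⟩ := h
      rw [hadj, hmem] at h1
      rcases h1 with h1 | h1
      · exact Or.inl (List.mem_map.2 ⟨_, h1, rfl⟩)
      · exact Or.inr (List.mem_map.2 ⟨_, h1, rfl⟩)
    · rintro (h | h)
      · obtain ⟨⟨b, c⟩, h1, he⟩ := List.mem_map.1 h
        simp only [Prod.map, Prod.mk.injEq] at he
        obtain ⟨rfl, rfl⟩ := he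
        exact (hadj b c).2 ((hmem b c).2 (Or.inl h1))
      · obtain ⟨⟨b, c⟩, h1, he⟩ := List.mem_map.1 h
        simp only [Prod.map, Prod.mk.injEq] at he
        obtain ⟨rfl, rfl⟩ := he
        exact (hadj c b).2 ((hmem c b).2 (Or.inr h1))

/-- The ordered pairs of vertices that span a triangle with `v`. -/
noncomputable def linkPairs (K : TwoComplex N) (v : Euc N) : Finset (Euc N × Euc N) :=
  (K.finite_vertices.toFinset ×ˢ K.finite_vertices.toFinset).filter
    (fun x => K.LinkAdj v x.1 x.2)

theorem mem_linkPairs {v : Euc N} {x : Euc N × Euc N} :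
    x ∈ K.linkPairs v ↔ K.LinkAdj v x.1 x.2 := by
  simp only [linkPairs, Finset.mem_filter, Finset.mem_product, Set.Finite.mem_toFinset,
    and_iff_right_iff_imp]
  exact fun h => ⟨h.isNeighbor.mem_vertices, h.symm.isNeighbor.mem_vertices⟩

/-- The sum of the angles at `v` of the triangles of `K`. -/
noncomputable def totalAngle (K : TwoComplex N) (v : Euc N) : ℝ :=
  (∑ x ∈ K.linkPairs v, EuclideanGeometry.angle x.1 v x.2) / 2

/-- A choice `P` of one orientation for each edge of the link removes the double counting in
`totalAngle`. -/
theorem totalAngle_eq_sum {v : Euc N} {P : Finset (Euc N × Euc N)}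
    (hP : ∀ a b, K.LinkAdj v a b ↔ (a, b) ∈ P ∨ (b, a) ∈ P)
    (hdisj : ∀ a b, (a, b) ∈ P → (b, a) ∉ P) :
    K.totalAngle v = ∑ x ∈ P, EuclideanGeometry.angle x.1 v x.2 := by
  have h1 : K.linkPairs v = P ∪ P.image Prod.swap := by
    ext ⟨a, b⟩
    rw [mem_linkPairs, Finset.mem_union, Finset.mem_image]
    refine (hP a b).trans (or_congr Iff.rfl ⟨fun h => ⟨_, h, rfl⟩, ?_⟩)
    rintro ⟨⟨x, y⟩, h, he⟩
    simp only [Prod.swap, Prod.mk.injEq] at he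
    rwa [← he.1, ← he.2]
  have h2 : Disjoint P (P.image Prod.swap) := by
    rw [Finset.disjoint_left]
    rintro ⟨a, b⟩ h h'
    obtain ⟨⟨x, y⟩, hxy, he⟩ := Finset.mem_image.1 h'
    simp only [Prod.swap, Prod.mk.injEq] at he
    rw [he.1, he.2] at hxy
    exact hdisj a b h hxy
  rw [totalAngle, h1, Finset.sum_union h2,
    Finset.sum_image (fun x _ y _ h => Prod.swap_injective h)]
  simp only [Prod.fst_swap, Prod.snd_swap]
  have h3 : ∑ x ∈ P, EuclideanGeometry.angle x.2 v x.1 =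
      ∑ x ∈ P, EuclideanGeometry.angle x.1 v x.2 :=
    Finset.sum_congr rfl (fun x _ => EuclideanGeometry.angle_comm x.2 v x.1)
  rw [h3]
  ring

/-- The angles at `v` between consecutive points of a list. -/
noncomputable def listAngles (v : Euc N) (l : List (Euc N)) : List ℝ :=
  List.zipWith (fun a b => EuclideanGeometry.angle a v b) l l.tail

end TwoComplex

/-! ### The subdivision that divides one edge. -/

namespace TwoComplex

variable {N : ℕ} {K : TwoComplex N} {a b : Euc N} {τ : ℝ}

/-- The simplices of the subdivision of `K` in which the edge with endpoints `a` and `b` is divided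
at its interior point `m`. -/
def subdivFaces (K : TwoComplex N) (a b m : Euc N) : Set (Finset (Euc N)) :=
  {s | ¬(a ∈ s ∧ b ∈ s) ∧
    ((m ∉ s ∧ s ∈ K.faces) ∨ (m ∈ s ∧ insert a (insert b (s.erase m)) ∈ K.faces))}

/-- The point that divides a segment in the ratio `τ : 1 - τ`. -/
noncomputable def divPoint (a b : Euc N) (τ : ℝ) : Euc N := (1 - τ) • a + τ • b

theorem divPoint_notMem_vertices (h : K.IsNeighbor a b) (h0 : 0 < τ) (h1 : τ < 1) :
    divPoint a b τ ∉ K.vertices := by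
  intro hm
  have ha := bary_segment h h0.le h1.le a
  have hb := bary_segment h h0.le h1.le b
  rw [← divPoint, bary_vertex hm] at ha hb
  simp only [if_true, if_neg h.1] at ha hb
  have ha' : a = divPoint a b τ := by
    by_contra hne
    rw [if_neg hne] at ha; linarith
  have hb' : b = divPoint a b τ := by
    by_contra hne
    rw [if_neg hne] at hb; linarith
  exact h.1 (hb'.trans ha'.symm)

/-- The coordinates with respect to `K` of a point with coordinates `w` in the subdivision. -/
noncomputable def pullWeight (a b m : Euc N) (τ : ℝ) (w : Euc N → ℝ) (v : Euc N) : ℝ :=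
  (if v = m then 0 else w v) + (if v = a then (1 - τ) * w m else 0) +
    (if v = b then τ * w m else 0)

/-- The weight at the new vertex is shared between `a` and `b` in the ratio `1 - τ : τ`; the face of
`K` is found by replacing the new vertex by `a` and `b`. -/
theorem exists_face_pullWeight (h : K.IsNeighbor a b) (h0 : 0 < τ) (h1 : τ < 1)
    {s : Finset (Euc N)} (hs : s ∈ K.subdivFaces a b (divPoint a b τ)) :
    ∃ s' ∈ K.faces, ∀ w z, IsWeight s w z → IsWeight s' (pullWeight a b (divPoint a b τ) τ w) z := by
  have hm := divPoint_notMem_vertices h h0 h1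
  set m := divPoint a b τ with hmdef
  obtain ⟨-, ⟨hms, hsK⟩ | ⟨hms, hT⟩⟩ := hs
  · refine ⟨s, hsK, fun w z hw => ?_⟩
    have : pullWeight a b m τ w = w := by
      ext v
      have hwm := hw.support m hms
      by_cases hv : v = m
      · simp [pullWeight, hv, hwm]
      · simp [pullWeight, hv, hwm]
    rwa [this]
  · refine ⟨_, hT, fun w z hw => ?_⟩
    set T := insert a (insert b (s.erase m)) with hTdef
    have haT : a ∈ T := by simp [hTdef]
    have hbT : b ∈ T := by simp [hTdef]
    have hmT : m ∉ T := fun hmem => hm (mem_vertices_of_mem hT hmem)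
    have hsub : s ⊆ insert m T := by
      intro x hx
      by_cases hxm : x = m <;> simp [hTdef, hxm, hx]
    have hU := hw.mono hsub
    have hsum := hU.sum_one
    have hsmul := hU.sum_smul
    rw [Finset.sum_insert hmT] at hsum hsmul
    have hmne : ∀ v ∈ T, v ≠ m := fun v hv he => hmT (he ▸ hv)
    have hwm := hU.nonneg m
    have hnn : 0 ≤ (1 - τ) * w m := mul_nonneg (by linarith) hwm
    have hnn' : 0 ≤ τ * w m := mul_nonneg h0.le hwm
    refine ⟨fun v => ?_, fun v hv => ?_, ?_, ?_⟩
    · have := hU.nonneg v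
      rw [pullWeight]
      split_ifs <;> linarith
    · have hva : v ≠ a := fun he => hv (he ▸ haT)
      have hvb : v ≠ b := fun he => hv (he ▸ hbT)
      by_cases hvm : v = m
      · rw [pullWeight, if_pos hvm, if_neg hva, if_neg hvb, add_zero, add_zero]
      · have := hU.support v (by simp [hvm, hv])
        simp [pullWeight, hva, hvb, hvm, this]
    · rw [Finset.sum_congr rfl (g := fun v => w v + (if v = a then (1 - τ) * w m else 0) +
        (if v = b then τ * w m else 0)) (fun v hv => by rw [pullWeight, if_neg (hmne v hv)]),
        Finset.sum_add_distrib, Finset.sum_add_distrib, Finset.sum_ite_eq', Finset.sum_ite_eq',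
        if_pos haT, if_pos hbT]
      linarith
    · rw [Finset.sum_congr rfl (g := fun v => w v • v + (if v = a then ((1 - τ) * w m) • v else 0) +
        (if v = b then (τ * w m) • v else 0)) (fun v hv => by
          rw [pullWeight, if_neg (hmne v hv), add_smul, add_smul, ite_smul, ite_smul, zero_smul]),
        Finset.sum_add_distrib, Finset.sum_add_distrib, Finset.sum_ite_eq', Finset.sum_ite_eq',
        if_pos haT, if_pos hbT, ← hsmul]
      have : w m • m = ((1 - τ) * w m) • a + (τ * w m) • b := by
        rw [hmdef, divPoint]; module
      rw [this]
      abel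

/-- No new simplex contains both `a` and `b`, so one of `w a`, `w b` vanishes. This makes the weight
at the division point recoverable from the coordinates in `K`, and then all other weights. -/
theorem uniqueWeights_subdivFaces (h : K.IsNeighbor a b) (h0 : 0 < τ) (h1 : τ < 1) :
    UniqueWeights (K.subdivFaces a b (divPoint a b τ)) := by
  have hm := divPoint_notMem_vertices h h0 h1
  have ham : a ≠ divPoint a b τ := fun he => hm (by rw [← he]; exact h.symm.mem_vertices)
  have hbm : b ≠ divPoint a b τ := fun he => hm (by rw [← he]; exact h.mem_vertices)
  have hz : ∀ s ∈ K.subdivFaces a b (divPoint a b τ), ∀ w z, IsWeight s w z → w a = 0 ∨ w b = 0 := by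
    intro s hs w z hw
    by_cases ha : a ∈ s
    · exact Or.inr (hw.support b (fun hb => hs.1 ⟨ha, hb⟩))
    · exact Or.inl (hw.support a ha)
  intro s hs t ht w w' z hw hw'
  obtain ⟨s', hs', H⟩ := exists_face_pullWeight h h0 h1 hs
  obtain ⟨t', ht', H'⟩ := exists_face_pullWeight h h0 h1 ht
  have key := K.uniqueWeights s' hs' t' ht' _ _ z (H w z hw) (H' w' z hw')
  set m := divPoint a b τ
  have ka := congrFun key a
  have kb := congrFun key b
  simp only [pullWeight, if_neg ham, if_neg hbm, if_true, if_neg h.1, if_neg h.1.symm,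
    add_zero] at ka kb
  have kv : ∀ v, v ≠ m → v ≠ a → v ≠ b → w v = w' v := by
    intro v hvm hva hvb
    have := congrFun key v
    simpa [pullWeight, hvm, hva, hvb] using this
  have n1 := hw.nonneg a
  have n2 := hw.nonneg b
  have n3 := hw'.nonneg a
  have n4 := hw'.nonneg b
  -- If `w m < w' m`, then `w a > w' a ≥ 0` and `w b > w' b ≥ 0`, although one of `w a`, `w b` is
  -- zero; the opposite inequality fails in the same way.
  have kmm : w m = w' m := by
    rcases lt_trichotomy (w m) (w' m) with hlt | heq | hlt
    · have e1 : (1 - τ) * w m < (1 - τ) * w' m := mul_lt_mul_of_pos_left hlt (by linarith)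
      have e2 : τ * w m < τ * w' m := mul_lt_mul_of_pos_left hlt h0
      rcases hz s hs w z hw with h' | h' <;> linarith
    · exact heq
    · have e1 : (1 - τ) * w' m < (1 - τ) * w m := mul_lt_mul_of_pos_left hlt (by linarith)
      have e2 : τ * w' m < τ * w m := mul_lt_mul_of_pos_left hlt h0
      rcases hz t ht w' z hw' with h' | h' <;> linarith
  rw [kmm] at ka kb
  ext v
  by_cases hvm : v = m
  · rw [hvm, kmm]
  by_cases hva : v = a
  · rw [hva]; linarith
  by_cases hvb : v = b
  · rw [hvb]; linarith
  exact kv v hvm hva hvb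

/-- The subdivision of `K` that divides an edge in the ratio `τ : 1 - τ`. -/
noncomputable def subdivideEdge (K : TwoComplex N) (h : K.IsNeighbor a b) (h0 : 0 < τ)
    (h1 : τ < 1) : TwoComplex N :=
  ofUniqueWeights (K.subdivFaces a b (divPoint a b τ))
    (by
      refine Set.Finite.subset (K.finite_faces.union ((K.finite_faces.biUnion
        (fun s _ => s.powerset.finite_toSet)).image (insert (divPoint a b τ)))) ?_
      rintro s ⟨-, ⟨-, hs⟩ | ⟨hm, hT⟩⟩
      · exact Or.inl hs
      · refine Or.inr ⟨s.erase (divPoint a b τ), Set.mem_biUnion hT ?_, Finset.insert_erase hm⟩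
        simp only [Finset.coe_powerset, Set.mem_preimage, Set.mem_powerset_iff, Finset.coe_subset]
        exact (Finset.subset_insert _ _).trans (Finset.subset_insert _ _))
    (by
      rintro s ⟨hab, ⟨-, hs⟩ | ⟨hm, hT⟩⟩
      · exact K.card_le_three s hs
      · have h3 := K.card_le_three _ hT
        have hlt : (s.erase (divPoint a b τ)).card <
            (insert a (insert b (s.erase (divPoint a b τ)))).card := by
          refine Finset.card_lt_card (Finset.ssubset_iff_subset_ne.2
            ⟨(Finset.subset_insert _ _).trans (Finset.subset_insert _ _), fun he => hab ?_⟩)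
          have ha : a ∈ s.erase (divPoint a b τ) := by rw [he]; simp
          have hb : b ∈ s.erase (divPoint a b τ) := by rw [he]; simp
          exact ⟨Finset.mem_of_mem_erase ha, Finset.mem_of_mem_erase hb⟩
        have := Finset.card_erase_add_one hm
        omega)
    (by
      rintro s ⟨-, ⟨-, hs⟩ | ⟨hm, -⟩⟩
      · exact K.nonempty_of_mem_faces hs
      · exact ⟨_, hm⟩)
    (by
      rintro s ⟨hab, hs⟩ t hts hne
      refine ⟨fun h => hab ⟨hts h.1, hts h.2⟩, ?_⟩
      by_cases hmt : divPoint a b τ ∈ t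
      · right
        rcases hs with ⟨hm, -⟩ | ⟨hm, hT⟩
        · exact absurd (hts hmt) hm
        · exact ⟨hmt, K.down_closed hT (Finset.insert_subset_insert _
            (Finset.insert_subset_insert _ (Finset.erase_subset_erase _ hts))) (by simp)⟩
      · left
        refine ⟨hmt, ?_⟩
        rcases hs with ⟨hm, hs⟩ | ⟨hm, hT⟩
        · exact K.down_closed hs hts hne
        · refine K.down_closed hT (fun x hx => ?_) hne
          have hxm : x ≠ divPoint a b τ := fun he => hmt (he ▸ hx)
          simp [hxm, hts hx])
    (uniqueWeights_subdivFaces h h0 h1)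

theorem subdivideEdge_faces (h : K.IsNeighbor a b) (h0 : 0 < τ) (h1 : τ < 1) :
    (K.subdivideEdge h h0 h1).faces = K.subdivFaces a b (divPoint a b τ) := rfl

/-- All the weight at `a` is traded for weight `μ` at `m`, which also takes `τ μ` from `b`. The
inequality says that `b` has enough to give. -/
theorem mem_convexHull_of_le {m : Euc N} (hm : m = (1 - τ) • a + τ • b) (h1 : τ < 1)
    {s : Finset (Euc N)} (hms : m ∉ s) (ha : a ∈ s) (hb : b ∈ s) (hab : a ≠ b) {w : Euc N → ℝ}
    {z : Euc N} (hw : IsWeight s w z) (hle : τ * w a ≤ (1 - τ) * w b) :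
    z ∈ convexHull ℝ ((insert m (s.erase a) : Finset (Euc N)) : Set (Euc N)) := by
  have hτ : (0 : ℝ) < 1 - τ := by linarith
  set μ := w a / (1 - τ) with hμ
  have hμ0 : 0 ≤ μ := div_nonneg (hw.nonneg a) hτ.le
  have hμa : (1 - τ) * μ = w a := by rw [hμ]; field_simp
  have hμb : τ * μ ≤ w b := by
    have : (1 - τ) * (τ * μ) ≤ (1 - τ) * w b := by
      calc (1 - τ) * (τ * μ) = τ * w a := by rw [← hμa]; ring
        _ ≤ _ := hle
    exact le_of_mul_le_mul_left this hτ
  have hme : m ∉ s.erase a := fun h => hms (Finset.mem_of_mem_erase h)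
  have hbe : b ∈ s.erase a := Finset.mem_erase.2 ⟨hab.symm, hb⟩
  have hmne : ∀ v ∈ s.erase a, v ≠ m := fun v hv he => hme (he ▸ hv)
  have hsum := hw.sum_one
  have hsmul := hw.sum_smul
  rw [← Finset.add_sum_erase _ _ ha] at hsum hsmul
  have hwt : IsWeight (insert m (s.erase a)) (fun v => if v ∈ s.erase a then
      w v - (if v = b then τ * μ else 0) else if v = m then μ else 0) z := by
    refine ⟨fun v => ?_, fun v hv => ?_, ?_, ?_⟩
    · split_ifs with h1 h2
      · rw [h2]; linarith
      · linarith [hw.nonneg v]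
      · exact hμ0
      · exact le_rfl
    · rw [Finset.mem_insert, not_or] at hv
      simp only [if_neg hv.1, if_neg hv.2]
    · rw [Finset.sum_insert hme, if_neg hme, if_pos rfl,
        Finset.sum_congr rfl (fun v hv => if_pos hv), Finset.sum_sub_distrib,
        Finset.sum_ite_eq', if_pos hbe]
      linarith
    · rw [Finset.sum_insert hme, if_neg hme, if_pos rfl,
        Finset.sum_congr rfl (g := fun v => w v • v - (if v = b then (τ * μ) • v else 0))
          (fun v hv => by rw [if_pos hv, sub_smul, ite_smul, zero_smul]), Finset.sum_sub_distrib,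
        Finset.sum_ite_eq', if_pos hbe, ← hsmul, ← hμa, hm]
      module
  exact hwt.mem_convexHull

/-- A simplex containing the edge is the union of two halves. Comparing `τ * w a` with `(1 - τ) * w
b` tells which half holds a point, and the second case is the first with `a`, `b` and `τ`, `1 - τ`
exchanged. -/
theorem isSubdivision_subdivideEdge (h : K.IsNeighbor a b) (h0 : 0 < τ) (h1 : τ < 1) :
    (K.subdivideEdge h h0 h1).IsSubdivision K := by
  have hm := divPoint_notMem_vertices h h0 h1
  have hface : ∀ s ∈ (K.subdivideEdge h h0 h1).faces, ∃ t ∈ K.faces,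
      convexHull ℝ (s : Set (Euc N)) ⊆ convexHull ℝ (t : Set (Euc N)) := by
    intro s hs
    obtain ⟨t, ht, H⟩ := exists_face_pullWeight h h0 h1 hs
    refine ⟨t, ht, fun z hz => ?_⟩
    obtain ⟨w, hw⟩ := IsWeight.exists_iff.2 hz
    exact (H w z hw).mem_convexHull
  refine ⟨Set.Subset.antisymm ?_ ?_, hface⟩
  · intro z hz
    obtain ⟨s, hs, hz⟩ := Geometry.SimplicialComplex.mem_space_iff.1 hz
    obtain ⟨t, ht, hst⟩ := hface s hs
    exact K.convexHull_subset_space ht (hst hz)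
  · intro z hz
    obtain ⟨s, hs, hz⟩ := Geometry.SimplicialComplex.mem_space_iff.1 hz
    have hms : divPoint a b τ ∉ s := fun hmem => hm (mem_vertices_of_mem hs hmem)
    rw [Geometry.SimplicialComplex.mem_space_iff]
    by_cases hab : a ∈ s ∧ b ∈ s
    · obtain ⟨w, hw⟩ := IsWeight.exists_iff.2 hz
      rcases le_total (τ * w a) ((1 - τ) * w b) with hle | hle
      · refine ⟨_, ?_, mem_convexHull_of_le (m := divPoint a b τ) rfl h1 hms hab.1 hab.2 h.1.symm hw hle⟩
        refine ⟨fun hcon => ?_, Or.inr ⟨by simp, ?_⟩⟩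
        · have := Finset.mem_insert.1 hcon.1
          rcases this with he | he
          · exact hms (he ▸ hab.1)
          · simp at he
        · rw [Finset.erase_insert (fun hmem => hms (Finset.mem_of_mem_erase hmem))]
          convert hs using 1
          rw [Finset.insert_eq_of_mem (a := b) (Finset.mem_erase.2 ⟨h.1, hab.2⟩),
            Finset.insert_erase hab.1]
      · have hle' : (1 - τ) * w b ≤ (1 - (1 - τ)) * w a := by linarith
        refine ⟨_, ?_, mem_convexHull_of_le (τ := 1 - τ) (m := divPoint a b τ)
          (by rw [divPoint]; module) (by linarith) hms hab.2 hab.1 h.1 hw hle'⟩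
        refine ⟨fun hcon => ?_, Or.inr ⟨by simp, ?_⟩⟩
        · have := Finset.mem_insert.1 hcon.2
          rcases this with he | he
          · exact hms (he ▸ hab.2)
          · simp at he
        · rw [Finset.erase_insert (fun hmem => hms (Finset.mem_of_mem_erase hmem))]
          convert hs using 1
          rw [Finset.insert_erase hab.2, Finset.insert_eq_of_mem hab.1]
    · exact ⟨s, ⟨hab, Or.inl ⟨hms, hs⟩⟩, hz⟩

/-- Dividing the edge opposite to `v` in a triangle divides one edge of the link. -/
theorem linkAdj_subdivide_opposite {v : Euc N} (hv : K.LinkAdj v a b) (h : K.IsNeighbor a b)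
    (h0 : 0 < τ) (h1 : τ < 1) (x y : Euc N) :
    (K.subdivideEdge h h0 h1).LinkAdj v x y ↔
      (K.LinkAdj v x y ∧ ¬(x = a ∧ y = b) ∧ ¬(x = b ∧ y = a)) ∨
        (x = divPoint a b τ ∧ (y = a ∨ y = b)) ∨ (y = divPoint a b τ ∧ (x = a ∨ x = b)) := by
  have hm := divPoint_notMem_vertices h h0 h1
  have hmv : divPoint a b τ ≠ v := fun he => hm (he ▸ hv.isNeighbor.symm.mem_vertices)
  have hma : divPoint a b τ ≠ a := fun he => hm (by rw [he]; exact h.symm.mem_vertices)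
  have hmb : divPoint a b τ ≠ b := fun he => hm (by rw [he]; exact h.mem_vertices)
  have key : ∀ y, (K.subdivideEdge h h0 h1).LinkAdj v (divPoint a b τ) y ↔ (y = a ∨ y = b) := by
    intro y
    rw [LinkAdj, subdivideEdge_faces]
    set m := divPoint a b τ
    constructor
    · rintro ⟨-, hyv, hmy, -, ⟨hcon, -⟩ | ⟨-, hT⟩⟩
      · simp at hcon
      · by_contra! hy
        have herase : (({v, m, y} : Finset (Euc N)).erase m) = {v, y} := by
          ext z; simp only [Finset.mem_erase, Finset.mem_insert, Finset.mem_singleton]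
          constructor
          · tauto
          · rintro (rfl | rfl)
            exacts [⟨hmv.symm, Or.inl rfl⟩, ⟨hmy.symm, Or.inr (Or.inr rfl)⟩]
        rw [herase] at hT
        have := K.card_le_three _ hT
        -- A third kind of neighbor `y` would put four distinct vertices in one simplex of `K`.
        have h4 : (insert a (insert b {v, y}) : Finset (Euc N)).card = 4 := by
          rw [Finset.card_insert_of_notMem, Finset.card_insert_of_notMem, Finset.card_pair hyv.symm]
          · simp [hv.2.1, hy.2.symm]
          · simp [h.1.symm, hv.1, hy.1.symm]
        omega
    · rintro (rfl | rfl)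
      · refine ⟨hmv, hv.1, hma, ?_, Or.inr ⟨by simp, ?_⟩⟩
        · simp [hv.2.1, hmb.symm, h.1]
        · convert hv.2.2.2 using 1
          ext z
          simp only [Finset.mem_erase, Finset.mem_insert, Finset.mem_singleton]
          constructor
          · tauto
          · rintro (rfl | rfl | rfl)
            · exact Or.inr (Or.inr ⟨hmv.symm, Or.inl rfl⟩)
            · exact Or.inl rfl
            · exact Or.inr (Or.inl rfl)
      · refine ⟨hmv, hv.2.1, hmb, ?_, Or.inr ⟨by simp, ?_⟩⟩
        · simp [hv.1, hma.symm, h.1.symm]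
        · convert hv.2.2.2 using 1
          ext z
          simp only [Finset.mem_erase, Finset.mem_insert, Finset.mem_singleton]
          constructor
          · tauto
          · rintro (rfl | rfl | rfl)
            · exact Or.inr (Or.inr ⟨hmv.symm, Or.inl rfl⟩)
            · exact Or.inl rfl
            · exact Or.inr (Or.inl rfl)
  have hno : ∀ y, ¬ K.LinkAdj v (divPoint a b τ) y := fun y hy => hm hy.isNeighbor.mem_vertices
  by_cases hx : x = divPoint a b τ
  · subst hx
    rw [key]
    have := hno y
    tauto
  by_cases hy : y = divPoint a b τ
  · subst hy
    rw [show (K.subdivideEdge h h0 h1).LinkAdj v x (divPoint a b τ) ↔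
      (K.subdivideEdge h h0 h1).LinkAdj v (divPoint a b τ) x from ⟨LinkAdj.symm, LinkAdj.symm⟩, key]
    have : ¬ K.LinkAdj v x (divPoint a b τ) := fun h => hno x h.symm
    tauto
  · have hmem : divPoint a b τ ∉ ({v, x, y} : Finset (Euc N)) := by
      simp [hmv, Ne.symm hx, Ne.symm hy]
    have hab : (a ∈ ({v, x, y} : Finset (Euc N)) ∧ b ∈ ({v, x, y} : Finset (Euc N))) ↔
        (x = a ∧ y = b) ∨ (x = b ∧ y = a) := by
      simp only [Finset.mem_insert, Finset.mem_singleton]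
      constructor
      · rintro ⟨ha, hb⟩
        rcases ha with ha | ha | ha
        · exact absurd ha hv.1
        · rcases hb with hb | hb | hb
          · exact absurd hb hv.2.1
          · exact absurd (hb.trans ha.symm) h.1
          · exact Or.inl ⟨ha.symm, hb.symm⟩
        · rcases hb with hb | hb | hb
          · exact absurd hb hv.2.1
          · exact Or.inr ⟨hb.symm, ha.symm⟩
          · exact absurd (hb.trans ha.symm) h.1
      · rintro (⟨rfl, rfl⟩ | ⟨rfl, rfl⟩) <;> simp
    rw [LinkAdj, subdivideEdge_faces, subdivFaces, Set.mem_ofPred_eq, hab]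
    rw [LinkAdj]
    simp only [hmem, hx, hy, not_false_eq_true, true_and, false_and, or_false]
    constructor
    · rintro ⟨e1, e2, e3, e4, e5⟩
      exact ⟨⟨e1, e2, e3, e5⟩, fun e => e4 (Or.inl e), fun e => e4 (Or.inr e)⟩
    · rintro ⟨⟨e1, e2, e3, e5⟩, e6, e7⟩
      exact ⟨e1, e2, e3, fun e => e.elim e6 e7, e5⟩

/-- Dividing an edge at `v` moves one vertex of the link towards `v`. -/
theorem linkAdj_subdivide_edge {v p : Euc N} (h : K.IsNeighbor v p)
    (h0 : 0 < τ) (h1 : τ < 1) (x y : Euc N) :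
    (K.subdivideEdge h h0 h1).LinkAdj v x y ↔
      ∃ x' y', K.LinkAdj v x' y' ∧ x = Function.update id p (divPoint v p τ) x' ∧
        y = Function.update id p (divPoint v p τ) y' := by
  have hm := divPoint_notMem_vertices h h0 h1
  have hmv : divPoint v p τ ≠ v := fun he => hm (by rw [he]; exact h.symm.mem_vertices)
  have hmp : divPoint v p τ ≠ p := fun he => hm (by rw [he]; exact h.mem_vertices)
  have key : ∀ y, (K.subdivideEdge h h0 h1).LinkAdj v (divPoint v p τ) y ↔ K.LinkAdj v p y := by
    intro y
    rw [LinkAdj, subdivideEdge_faces]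
    set m := divPoint v p τ
    have herase : y ≠ m → insert v (insert p (({v, m, y} : Finset (Euc N)).erase m)) = {v, p, y} := by
      intro hmy
      ext z; simp only [Finset.mem_erase, Finset.mem_insert, Finset.mem_singleton]
      constructor
      · tauto
      · rintro (rfl | rfl | rfl)
        exacts [Or.inl rfl, Or.inr (Or.inl rfl), Or.inr (Or.inr ⟨hmy, Or.inr (Or.inr rfl)⟩)]
    constructor
    · rintro ⟨-, hyv, hmy, hnot, ⟨hcon, -⟩ | ⟨-, hT⟩⟩
      · simp at hcon
      · rw [herase hmy.symm] at hT
        refine ⟨h.1, hyv, fun he => hnot ?_, hT⟩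
        simp [he]
    · rintro hy
      have hmy : y ≠ m := fun he => hm (he ▸ hy.symm.isNeighbor.mem_vertices)
      refine ⟨hmv, hy.2.1, hmy.symm, ?_, Or.inr ⟨by simp, ?_⟩⟩
      · simp [h.1, hmp.symm, hy.2.2.1]
      · rw [herase hmy]
        exact hy.2.2.2
  have hrest : ∀ x y, x ≠ divPoint v p τ → y ≠ divPoint v p τ →
      ((K.subdivideEdge h h0 h1).LinkAdj v x y ↔ K.LinkAdj v x y ∧ x ≠ p ∧ y ≠ p) := by
    intro x y hx hy
    have hmem : divPoint v p τ ∉ ({v, x, y} : Finset (Euc N)) := by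
      simp [hmv, Ne.symm hx, Ne.symm hy]
    have hab : (v ∈ ({v, x, y} : Finset (Euc N)) ∧ p ∈ ({v, x, y} : Finset (Euc N))) ↔
        x = p ∨ y = p := by
      simp only [Finset.mem_insert, Finset.mem_singleton, true_or, true_and]
      have := h.1
      grind
    rw [LinkAdj, subdivideEdge_faces, subdivFaces, Set.mem_ofPred_eq, hab]
    rw [LinkAdj]
    simp only [hmem, not_false_eq_true, true_and, false_and, or_false]
    constructor
    · rintro ⟨e1, e2, e3, e4, e5⟩
      exact ⟨⟨e1, e2, e3, e5⟩, fun e => e4 (Or.inl e), fun e => e4 (Or.inr e)⟩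
    · rintro ⟨⟨e1, e2, e3, e5⟩, e6, e7⟩
      exact ⟨e1, e2, e3, fun e => e.elim e6 e7, e5⟩
  constructor
  · intro hxy
    by_cases hx : x = divPoint v p τ
    · subst hx
      have h2 := (key y).1 hxy
      exact ⟨p, y, h2, by simp, by simp [h2.2.2.1.symm]⟩
    by_cases hy : y = divPoint v p τ
    · subst hy
      have h2 := (key x).1 hxy.symm
      exact ⟨x, p, h2.symm, by simp [h2.2.2.1.symm], by simp⟩
    · obtain ⟨h2, h3, h4⟩ := (hrest x y hx hy).1 hxy
      exact ⟨x, y, h2, by simp [h3], by simp [h4]⟩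
  · rintro ⟨x', y', h2, rfl, rfl⟩
    by_cases hx : x' = p
    · subst hx
      rw [Function.update_self, Function.update_of_ne h2.2.2.1.symm, id, key]
      exact h2
    by_cases hy : y' = p
    · subst hy
      rw [Function.update_self, Function.update_of_ne h2.2.2.1, id]
      exact ((key x').2 h2.symm).symm
    · rw [Function.update_of_ne hx, Function.update_of_ne hy, id, id]
      exact (hrest x' y' (fun he => hm (he ▸ h2.isNeighbor.mem_vertices))
        (fun he => hm (he ▸ h2.symm.isNeighbor.mem_vertices))).2 ⟨h2, hx, hy⟩

end TwoComplex

/-! ### Splitting angles and shortening spokes of a star. -/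

theorem List.zip_tail_append {α : Type*} (l₁ : List α) (a b : α) (l₂ : List α) :
    (l₁ ++ a :: b :: l₂).zip (l₁ ++ a :: b :: l₂).tail =
      (l₁ ++ [a]).zip (l₁ ++ [a]).tail ++ (a, b) :: (b :: l₂).zip (b :: l₂).tail := by
  induction l₁ with
  | nil => simp
  | cons x l ih =>
    cases l with
    | nil => simp
    | cons y l => simpa using ih

theorem continuousAt_angle_comp {X V : Type*} [TopologicalSpace X]
    [NormedAddCommGroup V] [InnerProductSpace ℝ V] {f g h : X → V} {x : X}
    (hf : ContinuousAt f x) (hg : ContinuousAt g x) (hh : ContinuousAt h x) (h1 : f x ≠ g x)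
    (h2 : h x ≠ g x) : ContinuousAt (fun t => EuclideanGeometry.angle (f t) (g t) (h t)) x := by
  have h1' : f x - g x ≠ 0 := sub_ne_zero.2 h1
  have h2' : h x - g x ≠ 0 := sub_ne_zero.2 h2
  have e1 : ContinuousAt (fun t => inner ℝ (f t - g t) (h t - g t) /
      (‖f t - g t‖ * ‖h t - g t‖)) x := by
    refine ContinuousAt.div (ContinuousAt.inner (𝕜 := ℝ) (hf.sub hg) (hh.sub hg))
      ((hf.sub hg).norm.mul (hh.sub hg).norm) ?_
    exact mul_ne_zero (norm_ne_zero_iff.2 h1') (norm_ne_zero_iff.2 h2')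
  exact Real.continuous_arccos.continuousAt.comp e1

namespace TwoComplex

variable {N : ℕ} {K : TwoComplex N} {v : Euc N}

theorem listAngles_eq_map (v : Euc N) (l : List (Euc N)) :
    listAngles v l = (l.zip l.tail).map (fun x => EuclideanGeometry.angle x.1 v x.2) := by
  rw [listAngles, ← List.map_uncurry_zip_eq_zipWith]
  rfl

theorem length_listAngles (v : Euc N) (l : List (Euc N)) :
    (listAngles v l).length = l.length - 1 := by
  simp [listAngles]

theorem listAngles_append (v : Euc N) (l₁ : List (Euc N)) (a b : Euc N) (l₂ : List (Euc N)) :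
    listAngles v (l₁ ++ a :: b :: l₂) =
      listAngles v (l₁ ++ [a]) ++ EuclideanGeometry.angle a v b :: listAngles v (b :: l₂) := by
  simp only [listAngles_eq_map, List.zip_tail_append, List.map_append, List.map_cons]

namespace IsStarList

variable {l : List (Euc N)}

theorem zip_nodup (h : K.IsStarList v l) : (l.zip l.tail).Nodup := by
  refine List.Nodup.of_map Prod.snd ?_
  rw [List.map_snd_zip (by simp)]
  exact h.nodup

/-- The list has length at least four, so the cycle has at least three vertices and never runs back
along an edge. -/
theorem swap_notMem (h : K.IsStarList v l) {a b : Euc N} (hab : (a, b) ∈ l.zip l.tail) :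
    (b, a) ∉ l.zip l.tail := by
  intro hba
  rw [List.mem_zip_tail_iff] at hab hba
  obtain ⟨i, hi, hia, hib⟩ := hab
  obtain ⟨j, hj, hjb, hja⟩ := hba
  have h1 := List.eq_of_getElem_eq_of_closed h.closed h.nodup hi (by omega : j < l.length)
    (hib.trans hjb.symm)
  have h2 := List.eq_of_getElem_eq_of_closed h.closed h.nodup (by omega : i < l.length) hj
    (hia.trans hja.symm)
  have := h.length
  omega

theorem totalAngle_eq (h : K.IsStarList v l) : K.totalAngle v = (listAngles v l).sum := by
  rw [totalAngle_eq_sum (P := (l.zip l.tail).toFinset) (by simpa using h.adj)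
    (by simpa using fun a b => h.swap_notMem), listAngles_eq_map, List.sum_toFinset _ h.zip_nodup]

theorem linkAdj_of_mem (h : K.IsStarList v l) {a b : Euc N} (hab : (a, b) ∈ l.zip l.tail) :
    K.LinkAdj v a b := (h.adj a b).2 (Or.inl hab)

theorem isNeighbor (h : K.IsStarList v l) {a : Euc N} (ha : a ∈ l) : K.IsNeighbor v a := by
  obtain ⟨i, hi, rfl⟩ := List.mem_iff_getElem.1 ha
  have hl := h.length
  rcases i with _ | i
  · exact (h.linkAdj_of_mem (List.mem_zip_tail_iff.2 ⟨0, by omega, rfl, rfl⟩)).isNeighbor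
  · exact (h.linkAdj_of_mem (List.mem_zip_tail_iff.2 ⟨i, hi, rfl, rfl⟩)).symm.isNeighbor

end IsStarList

theorem LinkAdj.not_collinear {a b : Euc N} (h : K.LinkAdj v a b) : ¬ Collinear ℝ {v, a, b} := by
  rw [← affineIndependent_iff_not_collinear_set]
  have hi := K.indep h.2.2.2
  have hinj : Function.Injective ![v, a, b] := by
    intro i j hij
    fin_cases i <;> fin_cases j <;> simp_all [h.1, h.2.1, h.2.2.1, h.1.symm, h.2.1.symm, h.2.2.1.symm]
  let e : Fin 3 ↪ ({v, a, b} : Finset (Euc N)) :=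
    ⟨fun i => ⟨![v, a, b] i, by fin_cases i <;> simp⟩, fun i j hij => hinj (congrArg Subtype.val hij)⟩
  exact hi.comp_embedding e

theorem LinkAdj.angle_pos {a b : Euc N} (h : K.LinkAdj v a b) :
    0 < EuclideanGeometry.angle a v b := by
  refine (EuclideanGeometry.angle_nonneg a v b).lt_of_ne' (fun h0 => h.not_collinear ?_)
  have := EuclideanGeometry.collinear_of_angle_eq_zero h0
  rwa [Set.insert_comm] at this

/-- The angle from `a` grows continuously from `0` to `x + y` along the edge, so it takes the value
`x`. The rest is `y` because angles add along a ray inside the triangle. -/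
theorem exists_divPoint_angle {a b : Euc N} (h : K.LinkAdj v a b) {x y : ℝ} (hx : 0 < x)
    (hy : 0 < y) (hxy : EuclideanGeometry.angle a v b = x + y) :
    ∃ τ : ℝ, 0 < τ ∧ τ < 1 ∧ EuclideanGeometry.angle a v (divPoint a b τ) = x ∧
      EuclideanGeometry.angle (divPoint a b τ) v b = y := by
  have hab : K.IsNeighbor a b := h.rotate.isNeighbor
  have hne : ∀ τ : ℝ, 0 ≤ τ → τ ≤ 1 → divPoint a b τ ≠ v := by
    intro τ h0 h1
    rcases h0.eq_or_lt with rfl | h0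
    · simpa [divPoint] using h.1
    rcases h1.eq_or_lt with rfl | h1
    · simpa [divPoint] using h.2.1
    · intro he
      exact divPoint_notMem_vertices hab h0 h1 (by rw [he]; exact h.isNeighbor.symm.mem_vertices)
  have hcont : ContinuousOn (fun τ : ℝ => EuclideanGeometry.angle a v (divPoint a b τ))
      (Set.Icc 0 1) := by
    intro τ hτ
    refine ContinuousAt.continuousWithinAt ?_
    refine continuousAt_angle_comp continuousAt_const continuousAt_const ?_ h.1 (hne τ hτ.1 hτ.2)
    unfold divPoint
    fun_prop
  have hab0 : EuclideanGeometry.angle a v (divPoint a b 0) = 0 := by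
    have : divPoint a b 0 = a := by simp [divPoint]
    rw [this]
    exact EuclideanGeometry.angle_self_of_ne h.1
  have hab1 : EuclideanGeometry.angle a v (divPoint a b 1) = x + y := by
    have : divPoint a b 1 = b := by simp [divPoint]
    rw [this, hxy]
  obtain ⟨τ, ⟨hτ0, hτ1⟩, hτ⟩ := intermediate_value_Icc (zero_le_one' ℝ) hcont
    (show x ∈ Set.Icc _ _ by simp only [hab0, hab1]; constructor <;> linarith)
  have hτ : EuclideanGeometry.angle a v (divPoint a b τ) = x := hτ
  have hadd : EuclideanGeometry.angle a v b = EuclideanGeometry.angle a v (divPoint a b τ) +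
      EuclideanGeometry.angle (divPoint a b τ) v b := by
    refine InnerProductGeometry.angle_eq_angle_add_add_angle_add_of_mem_span ?_ ?_
    · exact vsub_ne_zero.2 (hne τ hτ0 hτ1)
    · rw [Submodule.mem_span_pair]
      refine ⟨⟨1 - τ, by linarith⟩, ⟨τ, hτ0⟩, ?_⟩
      change (1 - τ) • (a - v) + τ • (b - v) = divPoint a b τ - v
      rw [divPoint]
      module
  refine ⟨τ, hτ0.lt_of_ne ?_, hτ1.lt_of_ne ?_, hτ, by linarith⟩
  · rintro rfl
    linarith
  · rintro rfl
    linarith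

/-- Dividing an opposite edge splits one angle of the star. -/
theorem IsStarList.split {l : List (Euc N)} (h : K.IsStarList v l) {α₁ α₂ : List ℝ} {x y : ℝ}
    (hx : 0 < x) (hy : 0 < y) (hl : listAngles v l = α₁ ++ (x + y) :: α₂) :
    ∃ J : TwoComplex N, J.IsSubdivision K ∧ ∃ l', J.IsStarList v l' ∧
      listAngles v l' = α₁ ++ x :: y :: α₂ := by
  obtain ⟨l₁, a, b, l₂, rfl, hlen⟩ : ∃ l₁ a b l₂, l = l₁ ++ a :: b :: l₂ ∧
      l₁.length = α₁.length := by
    have hlen := congrArg List.length hl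
    rw [length_listAngles] at hlen
    simp only [List.length_append, List.length_cons] at hlen
    have h1 : α₁.length < l.length := by omega
    have h2 : α₁.length + 1 < l.length := by omega
    -- The angle with index `i` lies between the points with indices `i` and `i + 1`.
    refine ⟨l.take α₁.length, l[α₁.length], l[α₁.length + 1], l.drop (α₁.length + 1 + 1), ?_, ?_⟩
    · rw [← List.drop_eq_getElem_cons h2, ← List.drop_eq_getElem_cons h1, List.take_append_drop]
    · rw [List.length_take]; omega
  rw [listAngles_append] at hl
  obtain ⟨e1, e2⟩ := List.append_inj hl (by rw [length_listAngles]; simp [hlen])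
  obtain ⟨e3, e4⟩ := List.cons.inj e2
  have hzip := List.zip_tail_append l₁ a b l₂
  have hab : K.LinkAdj v a b := h.linkAdj_of_mem (by rw [hzip]; simp)
  obtain ⟨τ, hτ0, hτ1, ha1, ha2⟩ := exists_divPoint_angle hab hx hy e3
  have hn : K.IsNeighbor a b := hab.rotate.isNeighbor
  have hm := divPoint_notMem_vertices hn hτ0 hτ1
  set m := divPoint a b τ with hmdef
  refine ⟨K.subdivideEdge hn hτ0 hτ1, isSubdivision_subdivideEdge hn hτ0 hτ1,
    l₁ ++ a :: m :: b :: l₂, ⟨?_, ?_, ?_, ?_⟩, ?_⟩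
  · have hlast : ∀ X : List (Euc N), (X ++ b :: l₂).getLast? = (b :: l₂).getLast? := by
      intro X
      simp [List.getLast?_append, List.getLast?_cons]
    have := h.closed
    rw [show l₁ ++ a :: b :: l₂ = (l₁ ++ [a]) ++ b :: l₂ by simp, hlast] at this
    rw [show l₁ ++ a :: m :: b :: l₂ = (l₁ ++ [a, m]) ++ b :: l₂ by simp, hlast, ← this]
    cases l₁ <;> simp
  · have hml : m ∉ l₁ ++ a :: b :: l₂ := fun hmem => hm (h.isNeighbor hmem).mem_vertices
    have hnd := h.nodup
    cases l₁ with
    | nil =>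
      simp only [List.nil_append, List.tail_cons] at hnd ⊢
      exact List.nodup_cons.2 ⟨fun hmem => hml (by simp [List.mem_cons.1 hmem]), hnd⟩
    | cons c l₁ =>
      simp only [List.cons_append, List.tail_cons] at hnd ⊢
      have : l₁ ++ a :: m :: b :: l₂ = (l₁ ++ [a]) ++ m :: (b :: l₂) := by simp
      rw [this, List.nodup_middle]
      refine List.nodup_cons.2 ⟨fun hmem => hml ?_, by simpa using hnd⟩
      simp only [List.cons_append, List.mem_cons]
      right
      simpa using hmem
  · have := h.length
    simp only [List.length_append, List.length_cons] at this ⊢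
    omega
  · intro p q
    rw [linkAdj_subdivide_opposite hab, h.adj]
    have hswap : (b, a) ∉ (l₁ ++ a :: b :: l₂).zip (l₁ ++ a :: b :: l₂).tail :=
      h.swap_notMem (by rw [hzip]; simp)
    have hnd := h.zip_nodup
    rw [hzip] at hnd hswap ⊢
    rw [List.zip_tail_append, show (m :: b :: l₂).zip (m :: b :: l₂).tail =
      (m, b) :: (b :: l₂).zip (b :: l₂).tail by simp]
    rw [List.nodup_middle, List.nodup_cons] at hnd
    have hnd1 := hnd.1
    simp only [List.mem_append, List.mem_cons, Prod.mk.injEq, not_or] at hnd1 hswap ⊢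
    generalize (l₁ ++ [a]).zip (l₁ ++ [a]).tail = P₁ at *
    generalize (b :: l₂).zip (b :: l₂).tail = P₂ at *
    have hmem : ∀ {p q : Euc N} {P : List (Euc N × Euc N)}, (a, b) ∉ P → (b, a) ∉ P → (p, q) ∈ P →
        ¬(p = a ∧ q = b) ∧ ¬(p = b ∧ q = a) := by
      rintro p q P h1 h2 h3
      constructor <;> rintro ⟨rfl, rfl⟩ <;> contradiction
    constructor
    · rintro (⟨(h1 | h1 | h1) | (h1 | h1 | h1), h2, h3⟩ | ⟨h1, h2 | h2⟩ | ⟨h1, h2 | h2⟩)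
      · exact Or.inl (Or.inl h1)
      · exact absurd h1 h2
      · exact Or.inl (Or.inr (Or.inr (Or.inr h1)))
      · exact Or.inr (Or.inl h1)
      · exact absurd ⟨h1.2, h1.1⟩ h3
      · exact Or.inr (Or.inr (Or.inr (Or.inr h1)))
      · exact Or.inr (Or.inr (Or.inl ⟨h2, h1⟩))
      · exact Or.inl (Or.inr (Or.inr (Or.inl ⟨h1, h2⟩)))
      · exact Or.inl (Or.inr (Or.inl ⟨h2, h1⟩))
      · exact Or.inr (Or.inr (Or.inr (Or.inl ⟨h1, h2⟩)))
    · rintro ((h1 | h1 | h1 | h1) | (h1 | h1 | h1 | h1))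
      · exact Or.inl ⟨Or.inl (Or.inl h1), hmem hnd1.1 hswap.1 h1⟩
      · exact Or.inr (Or.inr ⟨h1.2, Or.inl h1.1⟩)
      · exact Or.inr (Or.inl ⟨h1.1, Or.inr h1.2⟩)
      · exact Or.inl ⟨Or.inl (Or.inr (Or.inr h1)), hmem hnd1.2 hswap.2.2 h1⟩
      · have := hmem hnd1.1 hswap.1 h1
        exact Or.inl ⟨Or.inr (Or.inl h1), fun e => this.2 e.symm, fun e => this.1 e.symm⟩
      · exact Or.inr (Or.inl ⟨h1.2, Or.inl h1.1⟩)
      · exact Or.inr (Or.inr ⟨h1.1, Or.inr h1.2⟩)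
      · have := hmem hnd1.2 hswap.2.2 h1
        exact Or.inl ⟨Or.inr (Or.inr (Or.inr h1)), fun e => this.2 e.symm, fun e => this.1 e.symm⟩
  · have : listAngles v (m :: b :: l₂) =
        EuclideanGeometry.angle m v b :: listAngles v (b :: l₂) := by simp [listAngles]
    rw [listAngles_append, this, e1, ha1, ha2, e4]

theorem angle_update {p : Euc N} {τ : ℝ} (h0 : 0 < τ) (x y : Euc N) :
    EuclideanGeometry.angle (Function.update id p (divPoint v p τ) x) v
      (Function.update id p (divPoint v p τ) y) = EuclideanGeometry.angle x v y := by
  have hm : divPoint v p τ -ᵥ v = τ • (p -ᵥ v) := by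
    simp only [divPoint, vsub_eq_sub]; module
  have hl : ∀ y, EuclideanGeometry.angle (divPoint v p τ) v y = EuclideanGeometry.angle p v y := by
    intro y
    rw [EuclideanGeometry.angle, hm, InnerProductGeometry.angle_smul_left_of_pos _ _ h0]
    rfl
  have hl' : ∀ x y, EuclideanGeometry.angle (Function.update id p (divPoint v p τ) x) v y =
      EuclideanGeometry.angle x v y := by
    intro x y
    by_cases hx : x = p
    · rw [hx, Function.update_self, hl]
    · rw [Function.update_of_ne hx, id]
  rw [hl', EuclideanGeometry.angle_comm, hl', EuclideanGeometry.angle_comm]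

/-- Dividing an edge at `v` changes the lengths but not the angles of the star. -/
theorem IsStarList.shorten {l : List (Euc N)} (h : K.IsStarList v l) {p : Euc N} (hp : p ∈ l)
    {τ : ℝ} (h0 : 0 < τ) (h1 : τ < 1) :
    ∃ J : TwoComplex N, J.IsSubdivision K ∧
      J.IsStarList v (l.map (Function.update id p (divPoint v p τ))) ∧
      listAngles v (l.map (Function.update id p (divPoint v p τ))) = listAngles v l := by
  have hn := h.isNeighbor hp
  have hm := divPoint_notMem_vertices hn h0 h1
  have hinj : Set.InjOn (Function.update id p (divPoint v p τ)) {x | x ∈ l} := by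
    intro x hx y hy he
    have hxm : x ≠ divPoint v p τ := fun e => hm (by rw [← e]; exact (h.isNeighbor hx).mem_vertices)
    have hym : y ≠ divPoint v p τ := fun e => hm (by rw [← e]; exact (h.isNeighbor hy).mem_vertices)
    by_cases hxp : x = p <;> by_cases hyp : y = p
    · rw [hxp, hyp]
    · rw [hxp, Function.update_self, Function.update_of_ne hyp] at he
      exact absurd he.symm hym
    · rw [hyp, Function.update_self, Function.update_of_ne hxp] at he
      exact absurd he hxm
    · rwa [Function.update_of_ne hxp, Function.update_of_ne hyp] at he
  refine ⟨K.subdivideEdge hn h0 h1, isSubdivision_subdivideEdge hn h0 h1, ⟨?_, ?_, ?_, ?_⟩, ?_⟩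
  · rw [List.head?_map, List.getLast?_map, h.closed]
  · rw [← List.map_tail]
    exact h.nodup.map_on (fun x hx y hy he => hinj (List.mem_of_mem_tail hx)
      (List.mem_of_mem_tail hy) he)
  · rw [List.length_map]; exact h.length
  · intro x y
    rw [linkAdj_subdivide_edge, ← List.map_tail, List.zip_map]
    simp only [List.mem_map, Prod.exists, Prod.map, Prod.mk.injEq]
    constructor
    · rintro ⟨x', y', hxy, rfl, rfl⟩
      rcases (h.adj x' y').1 hxy with h2 | h2
      exacts [Or.inl ⟨x', y', h2, rfl, rfl⟩, Or.inr ⟨y', x', h2, rfl, rfl⟩]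
    · rintro (⟨x', y', h2, rfl, rfl⟩ | ⟨x', y', h2, rfl, rfl⟩)
      exacts [⟨x', y', h.linkAdj_of_mem h2, rfl, rfl⟩, ⟨y', x', (h.linkAdj_of_mem h2).symm, rfl, rfl⟩]
  · rw [listAngles_eq_map, listAngles_eq_map, ← List.map_tail, List.zip_map, List.map_map]
    refine List.map_congr_left (fun x _ => ?_)
    exact angle_update h0 x.1 x.2

end TwoComplex

/-! ### Common refinements, and dependence on the total angle alone. -/

/-- `β` arises from `α` by splitting one entry into two positive summands. -/
def SplitsTo (α β : List ℝ) : Prop :=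
  ∃ (α₁ α₂ : List ℝ) (x y : ℝ), 0 < x ∧ 0 < y ∧ α = α₁ ++ (x + y) :: α₂ ∧ β = α₁ ++ x :: y :: α₂

theorem SplitsTo.cons_reflTransGen {α β : List ℝ} (h : Relation.ReflTransGen SplitsTo α β) (a : ℝ) :
    Relation.ReflTransGen SplitsTo (a :: α) (a :: β) := by
  refine Relation.ReflTransGen.lift (a :: ·) ?_ _ _ h
  rintro _ _ ⟨α₁, α₂, x, y, hx, hy, rfl, rfl⟩
  exact ⟨a :: α₁, α₂, x, y, hx, hy, rfl, rfl⟩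

/-- The larger of the two first entries is cut at the smaller one, the now equal first entries are
removed, and the shorter pair of lists is refined by induction. Positivity and equal sums make both
lists end together. -/
theorem exists_common_refinement {α β : List ℝ} (hα : ∀ a ∈ α, 0 < a) (hβ : ∀ b ∈ β, 0 < b)
    (hsum : α.sum = β.sum) :
    ∃ γ, Relation.ReflTransGen SplitsTo α γ ∧ Relation.ReflTransGen SplitsTo β γ := by
  induction hn : α.length + β.length using Nat.strong_induction_on generalizing α β with
  | _ n ih =>
  have key : ∀ {a b : ℝ} {α β : List ℝ}, (∀ x ∈ a :: α, 0 < x) → (∀ x ∈ b :: β, 0 < x) →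
      (a :: α).sum = (b :: β).sum → (a :: α).length + (b :: β).length = n → a < b →
      ∃ γ, Relation.ReflTransGen SplitsTo (a :: α) γ ∧
        Relation.ReflTransGen SplitsTo (b :: β) γ := by
    intro a b α β hα hβ hsum hn hab
    obtain ⟨γ, h1, h2⟩ := ih (α.length + ((b - a) :: β).length) (by simp at hn ⊢; omega)
      (α := α) (β := (b - a) :: β) (fun x hx => hα x (List.mem_cons_of_mem _ hx))
      (by
        intro x hx
        rcases List.mem_cons.1 hx with rfl | hx
        · linarith
        · exact hβ x (List.mem_cons_of_mem _ hx))
      (by simp only [List.sum_cons] at hsum ⊢; linarith) rfl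
    refine ⟨a :: γ, SplitsTo.cons_reflTransGen h1 a, ?_⟩
    exact Relation.ReflTransGen.head ⟨[], β, a, b - a, hα a (by simp), by linarith, by simp, rfl⟩
      (SplitsTo.cons_reflTransGen h2 a)
  have nil : ∀ {β : List ℝ}, (∀ b ∈ β, 0 < b) → β.sum = 0 → β = [] := by
    intro β hβ h0
    by_contra hne
    exact (List.sum_pos β hβ hne).ne' h0
  rcases α with _ | ⟨a, α⟩
  · rw [nil hβ hsum.symm]
    exact ⟨[], .refl, .refl⟩
  rcases β with _ | ⟨b, β⟩
  · rw [nil hα hsum]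
    exact ⟨[], .refl, .refl⟩
  rcases lt_trichotomy a b with hab | rfl | hab
  · exact key hα hβ hsum hn hab
  · obtain ⟨γ, h1, h2⟩ := ih (α.length + β.length) (by simp at hn; omega) (α := α) (β := β)
      (fun x hx => hα x (List.mem_cons_of_mem _ hx)) (fun x hx => hβ x (List.mem_cons_of_mem _ hx))
      (by simpa using hsum) rfl
    exact ⟨a :: γ, SplitsTo.cons_reflTransGen h1 a, SplitsTo.cons_reflTransGen h2 a⟩
  · obtain ⟨γ, h1, h2⟩ := key hβ hα hsum.symm (by rw [← hn]; ring) hab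
    exact ⟨γ, h2, h1⟩

theorem List.getElem_eq_of_closed {α β : Type*} {l : List α} {l' : List β}
    (hc : l.head? = l.getLast?) (hn : l.tail.Nodup) (hc' : l'.head? = l'.getLast?)
    (hlen : l.length = l'.length) {i j : ℕ} (hi : i < l.length) (hj : j < l.length)
    (he : l[i] = l[j]) : l'[i] = l'[j] := by
  have h0 : ∀ (h : 0 < l'.length), l'[0] = l'[l'.length - 1] := by
    intro h
    rw [List.head?_eq_getElem?, List.getLast?_eq_getElem?, List.getElem?_eq_getElem h,
      List.getElem?_eq_getElem (by omega)] at hc'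
    exact Option.some_injective _ hc'
  rcases List.eq_of_getElem_eq_of_closed hc hn hi hj he with h | ⟨rfl, h⟩ | ⟨rfl, h⟩
  · subst h; rfl
  · obtain rfl : j = l'.length - 1 := by omega
    exact h0 _
  · obtain rfl : i = l'.length - 1 := by omega
    exact (h0 _).symm

namespace TwoComplex

variable {M N : ℕ} {K : TwoComplex N} {v : Euc N} {l : List (Euc N)}

theorem exists_linkAdj_of_mem (hK : K.IsSimplicialSurface) {s : Finset (Euc N)} (hs : s ∈ K.faces)
    (hv : v ∈ s) : ∃ a b, K.LinkAdj v a b ∧ s ⊆ {v, a, b} := by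
  have hcard := K.card_le_three s hs
  have hs' : insert v (s.erase v) = s := Finset.insert_erase hv
  have hc : (s.erase v).card + 1 = s.card := Finset.card_erase_add_one hv
  have hve : v ∉ s.erase v := Finset.notMem_erase v s
  generalize s.erase v = t at hs' hc hve
  subst hs'
  obtain h | h | h : t.card = 0 ∨ t.card = 1 ∨ t.card = 2 := by omega
  · obtain rfl := Finset.card_eq_zero.1 h
    obtain ⟨a, ha⟩ := exists_neighbor hK (mem_vertices_of_mem hs hv)
    obtain ⟨b, hb⟩ := exists_linkAdj hK ha
    exact ⟨a, b, hb, by simp⟩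
  · obtain ⟨a, rfl⟩ := Finset.card_eq_one.1 h
    have ha : K.IsNeighbor v a := ⟨fun e => hve (by simp [e]), hs⟩
    obtain ⟨b, hb⟩ := exists_linkAdj hK ha
    exact ⟨a, b, hb, Finset.pair_subset (by simp) (by simp)⟩
  · obtain ⟨a, b, hab, rfl⟩ := Finset.card_eq_two.1 h
    refine ⟨a, b, ⟨?_, ?_, hab, hs⟩, subset_rfl⟩
    · rintro rfl; simp at hve
    · rintro rfl; simp at hve

namespace IsStarList

theorem mem_starFaces_iff (hK : K.IsSimplicialSurface) (h : K.IsStarList v l)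
    {s : Finset (Euc N)} :
    s ∈ K.starFaces v ↔ s.Nonempty ∧ ∃ (i : ℕ) (hi : i + 1 < l.length),
      s ⊆ {v, l[i], l[i + 1]} := by
  constructor
  · rintro ⟨hs, t, ht, hv, hst⟩
    obtain ⟨a, b, hab, hsub⟩ := exists_linkAdj_of_mem hK ht hv
    refine ⟨K.nonempty_of_mem_faces hs, ?_⟩
    rcases (h.adj a b).1 hab with hm | hm
    · obtain ⟨i, hi, rfl, rfl⟩ := List.mem_zip_tail_iff.1 hm
      exact ⟨i, hi, hst.trans hsub⟩
    · obtain ⟨i, hi, rfl, rfl⟩ := List.mem_zip_tail_iff.1 hm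
      exact ⟨i, hi, by rw [Finset.pair_comm]; exact hst.trans hsub⟩
  · rintro ⟨hne, i, hi, hsub⟩
    have hab := h.linkAdj_of_mem (List.mem_zip_tail_iff.2 ⟨i, hi, rfl, rfl⟩)
    exact ⟨K.down_closed hab.2.2.2 hsub hne, _, hab.2.2.2, by simp, hsub⟩

/-- All spokes have length `ε` and corresponding angles agree, so by the law of cosines the outer
edges agree as well; the isometry matches the lists index by index. -/
theorem starsIsometric {L : TwoComplex M} {w : Euc M} {l' : List (Euc M)}
    (hK : K.IsSimplicialSurface) (hL : L.IsSimplicialSurface) (h : K.IsStarList v l)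
    (h' : L.IsStarList w l') (hang : listAngles v l = listAngles w l') {ε : ℝ}
    (hε : ∀ p ∈ l, dist p v = ε) (hε' : ∀ p ∈ l', dist p w = ε) : StarsIsometric K v L w := by
  have hlen : l.length = l'.length := by
    have := congrArg List.length hang
    rw [length_listAngles, length_listAngles] at this
    have := h.length
    have := h'.length
    omega
  have hvl : ∀ i (hi : i < l.length), l[i] ≠ v := fun i hi => (h.isNeighbor (List.getElem_mem hi)).1
  have hwl : ∀ i (hi : i < l'.length), l'[i] ≠ w :=
    fun i hi => (h'.isNeighbor (List.getElem_mem hi)).1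
  -- The repeated vertex gets the index of its first occurrence. This does no harm, because `l'`
  -- closes up in the same positions. The default `w` is never reached on the list.
  set f : Euc N → Euc M := fun x => if x = v then w else l'.getD (l.idxOf x) w with hf
  have hfv : f v = w := by simp [hf]
  have hfl : ∀ i (hi : i < l.length), f l[i] = l'[i] := by
    intro i hi
    have hj : l.idxOf l[i] < l.length := List.idxOf_lt_length_iff.2 (List.getElem_mem hi)
    simp only [hf, if_neg (hvl i hi)]
    rw [List.getD_eq_getElem _ _ (by omega)]
    exact List.getElem_eq_of_closed h.closed h.nodup h'.closed hlen hj hi (by simp)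
  have himg : ∀ i (hi : i + 1 < l.length),
      Finset.image f {v, l[i], l[i + 1]} = {w, l'[i], l'[i + 1]} := by
    intro i hi
    rw [Finset.image_insert, Finset.image_insert, Finset.image_singleton, hfv, hfl, hfl]
  have hvert : ∀ x, {x} ∈ K.starFaces v → x = v ∨ ∃ (i : ℕ) (hi : i < l.length), x = l[i] := by
    intro x hx
    obtain ⟨-, i, hi, hsub⟩ := (h.mem_starFaces_iff hK).1 hx
    rw [Finset.singleton_subset_iff] at hsub
    simp only [Finset.mem_insert, Finset.mem_singleton] at hsub
    rcases hsub with rfl | rfl | rfl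
    exacts [Or.inl rfl, Or.inr ⟨i, by omega, rfl⟩, Or.inr ⟨i + 1, hi, rfl⟩]
  have hedge : ∀ i (hi : i + 1 < l.length), dist l'[i] l'[i + 1] = dist l[i] l[i + 1] := by
    intro i hi
    have hi' : i < (listAngles v l).length := by rw [length_listAngles]; omega
    have e : (listAngles v l)[i] = (listAngles w l')[i]'(hang ▸ hi') := by simp only [hang]
    simp only [listAngles, List.getElem_zipWith, List.getElem_tail] at e
    have e1 := EuclideanGeometry.law_cos l[i] v l[i + 1]
    have e2 := EuclideanGeometry.law_cos l'[i] w l'[i + 1]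
    rw [hε _ (List.getElem_mem _), hε _ (List.getElem_mem _), e] at e1
    rw [hε' _ (List.getElem_mem _), hε' _ (List.getElem_mem _)] at e2
    exact (mul_self_inj dist_nonneg dist_nonneg).1 (e2.trans e1.symm)
  refine ⟨f, ⟨?_, ?_⟩, hfv, ?_⟩
  · intro x hx y hy he
    rcases hvert x hx with rfl | ⟨i, hi, rfl⟩ <;> rcases hvert y hy with rfl | ⟨j, hj, rfl⟩
    · rfl
    · rw [hfv, hfl] at he
      exact absurd he.symm (hwl j (by omega))
    · rw [hfv, hfl] at he
      exact absurd he (hwl i (by omega))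
    · rw [hfl, hfl] at he
      exact List.getElem_eq_of_closed h'.closed h'.nodup h.closed hlen.symm (by omega) (by omega) he
  · ext s
    rw [h'.mem_starFaces_iff hL]
    constructor
    · rintro ⟨s, hs, rfl⟩
      obtain ⟨hne, i, hi, hsub⟩ := (h.mem_starFaces_iff hK).1 hs
      refine ⟨hne.image f, i, by omega, ?_⟩
      rw [← himg i hi]
      exact Finset.image_subset_image hsub
    · rintro ⟨hne, i, hi, hsub⟩
      rw [← himg i (by omega)] at hsub
      obtain ⟨s, hs, rfl⟩ := Finset.subset_image_iff.1 hsub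
      refine ⟨s, (h.mem_starFaces_iff hK).2 ⟨Finset.image_nonempty.1 hne, i, by omega, ?_⟩, rfl⟩
      exact_mod_cast hs
  · intro x y hxy
    obtain ⟨-, i, hi, hsub⟩ := (h.mem_starFaces_iff hK).1 hxy
    have hd : ∀ i (hi : i < l.length), dist (f l[i]) w = dist l[i] v := by
      intro i hi
      rw [hfl, hε _ (List.getElem_mem _), hε' _ (List.getElem_mem _)]
    have hd2 : dist (f l[i]) (f l[i + 1]) = dist l[i] l[i + 1] := by
      rw [hfl, hfl, hedge]
    have hx : x ∈ ({v, l[i], l[i + 1]} : Finset (Euc N)) := hsub (by simp)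
    have hy : y ∈ ({v, l[i], l[i + 1]} : Finset (Euc N)) := hsub (by simp)
    simp only [Finset.mem_insert, Finset.mem_singleton] at hx hy
    have hd' : ∀ i (hi : i < l.length), dist w (f l[i]) = dist v l[i] := by
      intro i hi
      rw [dist_comm, hd, dist_comm]
    have hd2' : dist (f l[i + 1]) (f l[i]) = dist l[i + 1] l[i] := by
      rw [dist_comm, hd2, dist_comm]
    rcases hx with e | e | e <;> rcases hy with e' | e' | e' <;>
      simp only [e, e', dist_self, hfv, hd, hd2, hd', hd2']

end IsStarList

/-- Some surface in `S` has a vertex with star list `l` and value `r`. -/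
def Represents (S : ComplexSet) (φ : VertexFunction) (r : ℝ) (v : Euc N) (l : List (Euc N)) :
    Prop :=
  ∃ K ∈ S N, K.IsStarList v l ∧ φ N K v = r

theorem IsStarList.mem_vertices (h : K.IsStarList v l) : v ∈ K.vertices := by
  have hl := h.length
  exact (h.isNeighbor (List.getElem_mem (by omega : 0 < l.length))).symm.mem_vertices

variable {S : ComplexSet} {φ : VertexFunction} {r : ℝ}

theorem Represents.refine (hsub : S.ClosedUnderSubdivision) (hφ : φ.InvariantUnderSubdivision S)
    {β : List ℝ} (h : Represents S φ r v l)
    (hβ : Relation.ReflTransGen SplitsTo (listAngles v l) β) :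
    ∃ l', Represents S φ r v l' ∧ listAngles v l' = β := by
  induction hβ with
  | refl => exact ⟨l, h, rfl⟩
  | tail _ hs ih =>
    obtain ⟨l', ⟨K, hK, hl', rfl⟩, hα⟩ := ih
    obtain ⟨α₁, α₂, x, y, hx, hy, rfl, rfl⟩ := hs
    obtain ⟨J, hJ, l'', hl'', ha⟩ := hl'.split hx hy hα
    exact ⟨l'', ⟨J, hsub _ K hK J hJ, hl'',
      (hφ _ K hK J (hsub _ K hK J hJ) hJ v hl'.mem_vertices).symm⟩, ha⟩

theorem dist_divPoint {p : Euc N} {ε : ℝ} (h0 : 0 < ε) (h1 : ε ≤ dist p v) :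
    dist (divPoint v p (ε / dist p v)) v = ε := by
  have : divPoint v p (ε / dist p v) - v = (ε / dist p v) • (p - v) := by
    rw [divPoint]; module
  rw [dist_eq_norm, this, norm_smul, ← dist_eq_norm, Real.norm_of_nonneg (by positivity),
    div_mul_cancel₀ _ (h0.trans_le h1).ne']

/-- Each division cuts one spoke to length `ε`, so the number of vertices at another distance
decreases. -/
theorem Represents.shorten (hsub : S.ClosedUnderSubdivision) (hφ : φ.InvariantUnderSubdivision S)
    {ε : ℝ} (h0 : 0 < ε) (h : Represents S φ r v l) (hε : ∀ p ∈ l, ε ≤ dist p v) :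
    ∃ l', Represents S φ r v l' ∧ listAngles v l' = listAngles v l ∧ ∀ p ∈ l', dist p v = ε := by
  induction hn : (l.toFinset.filter (fun p => dist p v ≠ ε)).card using Nat.strong_induction_on
    generalizing l with
  | _ n ih =>
  by_cases hall : ∀ p ∈ l, dist p v = ε
  · exact ⟨l, h, rfl, hall⟩
  push Not at hall
  obtain ⟨p, hp, hpε⟩ := hall
  have hlt : ε < dist p v := (hε p hp).lt_of_ne' hpε
  obtain ⟨K, hK, hl, rfl⟩ := h
  obtain ⟨J, hJ, hl', ha⟩ := hl.shorten hp (div_pos h0 (h0.trans hlt))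
    ((div_lt_one (h0.trans hlt)).2 hlt)
  have hm := dist_divPoint h0 hlt.le
  set m := divPoint v p (ε / dist p v)
  have hval : ∀ x, Function.update id p m x = m ∨ (Function.update id p m x = x ∧ x ≠ p) := by
    intro x
    by_cases hx : x = p
    · left; rw [hx, Function.update_self]
    · right; exact ⟨by rw [Function.update_of_ne hx, id], hx⟩
  obtain ⟨l'', h1, h2, h3⟩ := ih _ (by
      rw [← hn]
      refine Finset.card_lt_card (Finset.ssubset_iff_subset_ne.2 ⟨?_, ?_⟩)
      · intro x hx
        rw [Finset.mem_filter, List.mem_toFinset, List.mem_map] at hx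
        obtain ⟨⟨y, hy, rfl⟩, hne⟩ := hx
        rcases hval y with e | ⟨e, -⟩
        · rw [e] at hne; exact absurd hm hne
        · rw [e] at hne ⊢
          exact Finset.mem_filter.2 ⟨List.mem_toFinset.2 hy, hne⟩
      · intro he
        have hpm : p ∈ l.toFinset.filter (fun p => dist p v ≠ ε) :=
          Finset.mem_filter.2 ⟨List.mem_toFinset.2 hp, hpε⟩
        rw [← he, Finset.mem_filter, List.mem_toFinset, List.mem_map] at hpm
        obtain ⟨⟨y, hy, e'⟩, hne⟩ := hpm
        rcases hval y with e | ⟨e, hyp⟩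
        · rw [← e', e] at hne; exact hne hm
        · exact hyp (e.symm.trans e'))
    (l := l.map (Function.update id p m))
    ⟨J, hsub _ K hK J hJ, hl', (hφ _ K hK J (hsub _ K hK J hJ) hJ v hl.mem_vertices).symm⟩
    (by
      intro x hx
      obtain ⟨y, hy, rfl⟩ := List.mem_map.1 hx
      rcases hval y with e | ⟨e, -⟩
      · rw [e, hm]
      · rw [e]; exact hε y hy) rfl
  exact ⟨l'', h1, h2.trans ha, h3⟩

theorem exists_forall_le_dist (h : K.IsStarList v l) : ∃ ε > 0, ∀ p ∈ l, ε ≤ dist p v := by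
  have hne : l.toFinset.Nonempty := by
    have hl := h.length
    exact ⟨_, List.mem_toFinset.2 (List.getElem_mem (by omega : 0 < l.length))⟩
  obtain ⟨p, hp, hmin⟩ := l.toFinset.exists_min_image (fun p => dist p v) hne
  exact ⟨dist p v, dist_pos.2 (h.isNeighbor (List.mem_toFinset.1 hp)).1,
    fun q hq => hmin q (List.mem_toFinset.2 hq)⟩

/-- The value of a geometrically locally determined function at a vertex only depends on the total
angle. -/
theorem eq_of_totalAngle_eq (hsurf : ∀ (N : ℕ), ∀ K ∈ S N, K.IsSimplicialSurface)
    (hsub : S.ClosedUnderSubdivision) (hiso : φ.InvariantUnderStarIsometries S)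
    (hφ : φ.InvariantUnderSubdivision S) {L : TwoComplex M} {w : Euc M} (hK : K ∈ S N)
    (hL : L ∈ S M) (hv : v ∈ K.vertices) (hw : w ∈ L.vertices)
    (hang : K.totalAngle v = L.totalAngle w) : φ N K v = φ M L w := by
  have hpos : ∀ {N : ℕ} {K : TwoComplex N} {v : Euc N} {l : List (Euc N)}, K.IsStarList v l →
      ∀ x ∈ listAngles v l, 0 < x := by
    intro N K v l h x hx
    rw [listAngles_eq_map, List.mem_map] at hx
    obtain ⟨⟨a, b⟩, hab, rfl⟩ := hx
    exact (h.linkAdj_of_mem hab).angle_pos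
  obtain ⟨l, hl⟩ := exists_isStarList (hsurf _ K hK) hv
  obtain ⟨l', hl'⟩ := exists_isStarList (hsurf _ L hL) hw
  rw [hl.totalAngle_eq, hl'.totalAngle_eq] at hang
  obtain ⟨γ, hγ, hγ'⟩ := exists_common_refinement (hpos hl) (hpos hl') hang
  obtain ⟨l₁, h₁, e₁⟩ := Represents.refine hsub hφ ⟨K, hK, hl, rfl⟩ hγ
  obtain ⟨l₁', h₁', e₁'⟩ := Represents.refine hsub hφ ⟨L, hL, hl', rfl⟩ hγ'
  obtain ⟨ε, hε, hd⟩ := exists_forall_le_dist h₁.choose_spec.2.1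
  obtain ⟨ε', hε', hd'⟩ := exists_forall_le_dist h₁'.choose_spec.2.1
  -- Both stars are cut to the same spoke length `min ε ε'`.
  obtain ⟨l₂, ⟨K₂, hK₂, hl₂, h₂⟩, e₂, hs⟩ := h₁.shorten hsub hφ (lt_min hε hε')
    (fun p hp => (min_le_left _ _).trans (hd p hp))
  obtain ⟨l₂', ⟨L₂, hL₂, hl₂', h₂'⟩, e₂', hs'⟩ := h₁'.shorten hsub hφ (lt_min hε hε')
    (fun p hp => (min_le_right _ _).trans (hd' p hp))
  rw [← h₂, ← h₂']
  exact hiso _ _ K₂ hK₂ L₂ hL₂ v hl₂.mem_vertices w hl₂'.mem_vertices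
    (hl₂.starsIsometric (hsurf _ _ hK₂) (hsurf _ _ hL₂) hl₂' (by rw [e₂, e₂', e₁, e₁']) hs hs')

end TwoComplex

/-! ### Counting simplices and summing angle defects. -/

theorem Finset.card_eq_mul_card_of_fiber {α β : Type*} [DecidableEq β] {s : Finset α} {t : Finset β} {f : α → β}
    {n : ℕ} (hf : ∀ a ∈ s, f a ∈ t) (hn : ∀ b ∈ t, (s.filter (fun a => f a = b)).card = n) :
    s.card = n * t.card := by
  rw [Finset.card_eq_sum_card_fiberwise hf, Finset.sum_congr rfl hn, Finset.sum_const,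
    smul_eq_mul, mul_comm]

namespace TwoComplex

variable {N : ℕ} (K : TwoComplex N)

noncomputable def facesOfCard (n : ℕ) : Finset (Finset (Euc N)) :=
  K.finite_faces.toFinset.filter (fun s => s.card = n)

theorem mem_facesOfCard {n : ℕ} {s : Finset (Euc N)} :
    s ∈ K.facesOfCard n ↔ s ∈ K.faces ∧ s.card = n := by
  simp [facesOfCard]

theorem numFaces_eq (i : ℕ) : K.numFaces i = (K.facesOfCard (i + 1)).card := by
  rw [numFaces, ← Set.ncard_coe_finset]
  congr 1
  ext s
  simp [mem_facesOfCard]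

noncomputable def orderedTriangles : Finset (Euc N × Euc N × Euc N) :=
  (K.finite_vertices.toFinset ×ˢ K.finite_vertices.toFinset ×ˢ K.finite_vertices.toFinset).filter
    (fun x => K.LinkAdj x.1 x.2.1 x.2.2)

noncomputable def orderedEdges : Finset (Euc N × Euc N) :=
  (K.finite_vertices.toFinset ×ˢ K.finite_vertices.toFinset).filter
    (fun x => K.IsNeighbor x.1 x.2)

variable {K}

theorem mem_orderedTriangles {v a b : Euc N} :
    (v, a, b) ∈ K.orderedTriangles ↔ K.LinkAdj v a b := by
  simp only [orderedTriangles, Finset.mem_filter, Finset.mem_product, Set.Finite.mem_toFinset,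
    and_iff_right_iff_imp]
  exact fun h => ⟨h.isNeighbor.symm.mem_vertices, h.isNeighbor.mem_vertices,
    h.symm.isNeighbor.mem_vertices⟩

theorem mem_orderedEdges {v a : Euc N} : (v, a) ∈ K.orderedEdges ↔ K.IsNeighbor v a := by
  simp only [orderedEdges, Finset.mem_filter, Finset.mem_product, Set.Finite.mem_toFinset,
    and_iff_right_iff_imp]
  exact fun h => ⟨h.symm.mem_vertices, h.mem_vertices⟩

theorem card_orderedEdges : K.orderedEdges.card = 2 * K.numFaces 1 := by
  rw [numFaces_eq]
  refine Finset.card_eq_mul_card_of_fiber (f := fun x => {x.1, x.2}) ?_ ?_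
  · rintro ⟨v, a⟩ h
    have h := mem_orderedEdges.1 h
    exact K.mem_facesOfCard.2 ⟨h.2, Finset.card_pair h.1.symm⟩
  · intro s hs
    obtain ⟨hs, hc⟩ := K.mem_facesOfCard.1 hs
    have : K.orderedEdges.filter (fun x => {x.1, x.2} = s) = s.offDiag := by
      ext ⟨v, a⟩
      rw [Finset.mem_filter, mem_orderedEdges, Finset.mem_offDiag]
      constructor
      · rintro ⟨h, rfl⟩
        exact ⟨by simp, by simp, h.1.symm⟩
      · rintro ⟨h1, h2, h3⟩
        have e : {v, a} = s := Finset.eq_of_subset_of_card_le (Finset.pair_subset h1 h2)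
          (by rw [hc, Finset.card_pair h3])
        exact ⟨⟨h3.symm, e ▸ hs⟩, e⟩
    rw [this, Finset.offDiag_card, hc]

theorem card_orderedTriangles : K.orderedTriangles.card = 6 * K.numFaces 2 := by
  rw [numFaces_eq]
  refine Finset.card_eq_mul_card_of_fiber (f := fun x => {x.1, x.2.1, x.2.2}) ?_ ?_
  · rintro ⟨v, a, b⟩ h
    have h := mem_orderedTriangles.1 h
    exact K.mem_facesOfCard.2 ⟨h.2.2.2, Finset.card_eq_three.2 ⟨v, a, b, h.1.symm, h.2.1.symm,
      h.2.2.1, rfl⟩⟩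
  · intro s hs
    obtain ⟨hs, hc⟩ := K.mem_facesOfCard.1 hs
    have : (K.orderedTriangles.filter (fun x => {x.1, x.2.1, x.2.2} = s)).card = s.offDiag.card := by
      refine Finset.card_bij (fun x _ => (x.1, x.2.1)) ?_ ?_ ?_
      · rintro ⟨v, a, b⟩ hm
        have h := mem_orderedTriangles.1 (Finset.mem_filter.1 hm).1
        have e : {v, a, b} = s := (Finset.mem_filter.1 hm).2
        rw [← e]
        exact Finset.mem_offDiag.2 ⟨Finset.mem_insert_self _ _, by simp, h.1.symm⟩
      · rintro ⟨v, a, b⟩ hm ⟨v', a', b'⟩ hm' heq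
        have h := mem_orderedTriangles.1 (Finset.mem_filter.1 hm).1
        have e : {v, a, b} = s := (Finset.mem_filter.1 hm).2
        have h' := mem_orderedTriangles.1 (Finset.mem_filter.1 hm').1
        have e' : {v', a', b'} = s := (Finset.mem_filter.1 hm').2
        obtain ⟨rfl, rfl⟩ := Prod.mk.inj heq
        have hb : b' ∈ ({v, a, b} : Finset (Euc N)) := by
          rw [e, ← e']; simp
        simp only [Finset.mem_insert, Finset.mem_singleton] at hb
        rcases hb with e | e | rfl
        · exact absurd e h'.2.1
        · exact absurd e.symm h'.2.2.1
        · rfl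
      · rintro ⟨v, a⟩ h
        obtain ⟨h1, h2, h3⟩ := Finset.mem_offDiag.1 h
        have hc2 : ((s.erase v).erase a).card = 1 := by
          rw [Finset.card_erase_of_mem (Finset.mem_erase.2 ⟨Ne.symm h3, h2⟩),
            Finset.card_erase_of_mem h1, hc]
        obtain ⟨b, hb⟩ := Finset.card_eq_one.1 hc2
        have hbm : b ∈ (s.erase v).erase a := by rw [hb]; simp
        have hba := (Finset.mem_erase.1 hbm).1
        have hbv := (Finset.mem_erase.1 (Finset.mem_erase.1 hbm).2).1
        have e : {v, a, b} = s := by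
          rw [← Finset.insert_erase h1, ← Finset.insert_erase (Finset.mem_erase.2 ⟨Ne.symm h3, h2⟩), hb]
        exact ⟨(v, a, b), Finset.mem_filter.2 ⟨mem_orderedTriangles.2
          ⟨Ne.symm h3, hbv, hba.symm, by rw [e]; exact hs⟩, e⟩, rfl⟩
    rw [this, Finset.offDiag_card, hc]

/-- There are `6 f₂` ordered triangles and `2 f₁` ordered edges, and each ordered edge starts
exactly two ordered triangles. -/
theorem three_mul_numFaces_two (hK : K.IsSimplicialSurface) :
    3 * K.numFaces 2 = 2 * K.numFaces 1 := by
  have h : K.orderedTriangles.card = 2 * K.orderedEdges.card := by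
    refine Finset.card_eq_mul_card_of_fiber (f := fun x => (x.1, x.2.1)) ?_ ?_
    · rintro ⟨v, a, b⟩ h
      exact mem_orderedEdges.2 (mem_orderedTriangles.1 h).isNeighbor
    · rintro ⟨v, a⟩ h
      rw [← ncard_linkAdj hK (mem_orderedEdges.1 h), ← Set.ncard_coe_finset]
      refine Set.ncard_congr (fun x _ => x.2.2) ?_ ?_ ?_
      · rintro ⟨v', a', b⟩ hm
        obtain ⟨hmem, e⟩ := Finset.mem_filter.1 (Finset.mem_coe.1 hm)
        have hadj := mem_orderedTriangles.1 hmem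
        obtain ⟨rfl, rfl⟩ := Prod.mk.inj e
        exact hadj
      · rintro ⟨v', a', b⟩ ⟨v'', a'', b'⟩ h h' e
        obtain ⟨-, e1⟩ := Finset.mem_filter.1 (Finset.mem_coe.1 h)
        obtain ⟨-, e2⟩ := Finset.mem_filter.1 (Finset.mem_coe.1 h')
        obtain ⟨rfl, rfl⟩ := Prod.mk.inj (e1.trans e2.symm)
        exact congrArg _ (congrArg _ e)
      · intro b hb
        exact ⟨(v, a, b), Finset.mem_coe.2 (Finset.mem_filter.2 ⟨mem_orderedTriangles.2 hb, rfl⟩), rfl⟩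
  rw [card_orderedTriangles, card_orderedEdges] at h
  omega

/-- Cyclic rotation of ordered triangles shows that the three corners contribute equally to the sum
over all of them. Three times the contribution `X` of the first corner is thus `π` for each of the
`6 f₂` ordered triangles, and the total angles add up to `X / 2`. -/
theorem sum_totalAngle :
    ∑ v ∈ K.finite_vertices.toFinset, K.totalAngle v = Real.pi * K.numFaces 2 := by
  set X := ∑ x ∈ K.orderedTriangles, EuclideanGeometry.angle x.2.1 x.1 x.2.2 with hX
  have h1 : ∑ v ∈ K.finite_vertices.toFinset, K.totalAngle v = X / 2 := by
    rw [hX, Finset.sum_finset_product K.orderedTriangles K.finite_vertices.toFinset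
      (fun v => K.linkPairs v), Finset.sum_div]
    · rfl
    · rintro ⟨v, a, b⟩
      rw [mem_orderedTriangles, mem_linkPairs, Set.Finite.mem_toFinset]
      exact ⟨fun h => ⟨h.isNeighbor.symm.mem_vertices, h⟩, fun h => h.2⟩
  have hrot : ∀ F : Euc N × Euc N × Euc N → ℝ, ∑ x ∈ K.orderedTriangles, F (x.2.1, x.2.2, x.1) =
      ∑ x ∈ K.orderedTriangles, F x := by
    intro F
    refine Finset.sum_nbij' (fun x => (x.2.1, x.2.2, x.1)) (fun x => (x.2.2, x.1, x.2.1)) ?_ ?_ ?_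
      ?_ ?_
    · rintro ⟨v, a, b⟩ h
      exact mem_orderedTriangles.2 (mem_orderedTriangles.1 h).rotate
    · rintro ⟨v, a, b⟩ h
      exact mem_orderedTriangles.2 (mem_orderedTriangles.1 h).rotate.rotate
    all_goals simp
  have h2 := hrot (fun x => EuclideanGeometry.angle x.2.1 x.1 x.2.2)
  have h3 := hrot (fun x => EuclideanGeometry.angle x.2.2 x.2.1 x.1)
  have hsum : X + X + X = Real.pi * K.orderedTriangles.card := by
    have e2 : ∑ x ∈ K.orderedTriangles, EuclideanGeometry.angle x.2.2 x.2.1 x.1 = X := h2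
    have e3 : ∑ x ∈ K.orderedTriangles, EuclideanGeometry.angle x.1 x.2.2 x.2.1 = X := h3.trans e2
    have e1 : X + X + X = X + ∑ x ∈ K.orderedTriangles, EuclideanGeometry.angle x.2.2 x.2.1 x.1 +
        ∑ x ∈ K.orderedTriangles, EuclideanGeometry.angle x.1 x.2.2 x.2.1 := by rw [e2, e3]
    rw [e1, hX, ← Finset.sum_add_distrib, ← Finset.sum_add_distrib, mul_comm, ← nsmul_eq_mul,
      ← Finset.sum_const]
    refine Finset.sum_congr rfl ?_
    rintro ⟨v, a, b⟩ h
    have h := mem_orderedTriangles.1 h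
    have := EuclideanGeometry.angle_add_angle_add_angle_eq_pi b h.1.symm
    simp only
    linarith
  rw [card_orderedTriangles] at hsum
  push_cast at hsum
  linarith

/-- The sum is `2π f₀ - π f₂`, and `3 f₂ = 2 f₁` turns `-f₂ / 2` into `-f₁ + f₂`. -/
theorem sum_two_pi_sub_totalAngle (hK : K.IsSimplicialSurface) :
    ∑ v ∈ K.finite_vertices.toFinset, (2 * Real.pi - K.totalAngle v) =
      2 * Real.pi * K.eulerChar := by
  have h0 : K.numFaces 0 = K.finite_vertices.toFinset.card := by
    rw [numFaces_eq]
    refine (Finset.card_bij (fun v _ => {v}) ?_ ?_ ?_).symm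
    · intro v hv
      exact K.mem_facesOfCard.2 ⟨K.finite_vertices.mem_toFinset.1 hv, by simp⟩
    · intro v _ w _ h
      exact Finset.singleton_injective h
    · intro s hs
      obtain ⟨hs, hc⟩ := K.mem_facesOfCard.1 hs
      obtain ⟨v, rfl⟩ := Finset.card_eq_one.1 hc
      exact ⟨v, K.finite_vertices.mem_toFinset.2 hs, rfl⟩
  have h1 := three_mul_numFaces_two hK
  rw [Finset.sum_sub_distrib, sum_totalAngle, Finset.sum_const, ← h0, eulerChar, nsmul_eq_mul]
  have h1' : (3 : ℝ) * K.numFaces 2 = 2 * K.numFaces 1 := by exact_mod_cast h1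
  push_cast
  linear_combination -Real.pi * h1'

end TwoComplex

/-! ### Bipyramids over plane polygons and their angles. -/

theorem finRotate_eq_add_one {n : ℕ} [NeZero n] (i : Fin n) : finRotate n i = i + 1 := by
  obtain ⟨m, rfl⟩ := Nat.exists_eq_succ_of_ne_zero (NeZero.ne n)
  simp

theorem Fin.add_one_add_one {n : ℕ} [NeZero n] (i : Fin n) : i + 1 + 1 = i + 2 := by
  rw [add_assoc]
  congr 1
  ext
  simp [Fin.val_add]

theorem planeInclusion_two (p : Euc 2) : planeInclusion p 2 = 0 := by simp [planeInclusion]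

theorem planeInclusion_injective : Function.Injective planeInclusion := by
  intro p q h
  have h0 := congrArg (fun z : Euc 3 => z 0) h
  have h1 := congrArg (fun z : Euc 3 => z 1) h
  ext i
  fin_cases i
  · simpa [planeInclusion] using h0
  · simpa [planeInclusion] using h1

/-- The orthogonal projection of `ℝ³` to `ℝ²`. -/
noncomputable def planeProj : Euc 3 →ₗ[ℝ] Euc 2 where
  toFun z := !₂[z 0, z 1]
  map_add' z w := by ext i; fin_cases i <;> simp
  map_smul' c z := by ext i; fin_cases i <;> simp

theorem planeProj_planeInclusion (p : Euc 2) : planeProj (planeInclusion p) = p := by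
  ext i
  fin_cases i <;> simp [planeProj, planeInclusion]

namespace IsWeight

variable {a z : Euc 3} {t : Finset (Euc 2)} {w : Euc 3 → ℝ}

theorem sum_image_planeInclusion {X : Type*} [AddCommMonoid X] (ha : a 2 ≠ 0) (g : Euc 3 → X) :
    ∑ v ∈ insert a (t.image planeInclusion), g v = g a + ∑ p ∈ t, g (planeInclusion p) := by
  rw [Finset.sum_insert, Finset.sum_image planeInclusion_injective.injOn]
  intro h
  obtain ⟨p, -, rfl⟩ := Finset.mem_image.1 h
  exact ha (planeInclusion_two p)

theorem apply_apex (ha : a 2 ≠ 0) (h : IsWeight (insert a (t.image planeInclusion)) w z) :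
    w a * a 2 = z 2 := by
  have := congrArg (fun u : Euc 3 => u 2) h.sum_smul
  rw [sum_image_planeInclusion ha] at this
  simpa [planeInclusion_two] using this

theorem sum_base (ha : a 2 ≠ 0) (h : IsWeight (insert a (t.image planeInclusion)) w z) :
    ∑ p ∈ t, w (planeInclusion p) = 1 - w a := by
  have := h.sum_one
  rw [sum_image_planeInclusion ha] at this
  linarith

theorem sum_smul_base (ha : a 2 ≠ 0) (h : IsWeight (insert a (t.image planeInclusion)) w z) :
    ∑ p ∈ t, w (planeInclusion p) • p = planeProj z - w a • planeProj a := by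
  have := congrArg planeProj h.sum_smul
  rw [sum_image_planeInclusion ha, map_add, map_sum] at this
  simp only [map_smul, planeProj_planeInclusion] at this
  rw [← this]
  abel

theorem apply_planeInclusion (ha : a 2 ≠ 0)
    (h : IsWeight (insert a (t.image planeInclusion)) w z) {p : Euc 2} (hp : p ∉ t) :
    w (planeInclusion p) = 0 := by
  refine h.support _ (fun hm => ?_)
  rcases Finset.mem_insert.1 hm with e | hm
  · exact ha (by rw [← e, planeInclusion_two])
  · obtain ⟨p', hp', e⟩ := Finset.mem_image.1 hm
    exact hp (planeInclusion_injective e ▸ hp')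

/-- Removing the apex and rescaling projects `z` from the apex to the base, which reduces uniqueness
of coordinates to the plane. -/
theorem base (ha : a 2 ≠ 0) (h : IsWeight (insert a (t.image planeInclusion)) w z)
    (h1 : w a ≠ 1) :
    IsWeight t (fun p => (1 - w a)⁻¹ * w (planeInclusion p))
      ((1 - w a)⁻¹ • (planeProj z - w a • planeProj a)) := by
  have hsum := sum_base ha h
  have hpos : 0 ≤ 1 - w a := hsum ▸ Finset.sum_nonneg (fun p _ => h.nonneg _)
  refine ⟨fun p => mul_nonneg (inv_nonneg.2 hpos) (h.nonneg _), fun p hp => ?_, ?_, ?_⟩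
  · rw [apply_planeInclusion ha h hp, mul_zero]
  · rw [← Finset.mul_sum, hsum, inv_mul_cancel₀ (sub_ne_zero.2 h1.symm)]
  · simp only [mul_smul]
    rw [← Finset.smul_sum, sum_smul_base ha h]

end IsWeight

/-- Barycentric coordinates are unique in the suspension of a planar family with unique
coordinates. -/
theorem UniqueWeights.suspension {B : Set (Finset (Euc 2))} (hB : UniqueWeights B) {x y : Euc 3}
    (hx : 0 < x 2) (hy : y 2 < 0) {A : Set (Finset (Euc 3))}
    (hA : ∀ s ∈ A, ∃ t ∈ B, ∃ a ∈ ({x, y} : Set (Euc 3)),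
      s ⊆ insert a (t.image planeInclusion)) : UniqueWeights A := by
  intro s hs s' hs' w w' z h h'
  obtain ⟨t, ht, a, ha, hst⟩ := hA s hs
  obtain ⟨u, hu, b, hb, hsu⟩ := hA s' hs'
  replace h := h.mono hst
  replace h' := h'.mono hsu
  clear hs hs' hst hsu
  have hsign : ∀ c ∈ ({x, y} : Set (Euc 3)), c 2 ≠ 0 := by
    rintro c (rfl | rfl)
    exacts [hx.ne', hy.ne]
  have ha2 := hsign a ha
  have hb2 := hsign b hb
  have e1 := IsWeight.apply_apex ha2 h
  have e2 := IsWeight.apply_apex hb2 h'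
  -- The third coordinate of `z` comes from the apex alone. Its sign tells the apexes apart and its
  -- size gives the apex weight.
  have hab : (a = b ∧ w a = w' b) ∨ (w a = 0 ∧ w' b = 0) := by
    by_cases hz : a = b
    · subst hz
      exact Or.inl ⟨rfl, mul_right_cancel₀ ha2 (e1.trans e2.symm)⟩
    · right
      have hn := h.nonneg a
      have hn' := h'.nonneg b
      have key : w a * a 2 = w' b * b 2 := e1.trans e2.symm
      have h0 : w a * a 2 = 0 ∧ w' b * b 2 = 0 := by
        rcases ha with rfl | rfl <;> rcases hb with rfl | rfl
        · exact absurd rfl hz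
        · have := mul_nonneg hn hx.le
          have := mul_nonpos_of_nonneg_of_nonpos hn' hy.le
          constructor <;> linarith
        · have := mul_nonneg hn' hx.le
          have := mul_nonpos_of_nonneg_of_nonpos hn hy.le
          constructor <;> linarith
        · exact absurd rfl hz
      exact ⟨(mul_eq_zero.1 h0.1).resolve_right ha2, (mul_eq_zero.1 h0.2).resolve_right hb2⟩
  have hc : w a = w' b := by rcases hab with h | h; exacts [h.2, h.1.trans h.2.symm]
  have hproj : w a • planeProj a = w' b • planeProj b := by
    rcases hab with ⟨rfl, h⟩ | ⟨h1, h2⟩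
    · rw [h]
    · rw [h1, h2, zero_smul, zero_smul]
  have hbase : ∀ p, w (planeInclusion p) = w' (planeInclusion p) := by
    intro p
    by_cases h1 : w a = 1
    · have z1 : ∀ p, w (planeInclusion p) = 0 := by
        intro p
        by_cases hp : p ∈ t
        · have := IsWeight.sum_base ha2 h
          rw [h1, sub_self, Finset.sum_eq_zero_iff_of_nonneg (fun p _ => h.nonneg _)] at this
          exact this p hp
        · exact IsWeight.apply_planeInclusion ha2 h hp
      have z2 : ∀ p, w' (planeInclusion p) = 0 := by
        intro p
        by_cases hp : p ∈ u
        · have := IsWeight.sum_base hb2 h'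
          rw [← hc, h1, sub_self, Finset.sum_eq_zero_iff_of_nonneg (fun p _ => h'.nonneg _)] at this
          exact this p hp
        · exact IsWeight.apply_planeInclusion hb2 h' hp
      rw [z1, z2]
    · have w1 := IsWeight.base ha2 h h1
      have w2 := IsWeight.base hb2 h' (hc ▸ h1)
      rw [← hproj, ← hc] at w2
      have := congrFun (hB t ht u hu _ _ _ w1 w2) p
      exact mul_left_cancel₀ (inv_ne_zero (sub_ne_zero.2 (Ne.symm h1))) this
  funext v
  by_cases hv : ∃ p, planeInclusion p = v
  · obtain ⟨p, rfl⟩ := hv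
    exact hbase p
  have hvi : ∀ t : Finset (Euc 2), v ∉ t.image planeInclusion := by
    intro t hm
    obtain ⟨p, -, e⟩ := Finset.mem_image.1 hm
    exact hv ⟨p, e⟩
  have w0 : v ≠ a → w v = 0 := fun hne => h.support v (by simp [hne, hvi t])
  have w0' : v ≠ b → w' v = 0 := fun hne => h'.support v (by simp [hne, hvi u])
  rcases hab with ⟨rfl, he⟩ | ⟨ha0, hb0⟩
  · by_cases hva : v = a
    · rw [hva, he]
    · rw [w0 hva, w0' hva]
  · have : w v = 0 := by
      by_cases hva : v = a
      · rw [hva, ha0]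
      · exact w0 hva
    rw [this]
    by_cases hvb : v = b
    · rw [hvb, hb0]
    · rw [w0' hvb]

theorem AffineIndependent.finset_triple {N : ℕ} {a b c : Euc N}
    (h : AffineIndependent ℝ ![a, b, c]) :
    AffineIndependent ℝ ((↑) : ({a, b, c} : Finset (Euc N)) → Euc N) := by
  have hex : ∀ x : ({a, b, c} : Finset (Euc N)), ∃ i, ![a, b, c] i = x := by
    rintro ⟨x, hx⟩
    simp only [Finset.mem_insert, Finset.mem_singleton] at hx
    rcases hx with rfl | rfl | rfl
    exacts [⟨0, rfl⟩, ⟨1, rfl⟩, ⟨2, rfl⟩]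
  choose e he using hex
  have hinj : Function.Injective e := fun x y hxy => Subtype.ext (by rw [← he x, ← he y, hxy])
  have := h.comp_embedding ⟨e, hinj⟩
  convert this using 1
  funext x
  exact (he x).symm

namespace IsSimplePolygon

variable {n : ℕ} [NeZero n] {P : Polygon (Euc 2) n}

theorem ne_add_one (hP : IsSimplePolygon P) (i : Fin n) : P i ≠ P (i + 1) := by
  simpa using (hP.1 i).injective.ne (by decide : (0 : Fin 3) ≠ 1)

theorem ne_add_two (hP : IsSimplePolygon P) (i : Fin n) : P i ≠ P (i + 2) := by
  simpa using (hP.1 i).injective.ne (by decide : (0 : Fin 3) ≠ 2)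

theorem injective (hP : IsSimplePolygon P) : Function.Injective P := by
  intro i j hij
  by_contra hne
  by_cases h1 : j = i + 1
  · subst h1; exact hP.ne_add_one i hij
  by_cases h2 : i = j + 1
  · subst h2; exact hP.ne_add_one j hij.symm
  refine Set.disjoint_left.1 (hP.2 i j hne (by rwa [finRotate_eq_add_one])
    (by rwa [finRotate_eq_add_one])) (left_mem_affineSegment ℝ _ _) ?_
  rw [hij]
  exact left_mem_affineSegment ℝ _ _

/-- Consecutive edges lie in a nondegenerate triangle, where coordinates are unique, and other pairs
of distinct edges are disjoint. -/
theorem uniqueWeights (hP : IsSimplePolygon P) :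
    UniqueWeights {s | ∃ i, s = {P i, P (i + 1)}} := by
  have hadj : ∀ (i : Fin n) (w w' : Euc 2 → ℝ) (z : Euc 2), IsWeight {P i, P (i + 1)} w z →
      IsWeight {P (i + 1), P (i + 1 + 1)} w' z → w = w' := by
    intro i w w' z h h'
    have e : i + 1 + 1 = i + 2 := Fin.add_one_add_one i
    rw [e] at h'
    exact IsWeight.eq_of_affineIndependent (hP.1 i).finset_triple
      (h.mono (Finset.pair_subset (by simp) (by simp)))
      (h'.mono (Finset.pair_subset (by simp) (by simp)))
  rintro _ ⟨i, rfl⟩ _ ⟨j, rfl⟩ w w' z h h'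
  by_cases hij : i = j
  · subst hij
    exact IsWeight.eq_of_affineIndependent (hP.1 i).finset_triple
      (h.mono (Finset.pair_subset (by simp) (by simp)))
      (h'.mono (Finset.pair_subset (by simp) (by simp)))
  by_cases h1 : j = i + 1
  · subst h1
    exact hadj i w w' z h h'
  by_cases h2 : i = j + 1
  · subst h2
    exact (hadj j w' w z h' h).symm
  have hmem : ∀ {i : Fin n} {w : Euc 2 → ℝ}, IsWeight {P i, P (i + 1)} w z → z ∈ P.edgeSet ℝ i := by
    intro i w h
    have := h.mem_convexHull
    rw [Finset.coe_pair, convexHull_pair, ← affineSegment_eq_segment] at this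
    rwa [Polygon.edgeSet, finRotate_eq_add_one]
  exact absurd (hmem h') (Set.disjoint_left.1 (hP.2 i j hij (by rwa [finRotate_eq_add_one])
    (by rwa [finRotate_eq_add_one])) (hmem h))

end IsSimplePolygon

section Bipyramid

variable {n : ℕ} [NeZero n] {P : Polygon (Euc 2) n} {x y : Euc 3}

/-- The bipyramid over the polygon `P` with apexes `x` and `y`. -/
noncomputable def bipyramid (hP : IsSimplePolygon P) (hx : 0 < x 2) (hy : y 2 < 0) :
    TwoComplex 3 :=
  TwoComplex.ofUniqueWeights
    {s | s.Nonempty ∧ ∃ i : Fin n, ∃ a ∈ ({x, y} : Set (Euc 3)),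
        s ⊆ {a, planeInclusion (P i), planeInclusion (P (finRotate n i))}}
    (by
      refine (Finset.finite_toSet (insert x (insert y
        (Finset.univ.image (fun i => planeInclusion (P i))))).powerset).subset ?_
      rintro s ⟨-, i, a, ha, hs⟩
      rw [Finset.mem_coe, Finset.mem_powerset]
      refine hs.trans (Finset.triple_subset ?_ (by simp) (by simp))
      rcases ha with rfl | rfl <;> simp)
    (fun s hs => by
      obtain ⟨-, i, a, -, h⟩ := hs
      exact (Finset.card_le_card h).trans Finset.card_le_three)
    (fun s hs => hs.1)
    (fun s hs t hts ht => by
      obtain ⟨-, i, a, ha, h⟩ := hs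
      exact ⟨ht, i, a, ha, hts.trans h⟩)
    (hP.uniqueWeights.suspension hx hy (by
      rintro s ⟨-, i, a, ha, hs⟩
      refine ⟨{P i, P (i + 1)}, ⟨i, rfl⟩, a, ha, ?_⟩
      rw [Finset.image_insert, Finset.image_singleton, ← finRotate_eq_add_one]
      exact hs))

variable (hP : IsSimplePolygon P) (hx : 0 < x 2) (hy : y 2 < 0)

theorem isBipyramid_bipyramid : (bipyramid hP hx hy).IsBipyramid :=
  ⟨n, inferInstance, P, x, y, hP, hx, hy, rfl⟩

theorem mem_bipyramid_faces {s : Finset (Euc 3)} : s ∈ (bipyramid hP hx hy).faces ↔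
    s.Nonempty ∧ ∃ i : Fin n, ∃ a ∈ ({x, y} : Set (Euc 3)),
      s ⊆ {a, planeInclusion (P i), planeInclusion (P (i + 1))} := by
  simp only [← finRotate_eq_add_one]
  rfl

end Bipyramid

open EuclideanGeometry

section Bipyramid

variable {n : ℕ} [NeZero n] {P : Polygon (Euc 2) n} {x y : Euc 3}
  (hP : IsSimplePolygon P) (hx : 0 < x 2) (hy : y 2 < 0)

theorem apex_ne_planeInclusion (hx : 0 < x 2) (hy : y 2 < 0) {a : Euc 3} (ha : a ∈ ({x, y} : Set (Euc 3))) (p : Euc 2) :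
    a ≠ planeInclusion p := by
  intro e
  have h0 := planeInclusion_two p
  rw [← e] at h0
  rcases ha with rfl | rfl
  exacts [hx.ne' h0, hy.ne h0]

theorem bipyramid_linkAdj_apex {a : Euc 3} (ha : a ∈ ({x, y} : Set (Euc 3))) {b c : Euc 3} :
    (bipyramid hP hx hy).LinkAdj a b c ↔
      ∃ i : Fin n, (b = planeInclusion (P i) ∧ c = planeInclusion (P (i + 1))) ∨
        (c = planeInclusion (P i) ∧ b = planeInclusion (P (i + 1))) := by
  have hap := apex_ne_planeInclusion hx hy ha
  constructor
  · rintro ⟨hba, hca, hbc, hf⟩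
    obtain ⟨-, i, a', ha', hs⟩ := (mem_bipyramid_faces hP hx hy).1 hf
    simp only [Finset.insert_subset_iff, Finset.singleton_subset_iff, Finset.mem_insert,
      Finset.mem_singleton] at hs
    obtain ⟨h1, h2, h3⟩ := hs
    obtain rfl : a = a' := by
      rcases h1 with h | h | h
      exacts [h, absurd h (hap _), absurd h (hap _)]
    refine ⟨i, ?_⟩
    rcases h2 with h2 | h2 | h2
    · exact absurd h2 hba
    · rcases h3 with h3 | h3 | h3
      · exact absurd h3 hca
      · exact absurd (h2.trans h3.symm) hbc
      · exact Or.inl ⟨h2, h3⟩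
    · rcases h3 with h3 | h3 | h3
      · exact absurd h3 hca
      · exact Or.inr ⟨h3, h2⟩
      · exact absurd (h2.trans h3.symm) hbc
  · have key : ∀ i, (bipyramid hP hx hy).LinkAdj a (planeInclusion (P i))
        (planeInclusion (P (i + 1))) := fun i =>
      ⟨(hap _).symm, (hap _).symm, fun e => hP.ne_add_one i (planeInclusion_injective e),
        (mem_bipyramid_faces hP hx hy).2 ⟨by simp, i, a, ha, subset_rfl⟩⟩
    rintro ⟨i, ⟨rfl, rfl⟩ | ⟨rfl, rfl⟩⟩
    exacts [key i, (key i).symm]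

theorem bipyramid_totalAngle_apex {a : Euc 3} (ha : a ∈ ({x, y} : Set (Euc 3))) :
    (bipyramid hP hx hy).totalAngle a =
      ∑ i, ∠ (planeInclusion (P i)) a (planeInclusion (P (i + 1))) := by
  have hinj : Function.Injective (fun i => planeInclusion (P i)) :=
    planeInclusion_injective.comp hP.injective
  rw [TwoComplex.totalAngle_eq_sum
    (P := Finset.univ.image (fun i => (planeInclusion (P i), planeInclusion (P (i + 1))))),
    Finset.sum_image (fun i _ j _ h => hinj (Prod.mk.inj h).1)]
  · intro b c
    rw [bipyramid_linkAdj_apex hP hx hy ha]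
    simp only [Finset.mem_image, Finset.mem_univ, true_and, Prod.mk.injEq]
    constructor
    · rintro ⟨i, ⟨rfl, rfl⟩ | ⟨rfl, rfl⟩⟩
      exacts [Or.inl ⟨i, rfl, rfl⟩, Or.inr ⟨i, rfl, rfl⟩]
    · rintro (⟨i, rfl, rfl⟩ | ⟨i, rfl, rfl⟩)
      exacts [⟨i, Or.inl ⟨rfl, rfl⟩⟩, ⟨i, Or.inr ⟨rfl, rfl⟩⟩]
  · intro b c h h'
    simp only [Finset.mem_image, Finset.mem_univ, true_and, Prod.mk.injEq] at h h'
    obtain ⟨i, rfl, rfl⟩ := h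
    obtain ⟨j, h1, h2⟩ := h'
    have e1 : j = i + 1 := hinj h1
    have e2 : j + 1 = i := hinj h2
    rw [e1, Fin.add_one_add_one] at e2
    exact hP.ne_add_two i (by rw [e2])

theorem bipyramid_linkAdj_base {i : Fin n} {b c : Euc 3} :
    (bipyramid hP hx hy).LinkAdj (planeInclusion (P i)) b c ↔
      ∃ a ∈ ({x, y} : Set (Euc 3)), ∃ j, (j = i + 1 ∨ j = i - 1) ∧
        ((b = a ∧ c = planeInclusion (P j)) ∨ (c = a ∧ b = planeInclusion (P j))) := by
  have hinj : Function.Injective (fun i => planeInclusion (P i)) :=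
    planeInclusion_injective.comp hP.injective
  constructor
  · rintro ⟨hbi, hci, hbc, hf⟩
    obtain ⟨-, j, a, ha, hs⟩ := (mem_bipyramid_faces hP hx hy).1 hf
    simp only [Finset.insert_subset_iff, Finset.singleton_subset_iff, Finset.mem_insert,
      Finset.mem_singleton] at hs
    obtain ⟨h1, h2, h3⟩ := hs
    refine ⟨a, ha, ?_⟩
    have key : ∀ p, (b = a ∨ b = p) → (c = a ∨ c = p) → (b = a ∧ c = p) ∨ (c = a ∧ b = p) := by
      rintro p (e | e) (e' | e')
      · exact absurd (e.trans e'.symm) hbc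
      · exact Or.inl ⟨e, e'⟩
      · exact Or.inr ⟨e', e⟩
      · exact absurd (e.trans e'.symm) hbc
    rcases h1 with h1 | h1 | h1
    · exact absurd h1.symm (apex_ne_planeInclusion hx hy ha _)
    · rw [← h1] at h2 h3
      obtain rfl : i = j := hinj h1
      exact ⟨i + 1, Or.inl rfl, key _ (h2.imp_right fun h => h.resolve_left hbi)
        (h3.imp_right fun h => h.resolve_left hci)⟩
    · rw [← h1] at h2 h3
      obtain rfl : i = j + 1 := hinj h1
      exact ⟨j, Or.inr (by rw [add_sub_cancel_right]),
        key _ (h2.imp_right fun h => h.resolve_right hbi)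
        (h3.imp_right fun h => h.resolve_right hci)⟩
  · have key : ∀ a ∈ ({x, y} : Set (Euc 3)), ∀ j, j = i + 1 ∨ j = i - 1 →
        (bipyramid hP hx hy).LinkAdj (planeInclusion (P i)) a (planeInclusion (P j)) := by
      rintro a ha j (rfl | rfl)
      · exact ((bipyramid_linkAdj_apex hP hx hy ha).2 ⟨i, Or.inl ⟨rfl, rfl⟩⟩).rotate.symm
      · exact ((bipyramid_linkAdj_apex hP hx hy ha).2 ⟨i - 1, Or.inr ⟨rfl, by
          rw [sub_add_cancel]⟩⟩).rotate.symm
    rintro ⟨a, ha, j, hj, ⟨rfl, rfl⟩ | ⟨rfl, rfl⟩⟩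
    exacts [key _ ha j hj, (key _ ha j hj).symm]

theorem bipyramid_totalAngle_base (i : Fin n) :
    (bipyramid hP hx hy).totalAngle (planeInclusion (P i)) =
      (∠ x (planeInclusion (P i)) (planeInclusion (P (i + 1))) +
        ∠ x (planeInclusion (P i)) (planeInclusion (P (i - 1)))) +
      (∠ y (planeInclusion (P i)) (planeInclusion (P (i + 1))) +
        ∠ y (planeInclusion (P i)) (planeInclusion (P (i - 1)))) := by
  have hxy : x ≠ y := by rintro rfl; linarith
  have hj : planeInclusion (P (i + 1)) ≠ planeInclusion (P (i - 1)) := by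
    have := hP.ne_add_two (i - 1)
    rw [← Fin.add_one_add_one, sub_add_cancel] at this
    exact fun e => this (planeInclusion_injective e).symm
  have hap := fun a ha => apex_ne_planeInclusion hx hy (a := a) ha
  rw [TwoComplex.totalAngle_eq_sum (P := ({x, y} : Finset (Euc 3)) ×ˢ
    ({planeInclusion (P (i + 1)), planeInclusion (P (i - 1))} : Finset (Euc 3))),
    Finset.sum_product, Finset.sum_pair hxy, Finset.sum_pair hj, Finset.sum_pair hj]
  · intro b c
    rw [bipyramid_linkAdj_base hP hx hy]
    simp only [Finset.mem_product, Finset.mem_insert, Finset.mem_singleton]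
    constructor
    · rintro ⟨a, ha, j, hj, ⟨rfl, rfl⟩ | ⟨rfl, rfl⟩⟩
      · exact Or.inl ⟨ha, by rcases hj with rfl | rfl <;> simp⟩
      · exact Or.inr ⟨ha, by rcases hj with rfl | rfl <;> simp⟩
    · rintro (⟨ha, hj⟩ | ⟨ha, hj⟩)
      · rcases hj with rfl | rfl
        exacts [⟨b, ha, _, Or.inl rfl, Or.inl ⟨rfl, rfl⟩⟩, ⟨b, ha, _, Or.inr rfl, Or.inl ⟨rfl, rfl⟩⟩]
      · rcases hj with rfl | rfl
        exacts [⟨c, ha, _, Or.inl rfl, Or.inr ⟨rfl, rfl⟩⟩, ⟨c, ha, _, Or.inr rfl, Or.inr ⟨rfl, rfl⟩⟩]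
  · intro b c h h'
    simp only [Finset.mem_product, Finset.mem_insert, Finset.mem_singleton] at h h'
    have hb : b ∈ ({x, y} : Set (Euc 3)) := h.1
    rcases h'.2 with e | e
    exacts [hap b hb _ e, hap b hb _ e]

theorem bipyramid_vertices : (bipyramid hP hx hy).vertices =
    ((insert x (insert y (Finset.univ.image (fun i => planeInclusion (P i)))) : Finset (Euc 3)) :
      Set (Euc 3)) := by
  ext v
  change {v} ∈ (bipyramid hP hx hy).faces ↔ _
  rw [mem_bipyramid_faces]
  simp only [Finset.singleton_nonempty, true_and, Finset.singleton_subset_iff, Finset.mem_insert,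
    Finset.mem_singleton, Finset.mem_coe, Finset.mem_image, Finset.mem_univ]
  constructor
  · rintro ⟨i, a, ha, rfl | rfl | rfl⟩
    · rcases ha with rfl | rfl <;> simp
    · exact Or.inr (Or.inr ⟨i, rfl⟩)
    · exact Or.inr (Or.inr ⟨i + 1, rfl⟩)
  · rintro (rfl | rfl | ⟨i, rfl⟩)
    · exact ⟨0, v, by simp, Or.inl rfl⟩
    · exact ⟨0, v, by simp, Or.inl rfl⟩
    · exact ⟨i, x, by simp, Or.inr (Or.inl rfl)⟩

theorem bipyramid_finsum_vertices (g : Euc 3 → ℝ) :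
    ∑ᶠ v ∈ (bipyramid hP hx hy).vertices, g v =
      g x + g y + ∑ i, g (planeInclusion (P i)) := by
  have hxy : x ≠ y := by rintro rfl; linarith
  have hinj : Function.Injective (fun i => planeInclusion (P i)) :=
    planeInclusion_injective.comp hP.injective
  have hap := fun a ha => apex_ne_planeInclusion hx hy (a := a) ha
  have hn : ∀ a ∈ ({x, y} : Set (Euc 3)), a ∉ Finset.univ.image (fun i => planeInclusion (P i)) := by
    intro a ha hm
    obtain ⟨i, -, e⟩ := Finset.mem_image.1 hm
    exact hap a ha _ e.symm
  rw [bipyramid_vertices, finsum_mem_coe_finset, Finset.sum_insert, Finset.sum_insert,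
    Finset.sum_image hinj.injOn, add_assoc]
  · exact hn y (by simp)
  · rw [Finset.mem_insert, not_or]
    exact ⟨hxy, hn x (by simp)⟩

/-- The `2n` triangles have angle sum `π` each; shifting the index brings the three corners of a
triangle together. -/
theorem bipyramid_sum_totalAngle :
    (bipyramid hP hx hy).totalAngle x + (bipyramid hP hx hy).totalAngle y +
      ∑ i, (bipyramid hP hx hy).totalAngle (planeInclusion (P i)) = 2 * n * Real.pi := by
  have key : ∀ a ∈ ({x, y} : Set (Euc 3)),
      ∑ i, ∠ (planeInclusion (P i)) a (planeInclusion (P (i + 1))) +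
        ∑ i, (∠ a (planeInclusion (P i)) (planeInclusion (P (i + 1))) +
          ∠ a (planeInclusion (P i)) (planeInclusion (P (i - 1)))) = n * Real.pi := by
    intro a ha
    have hshift : ∑ i, ∠ a (planeInclusion (P i)) (planeInclusion (P (i - 1))) =
        ∑ i, ∠ a (planeInclusion (P (i + 1))) (planeInclusion (P i)) := by
      rw [← Equiv.sum_comp (Equiv.addRight (1 : Fin n))]
      simp
    rw [Finset.sum_add_distrib, hshift, ← Finset.sum_add_distrib, ← Finset.sum_add_distrib]
    rw [Finset.sum_congr rfl (g := fun _ => Real.pi), Finset.sum_const, Finset.card_univ,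
      Fintype.card_fin, nsmul_eq_mul]
    intro i _
    have := angle_add_angle_add_angle_eq_pi (planeInclusion (P (i + 1)))
      (apex_ne_planeInclusion hx hy ha (P i)).symm
    rw [angle_comm (planeInclusion (P (i + 1))) a, angle_comm _ _ a] at this
    linarith
  have hkx := key x (by simp)
  have hky := key y (by simp)
  simp only [bipyramid_totalAngle_base]
  rw [bipyramid_totalAngle_apex hP hx hy (a := x) (by simp),
    bipyramid_totalAngle_apex hP hx hy (a := y) (by simp), Finset.sum_add_distrib]
  linarith

end Bipyramid

/-! ### Apexes on the axis, and simple polygons given by sequences. -/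

/-- The point of the third coordinate axis at height `h`. -/
noncomputable def axisPoint (h : ℝ) : Euc 3 := !₂[0, 0, h]

theorem axisPoint_two (h : ℝ) : axisPoint h 2 = h := by simp [axisPoint]

theorem inner_planeInclusion_sub_axisPoint (p q : Euc 2) (h : ℝ) :
    inner ℝ (planeInclusion p - axisPoint h) (planeInclusion q - axisPoint h) =
      inner ℝ p q + h ^ 2 := by
  simp [PiLp.inner_apply, Fin.sum_univ_three, planeInclusion, axisPoint]
  ring

theorem inner_sub_planeInclusion (p q : Euc 2) (h : ℝ) :
    inner ℝ (axisPoint h - planeInclusion p) (planeInclusion q - planeInclusion p) =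
      ‖p‖ ^ 2 - inner ℝ p q := by
  rw [EuclideanSpace.real_norm_sq_eq]
  simp [Fin.sum_univ_two, PiLp.inner_apply, Fin.sum_univ_three, planeInclusion, axisPoint]
  ring

theorem norm_planeInclusion_sub_axisPoint (p : Euc 2) {u : ℝ} (hu : u ≠ 0) :
    ‖planeInclusion p - axisPoint u⁻¹‖ = √(u ^ 2 * ‖p‖ ^ 2 + 1) / |u| := by
  have h1 : ‖planeInclusion p - axisPoint u⁻¹‖ ^ 2 = (u ^ 2 * ‖p‖ ^ 2 + 1) / |u| ^ 2 := by
    rw [← real_inner_self_eq_norm_sq, inner_planeInclusion_sub_axisPoint, sq_abs,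
      real_inner_self_eq_norm_sq]
    field_simp
  rw [← Real.sqrt_sq (norm_nonneg _), h1, Real.sqrt_div (by positivity),
    Real.sqrt_sq (abs_nonneg u)]

/-- In terms of the inverse height `u` the formula is even and stays continuous at `u = 0`, where
the apex is at infinity and the angle is zero. -/
theorem angle_axisPoint (p q : Euc 2) {u : ℝ} (hu : u ≠ 0) :
    ∠ (planeInclusion p) (axisPoint u⁻¹) (planeInclusion q) =
      Real.arccos ((u ^ 2 * inner ℝ p q + 1) /
        (√(u ^ 2 * ‖p‖ ^ 2 + 1) * √(u ^ 2 * ‖q‖ ^ 2 + 1))) := by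
  rw [EuclideanGeometry.angle, InnerProductGeometry.angle, vsub_eq_sub, vsub_eq_sub,
    inner_planeInclusion_sub_axisPoint, norm_planeInclusion_sub_axisPoint p hu,
    norm_planeInclusion_sub_axisPoint q hu]
  congr 1
  have hp : √(u ^ 2 * ‖p‖ ^ 2 + 1) ≠ 0 := (Real.sqrt_pos.2 (by positivity)).ne'
  have hq : √(u ^ 2 * ‖q‖ ^ 2 + 1) ≠ 0 := (Real.sqrt_pos.2 (by positivity)).ne'
  have hu' : |u| ≠ 0 := abs_ne_zero.2 hu
  have h2 : |u| * |u| = u ^ 2 := by rw [← sq_abs]; ring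
  rw [div_mul_div_comm, h2]
  field_simp

/-- Four such acute angles at a base vertex keep its total angle below `2π`. -/
theorem angle_planeInclusion_lt (p q : Euc 2) (h : ℝ) (hpq : inner ℝ p q < ‖p‖ ^ 2) :
    ∠ (axisPoint h) (planeInclusion p) (planeInclusion q) < Real.pi / 2 := by
  have hin : 0 < inner ℝ (axisPoint h - planeInclusion p) (planeInclusion q - planeInclusion p) := by
    rw [inner_sub_planeInclusion]; linarith
  rw [EuclideanGeometry.angle, InnerProductGeometry.angle, vsub_eq_sub, vsub_eq_sub,
    Real.arccos_lt_pi_div_two]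
  refine div_pos hin (mul_pos (norm_pos_iff.2 ?_) (norm_pos_iff.2 ?_))
  · intro h0; rw [h0, inner_zero_left] at hin; exact hin.ne rfl
  · intro h0; rw [h0, inner_zero_right] at hin; exact hin.ne rfl

/-- The polygon whose vertices are the first `n` terms of a sequence. -/
def polygonOfSeq (n : ℕ) (p : ℕ → Euc 2) : Polygon (Euc 2) n := ⟨fun i => p i⟩

theorem affineIndependent_of_det_ne_zero {a b c : Euc 2}
    (h : (b 0 - a 0) * (c 1 - a 1) - (b 1 - a 1) * (c 0 - a 0) ≠ 0) :
    AffineIndependent ℝ ![a, b, c] := by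
  rw [affineIndependent_iff_not_collinear_set, collinear_iff_of_mem (p₀ := a) (by simp)]
  rintro ⟨v, hv⟩
  obtain ⟨r, hr⟩ := hv b (by simp)
  obtain ⟨s, hs⟩ := hv c (by simp)
  apply h
  simp only [hr, hs, vadd_eq_add, PiLp.add_apply, PiLp.smul_apply, smul_eq_mul]
  ring

theorem polygonOfSeq_add_one {n : ℕ} [NeZero n] {p : ℕ → Euc 2} (h0 : p n = p 0) (i : Fin n) :
    polygonOfSeq n p (i + 1) = p (i + 1) := by
  change p ((i + 1 : Fin n) : ℕ) = _
  obtain ⟨m, rfl⟩ := Nat.exists_eq_succ_of_ne_zero (NeZero.ne n)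
  rw [Fin.val_add_one]
  split_ifs with hi
  · rw [← h0, hi, Fin.val_last]
  · rfl

/-- Repeating the first two points at the end of the sequence replaces cyclic indices by natural
numbers; only the pair of the first and the last edge remains as an exception. -/
theorem isSimplePolygon_polygonOfSeq {n : ℕ} [NeZero n] {p : ℕ → Euc 2} (hn : 2 ≤ n)
    (h0 : p n = p 0) (h1 : p (n + 1) = p 1)
    (hdet : ∀ i < n, (p (i + 1) 0 - p i 0) * (p (i + 2) 1 - p i 1) -
      (p (i + 1) 1 - p i 1) * (p (i + 2) 0 - p i 0) ≠ 0)
    (hdisj : ∀ i j, i + 1 < j → j < n → (i = 0 → j + 1 ≠ n) →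
      Disjoint (segment ℝ (p i) (p (i + 1))) (segment ℝ (p j) (p (j + 1)))) :
    IsSimplePolygon (polygonOfSeq n p) := by
  have e1 : ∀ i : Fin n, polygonOfSeq n p (i + 1) = p (i + 1) := polygonOfSeq_add_one h0
  have e2 : ∀ i : Fin n, polygonOfSeq n p (i + 2) = p (i + 2) := by
    intro i
    rw [← Fin.add_one_add_one, e1]
    by_cases hi : (i : ℕ) + 1 = n
    · have : ((i + 1 : Fin n) : ℕ) = 0 := by
        rw [Fin.val_add_eq_ite]
        have : ((1 : Fin n) : ℕ) = 1 := by
          rw [Fin.val_one', Nat.mod_eq_of_lt (by omega)]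
        split_ifs <;> omega
      rw [this, show (i : ℕ) + 2 = n + 1 by omega, h1]
    · have : ((i + 1 : Fin n) : ℕ) = i + 1 := by
        rw [Fin.val_add_eq_ite]
        have : ((1 : Fin n) : ℕ) = 1 := by
          rw [Fin.val_one', Nat.mod_eq_of_lt (by omega)]
        split_ifs <;> omega
      rw [this]
  refine ⟨fun i => ?_, ?_⟩
  · rw [e1, e2]
    exact affineIndependent_of_det_ne_zero (hdet i i.2)
  · have key : ∀ i j : Fin n, i < j → j ≠ finRotate n i → i ≠ finRotate n j →
        Disjoint ((polygonOfSeq n p).edgeSet ℝ i) ((polygonOfSeq n p).edgeSet ℝ j) := by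
      intro i j hij hj hi
      rw [finRotate_eq_add_one] at hi hj
      rw [Polygon.edgeSet, Polygon.edgeSet, affineSegment_eq_segment, affineSegment_eq_segment,
        finRotate_eq_add_one, finRotate_eq_add_one, e1, e1]
      have hval : ((1 : Fin n) : ℕ) = 1 := by
        rw [Fin.val_one', Nat.mod_eq_of_lt (by omega)]
      refine hdisj i j ?_ j.2 ?_
      · have h3 : (i : ℕ) < j := hij
        refine lt_of_le_of_ne h3 (fun h => hj (Fin.ext ?_))
        rw [Fin.val_add_eq_ite]
        split_ifs <;> omega
      · intro hi0 hjn
        refine hi (Fin.ext ?_)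
        rw [Fin.val_add_eq_ite]
        split_ifs <;> omega
    intro i j hij hj hi
    rcases lt_or_gt_of_ne hij with h | h
    · exact key i j h hj hi
    · exact (key j i h hi hj).symm

/-! ### Jensen's equation. -/

/-- At the leftmost point `r` of a positive maximum, the mean of `d (r - δ)` and `d (r + δ)` is the
maximum, so both are maximal, against the choice of `r`. -/
theorem nonpos_of_midpoint {d : ℝ → ℝ} {p q : ℝ} (hd : ContinuousOn d (Set.Icc p q))
    (hmid : ∀ u ∈ Set.Icc p q, ∀ v ∈ Set.Icc p q, d u + d v = 2 * d ((u + v) / 2))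
    (hp : d p = 0) (hq : d q = 0) {t : ℝ} (ht : t ∈ Set.Icc p q) : d t ≤ 0 := by
  obtain ⟨s, hs, hmax⟩ := isCompact_Icc.exists_isMaxOn ⟨t, ht⟩ hd
  refine (hmax ht).trans ?_
  by_contra! hpos
  have hpos : 0 < d s := hpos
  have hcl : IsCompact (Set.Icc p q ∩ d ⁻¹' {d s}) :=
    isCompact_Icc.of_isClosed_subset (hd.preimage_isClosed_of_isClosed isClosed_Icc
      isClosed_singleton) Set.inter_subset_left
  obtain ⟨r, ⟨hr, hrs⟩, hleast⟩ := hcl.exists_isLeast ⟨s, hs, rfl⟩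
  have hrs : d r = d s := hrs
  have hrp : p < r := hr.1.lt_of_ne (by rintro rfl; linarith)
  have hrq : r < q := hr.2.lt_of_ne (by rintro rfl; linarith)
  set δ := min (r - p) (q - r) with hδ
  have h1 : δ ≤ r - p := min_le_left _ _
  have h2 : δ ≤ q - r := min_le_right _ _
  have h3 : 0 < δ := lt_min (by linarith) (by linarith)
  have hm1 : r - δ ∈ Set.Icc p q := ⟨by linarith, by linarith⟩
  have hm2 : r + δ ∈ Set.Icc p q := ⟨by linarith, by linarith⟩
  have hsum := hmid _ hm1 _ hm2
  rw [show (r - δ + (r + δ)) / 2 = r by ring] at hsum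
  have b1 : d (r - δ) ≤ d s := hmax hm1
  have b2 : d (r + δ) ≤ d s := hmax hm2
  have := hleast ⟨hm1, show d (r - δ) = d s by linarith⟩
  linarith

/-- A continuous function that satisfies Jensen's equation on an interval is affine there. -/
theorem exists_affine_of_midpoint {f : ℝ → ℝ} {a b : ℝ} (hab : a < b)
    (hf : ContinuousOn f (Set.Ioo a b))
    (hmid : ∀ u ∈ Set.Ioo a b, ∀ v ∈ Set.Ioo a b, f u + f v = 2 * f ((u + v) / 2)) :
    ∃ k m : ℝ, ∀ u ∈ Set.Ioo a b, f u = k * u + m := by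
  have hline : ∀ p q : ℝ, a < p → p < q → q < b → ∃ k m : ℝ, ∀ u ∈ Set.Icc p q, f u = k * u + m := by
    intro p q hap hpq hqb
    have hsub : Set.Icc p q ⊆ Set.Ioo a b := fun t ht => ⟨hap.trans_le ht.1, ht.2.trans_lt hqb⟩
    set k := (f q - f p) / (q - p) with hk
    have hkq : k * (q - p) = f q - f p := div_mul_cancel₀ _ (by linarith)
    set d : ℝ → ℝ := fun t => f t - (f p + k * (t - p)) with hd
    have hdc : ContinuousOn d (Set.Icc p q) := (hf.mono hsub).sub (by fun_prop)
    have hdm : ∀ u ∈ Set.Icc p q, ∀ v ∈ Set.Icc p q, d u + d v = 2 * d ((u + v) / 2) := by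
      intro u hu v hv
      have := hmid u (hsub hu) v (hsub hv)
      simp only [hd]
      linarith
    have hd0 : d p = 0 := by simp [hd]
    have hd1 : d q = 0 := by simp only [hd]; linarith
    refine ⟨k, f p - k * p, fun u hu => ?_⟩
    have h1 := nonpos_of_midpoint hdc hdm hd0 hd1 hu
    have h2 := nonpos_of_midpoint (d := fun t => -d t) hdc.neg
      (fun u hu v hv => by linarith [hdm u hu v hv]) (by simp [hd0]) (by simp [hd1]) hu
    simp only [hd] at h1 h2
    linarith
  -- The middle third fixes the constants; any other point shares a compact interval with it, on
  -- which `f` is affine with the same constants.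
  set p₀ := (2 * a + b) / 3 with hp₀
  set q₀ := (a + 2 * b) / 3 with hq₀
  obtain ⟨k, m, h₀⟩ := hline p₀ q₀ (by rw [hp₀]; linarith) (by rw [hp₀, hq₀]; linarith)
    (by rw [hq₀]; linarith)
  have hpq : p₀ < q₀ := by rw [hp₀, hq₀]; linarith
  refine ⟨k, m, fun u hu => ?_⟩
  obtain ⟨k', m', h⟩ := hline (min u p₀) (max u q₀)
    (lt_min hu.1 (by rw [hp₀]; linarith))
    ((min_le_right _ _).trans_lt (hpq.trans_le (le_max_right _ _)))
    (max_lt hu.2 (by rw [hq₀]; linarith))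
  have e1 := h₀ p₀ ⟨le_rfl, hpq.le⟩
  have e2 := h₀ q₀ ⟨hpq.le, le_rfl⟩
  have e3 := h p₀ ⟨min_le_right _ _, hpq.le.trans (le_max_right _ _)⟩
  have e4 := h q₀ ⟨(min_le_right _ _).trans hpq.le, le_max_right _ _⟩
  have e5 := h u ⟨min_le_left _ _, le_max_left _ _⟩
  have hk : k = k' := by
    have : (k - k') * (q₀ - p₀) = 0 := by linarith
    rcases mul_eq_zero.1 this with h | h <;> linarith
  subst hk
  linarith

/-! ### Moving apexes, and bipyramids over the regular triangle. -/

section Convergence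

variable {n : ℕ} [NeZero n] {P : Polygon (Euc 2) n} {x x' y : Euc 3}
  (hP : IsSimplePolygon P) (hx : 0 < x 2) (hy : y 2 < 0)

theorem isSimplicialIso_bipyramid (hx' : 0 < x' 2) :
    IsSimplicialIso (Function.update id x x') (bipyramid hP hx hy).faces
      (bipyramid hP hx' hy).faces := by
  have hxy : y ≠ x := by rintro rfl; linarith
  have hxy' : y ≠ x' := by rintro rfl; linarith
  have hap := apex_ne_planeInclusion hx hy (a := x) (by simp)
  have hap' := apex_ne_planeInclusion hx' hy (a := x') (by simp)
  set g : Euc 3 → Euc 3 := Function.update id x x' with hg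
  have gx : g x = x' := Function.update_self _ _ _
  have gy : g y = y := Function.update_of_ne hxy _ _
  have gq : ∀ p, g (planeInclusion p) = planeInclusion p := fun p =>
    Function.update_of_ne (hap p).symm _ _
  have hvert : ∀ v, {v} ∈ (bipyramid hP hx hy).faces → v = x ∨ (g v = v ∧ v ≠ x') := by
    intro v hv
    obtain ⟨-, i, a, ha, hs⟩ := (mem_bipyramid_faces hP hx hy).1 hv
    rw [Finset.singleton_subset_iff] at hs
    simp only [Finset.mem_insert, Finset.mem_singleton] at hs
    rcases hs with rfl | rfl | rfl
    · rcases ha with rfl | rfl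
      exacts [Or.inl rfl, Or.inr ⟨gy, hxy'⟩]
    · exact Or.inr ⟨gq _, (hap' _).symm⟩
    · exact Or.inr ⟨gq _, (hap' _).symm⟩
  have himg : ∀ a i, Finset.image g {a, planeInclusion (P i), planeInclusion (P (i + 1))} =
      {g a, planeInclusion (P i), planeInclusion (P (i + 1))} := by
    intro a i
    rw [Finset.image_insert, Finset.image_insert, Finset.image_singleton, gq, gq]
  refine ⟨?_, ?_⟩
  · intro v hv w hw he
    rcases hvert v hv with rfl | ⟨h1, h2⟩ <;> rcases hvert w hw with rfl | ⟨h3, h4⟩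
    · rfl
    · rw [gx, h3] at he; exact absurd he.symm h4
    · rw [gx, h1] at he; exact absurd he h2
    · rwa [h1, h3] at he
  · ext s
    rw [mem_bipyramid_faces]
    constructor
    · rintro ⟨s, hs, rfl⟩
      obtain ⟨hne, i, a, ha, hsub⟩ := (mem_bipyramid_faces hP hx hy).1 hs
      refine ⟨hne.image g, i, g a, ?_, ?_⟩
      · rcases ha with rfl | rfl
        · simp [gx]
        · simp [gy]
      · rw [← himg]
        exact Finset.image_subset_image hsub
    · rintro ⟨hne, i, a', ha', hsub⟩
      obtain ⟨a, ha, rfl⟩ : ∃ a ∈ ({x, y} : Set (Euc 3)), g a = a' := by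
        rcases ha' with rfl | rfl
        exacts [⟨x, by simp, gx⟩, ⟨_, by simp, gy⟩]
      rw [← himg] at hsub
      obtain ⟨s, hs, rfl⟩ := Finset.subset_image_iff.1 hsub
      exact ⟨s, (mem_bipyramid_faces hP hx hy).2 ⟨Finset.image_nonempty.1 hne, i, a, ha,
        by exact_mod_cast hs⟩, rfl⟩

theorem convergesTo_bipyramid {xs : ℕ → Euc 3} (hxs : ∀ j, 0 < xs j 2)
    (hlim : Tendsto xs atTop (𝓝 x)) :
    ConvergesTo (fun j => bipyramid hP (hxs j) hy) (fun j => Function.update id x (xs j))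
      (bipyramid hP hx hy) := by
  refine ⟨fun j => isSimplicialIso_bipyramid hP hx hy (hxs j), fun u _ => ?_⟩
  by_cases hu : u = x
  · subst hu
    simpa using hlim
  · simp [Function.update_of_ne hu]

end Convergence

section Triangle

/-- The regular triangle inscribed in the unit circle. -/
noncomputable def regularTriangle : Polygon (Euc 2) 3 :=
  ⟨![!₂[1, 0], !₂[-(1 / 2), √3 / 2], !₂[-(1 / 2), -(√3 / 2)]]⟩

theorem isSimplePolygon_regularTriangle : IsSimplePolygon regularTriangle := by
  have h3 : (0 : ℝ) < √3 := by positivity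
  refine ⟨fun i => affineIndependent_of_det_ne_zero ?_, fun i j h1 h2 h3 => ?_⟩
  · have : ∀ z : ℝ, z < 0 ∨ 0 < z → z ≠ 0 := fun z hz => hz.elim ne_of_lt (fun h => h.ne')
    apply this
    right
    fin_cases i <;> simp [regularTriangle] <;> nlinarith
  -- Any two distinct edges of a triangle are adjacent.
  · exfalso
    revert i j
    decide

theorem norm_regularTriangle (i : Fin 3) : ‖regularTriangle i‖ ^ 2 = 1 := by
  have h3 : √3 ^ 2 = 3 := Real.sq_sqrt (by norm_num)
  rw [EuclideanSpace.real_norm_sq_eq, Fin.sum_univ_two]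
  fin_cases i <;> simp [regularTriangle] <;> nlinarith

theorem inner_regularTriangle (i : Fin 3) :
    inner ℝ (regularTriangle i) (regularTriangle (i + 1)) = -(1 / 2 : ℝ) := by
  have h3 : √3 ^ 2 = 3 := Real.sq_sqrt (by norm_num)
  rw [PiLp.inner_apply, Fin.sum_univ_two]
  fin_cases i <;> simp [regularTriangle] <;> nlinarith

/-- The inverse height at which an equilateral triangle inscribed in the unit circle is seen with
face angles `α`. -/
noncomputable def inverseHeight (α : ℝ) : ℝ := √((1 - Real.cos α) / (Real.cos α + 1 / 2))

theorem cos_add_half_pos {α : ℝ} (h0 : 0 < α) (h1 : α < 2 * Real.pi / 3) :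
    0 < Real.cos α + 1 / 2 := by
  have h2 : Real.cos (2 * Real.pi / 3) = -(1 / 2) := by
    rw [show 2 * Real.pi / 3 = Real.pi - Real.pi / 3 by ring, Real.cos_pi_sub, Real.cos_pi_div_three]
  have := Real.cos_lt_cos_of_nonneg_of_le_pi h0.le (by linarith [Real.pi_pos]) h1
  linarith

theorem inverseHeight_sq_pos {α : ℝ} (h0 : 0 < α) (h1 : α < 2 * Real.pi / 3) :
    0 < (1 - Real.cos α) / (Real.cos α + 1 / 2) := by
  refine div_pos ?_ (cos_add_half_pos h0 h1)
  have := Real.cos_lt_cos_of_nonneg_of_le_pi le_rfl (by linarith [Real.pi_pos]) h0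
  rw [Real.cos_zero] at this
  linarith

theorem inverseHeight_pos {α : ℝ} (h0 : 0 < α) (h1 : α < 2 * Real.pi / 3) : 0 < inverseHeight α :=
  Real.sqrt_pos.2 (inverseHeight_sq_pos h0 h1)

theorem continuousAt_inverseHeight {α : ℝ} (h0 : 0 < α) (h1 : α < 2 * Real.pi / 3) :
    ContinuousAt inverseHeight α := by
  unfold inverseHeight
  refine Real.continuous_sqrt.continuousAt.comp ?_
  exact ContinuousAt.div (by fun_prop) (by fun_prop) (cos_add_half_pos h0 h1).ne'

/-- For unit vectors with inner product `-1/2` the cosine of the angle is `(1 - u² / 2) / (1 + u²)`;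
solving for `u²` gives `inverseHeight`. The bound `2π / 3` is the limit in which the apex sinks into
the plane. -/
theorem angle_regularTriangle {α u : ℝ} (h0 : 0 < α) (h1 : α < 2 * Real.pi / 3)
    (hu : u = inverseHeight α ∨ u = -inverseHeight α) (i : Fin 3) :
    ∠ (planeInclusion (regularTriangle i)) (axisPoint u⁻¹)
      (planeInclusion (regularTriangle (i + 1))) = α := by
  have hs := inverseHeight_pos h0 h1
  have hu0 : u ≠ 0 := by rcases hu with rfl | rfl; exacts [hs.ne', neg_ne_zero.2 hs.ne']
  have hu2 : u ^ 2 = (1 - Real.cos α) / (Real.cos α + 1 / 2) := by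
    have : inverseHeight α ^ 2 = _ := Real.sq_sqrt (inverseHeight_sq_pos h0 h1).le
    rcases hu with rfl | rfl
    · exact this
    · rw [neg_sq]; exact this
  have hc := (cos_add_half_pos h0 h1).ne'
  rw [angle_axisPoint _ _ hu0, norm_regularTriangle, norm_regularTriangle, inner_regularTriangle,
    Real.mul_self_sqrt (by positivity), hu2]
  rw [← Real.arccos_cos h0.le (by linarith [Real.pi_pos])]
  congr 1
  rw [Real.arccos_cos h0.le (by linarith [Real.pi_pos])]
  have hne : (1 - Real.cos α) / (Real.cos α + 1 / 2) * 1 + 1 ≠ 0 := by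
    have := inverseHeight_sq_pos h0 h1
    positivity
  rw [div_eq_iff hne]
  obtain ⟨t, ht⟩ : ∃ t, Real.cos α = t - 1 / 2 := ⟨Real.cos α + 1 / 2, by ring⟩
  rw [ht, sub_add_cancel] at hc ⊢
  field_simp
  ring

theorem angle_base_regularTriangle {u : ℝ} (hu : u ≠ 0) (i j : Fin 3) :
    ∠ (axisPoint u⁻¹) (planeInclusion (regularTriangle i)) (planeInclusion (regularTriangle j)) =
      (Real.pi - ∠ (planeInclusion (regularTriangle i)) (axisPoint u⁻¹)
        (planeInclusion (regularTriangle j))) / 2 := by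
  have hd : ∀ i, dist (axisPoint u⁻¹) (planeInclusion (regularTriangle i)) =
      √(u ^ 2 * 1 + 1) / |u| := by
    intro i
    rw [dist_comm, dist_eq_norm, norm_planeInclusion_sub_axisPoint _ hu, norm_regularTriangle]
  have h1 := EuclideanGeometry.angle_eq_angle_of_dist_eq ((hd i).trans (hd j).symm)
  have hne : planeInclusion (regularTriangle i) ≠ axisPoint u⁻¹ := by
    intro e
    have := planeInclusion_two (regularTriangle i)
    rw [e, axisPoint_two] at this
    exact inv_ne_zero hu this
  have h2 := angle_add_angle_add_angle_eq_pi (planeInclusion (regularTriangle j)) hne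
  rw [angle_comm (planeInclusion (regularTriangle i)) (planeInclusion (regularTriangle j)),
    angle_comm (planeInclusion (regularTriangle j)) (axisPoint u⁻¹)] at h2
  have h3 := angle_comm (axisPoint u⁻¹) (planeInclusion (regularTriangle j))
    (planeInclusion (regularTriangle i))
  linarith

end Triangle

/-- On the surfaces of `S`, which contain the bipyramids, `φ` is a function `f` of the total angle;
it is continuous, and sums to `c` on bipyramids. -/
structure IsAngleFunction (S : ComplexSet) (φ : VertexFunction) (c : ℝ) (f : ℝ → ℝ) : Prop where
  apply_eq : ∀ (N : ℕ), ∀ K ∈ S N, ∀ v ∈ K.vertices, φ N K v = f (K.totalAngle v)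
  isContinuous : φ.IsContinuous S
  bipyramid_mem : ∀ K : TwoComplex 3, K.IsBipyramid → K ∈ S 3
  finsum_eq : ∀ K : TwoComplex 3, K.IsBipyramid → ∑ᶠ v ∈ K.vertices, φ 3 K v = c

namespace IsAngleFunction

variable {S : ComplexSet} {φ : VertexFunction} {c : ℝ} {f : ℝ → ℝ}

theorem sum_bipyramid (h : IsAngleFunction S φ c f) {n : ℕ} [NeZero n] {P : Polygon (Euc 2) n}
    {x y : Euc 3} (hP : IsSimplePolygon P) (hx : 0 < x 2) (hy : y 2 < 0) :
    f ((bipyramid hP hx hy).totalAngle x) + f ((bipyramid hP hx hy).totalAngle y) +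
      ∑ i, f ((bipyramid hP hx hy).totalAngle (planeInclusion (P i))) = c := by
  rw [← h.finsum_eq _ (isBipyramid_bipyramid hP hx hy), ← bipyramid_finsum_vertices hP hx hy
    (fun v => f ((bipyramid hP hx hy).totalAngle v))]
  refine finsum_mem_congr rfl (fun v hv => ?_)
  exact (h.apply_eq 3 _ (h.bipyramid_mem _ (isBipyramid_bipyramid hP hx hy)) v hv).symm

end IsAngleFunction

section Triangle

variable {α β : ℝ}

theorem axisPoint_inverseHeight_pos (h0 : 0 < α) (h1 : α < 2 * Real.pi / 3) :
    0 < axisPoint (inverseHeight α)⁻¹ 2 := by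
  rw [axisPoint_two]
  exact inv_pos.2 (inverseHeight_pos h0 h1)

theorem axisPoint_neg_inverseHeight_neg (h0 : 0 < α) (h1 : α < 2 * Real.pi / 3) :
    axisPoint (-inverseHeight α)⁻¹ 2 < 0 := by
  rw [axisPoint_two]
  exact inv_lt_zero.2 (neg_neg_iff_pos.2 (inverseHeight_pos h0 h1))

/-- The bipyramid over the regular triangle with face angles `α` and `β` at the apexes. -/
noncomputable def triangularBipyramid (hα0 : 0 < α) (hα1 : α < 2 * Real.pi / 3) (hβ0 : 0 < β)
    (hβ1 : β < 2 * Real.pi / 3) : TwoComplex 3 :=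
  bipyramid isSimplePolygon_regularTriangle (axisPoint_inverseHeight_pos hα0 hα1)
    (axisPoint_neg_inverseHeight_neg hβ0 hβ1)

variable (hα0 : 0 < α) (hα1 : α < 2 * Real.pi / 3) (hβ0 : 0 < β) (hβ1 : β < 2 * Real.pi / 3)

theorem triangularBipyramid_top :
    (triangularBipyramid hα0 hα1 hβ0 hβ1).totalAngle (axisPoint (inverseHeight α)⁻¹) = 3 * α := by
  rw [triangularBipyramid, bipyramid_totalAngle_apex _ _ _ (by simp),
    Finset.sum_congr rfl (fun i _ => angle_regularTriangle hα0 hα1 (Or.inl rfl) i)]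
  simp

theorem triangularBipyramid_bottom :
    (triangularBipyramid hα0 hα1 hβ0 hβ1).totalAngle (axisPoint (-inverseHeight β)⁻¹) = 3 * β := by
  rw [triangularBipyramid, bipyramid_totalAngle_apex _ _ _ (by simp),
    Finset.sum_congr rfl (fun i _ => angle_regularTriangle hβ0 hβ1 (Or.inr rfl) i)]
  simp

theorem triangularBipyramid_base (i : Fin 3) :
    (triangularBipyramid hα0 hα1 hβ0 hβ1).totalAngle (planeInclusion (regularTriangle i)) =
      2 * Real.pi - α - β := by
  have ha := (inverseHeight_pos hα0 hα1).ne'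
  have hb := neg_ne_zero.2 (inverseHeight_pos hβ0 hβ1).ne'
  have e1 := angle_regularTriangle hα0 hα1 (Or.inl rfl)
  have e2 := angle_regularTriangle hβ0 hβ1 (Or.inr rfl)
  have e1' := e1 (i - 1)
  have e2' := e2 (i - 1)
  rw [sub_add_cancel, angle_comm] at e1' e2'
  rw [triangularBipyramid, bipyramid_totalAngle_base, angle_base_regularTriangle ha,
    angle_base_regularTriangle ha, angle_base_regularTriangle hb, angle_base_regularTriangle hb,
    e1, e2, e1', e2']
  ring

end Triangle

namespace IsAngleFunction

variable {S : ComplexSet} {φ : VertexFunction} {c : ℝ} {f : ℝ → ℝ}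

/-- The apexes have face angles `u / 3` and `v / 3`. The faces are isosceles, so the base angles
depend only on `u + v`. -/
theorem triangular (h : IsAngleFunction S φ c f) {u v : ℝ} (hu : u ∈ Set.Ioo 0 (2 * Real.pi))
    (hv : v ∈ Set.Ioo 0 (2 * Real.pi)) :
    f u + f v + 3 * f (2 * Real.pi - (u + v) / 3) = c := by
  have hu0 : 0 < u / 3 := by linarith [hu.1]
  have hu1 : u / 3 < 2 * Real.pi / 3 := by linarith [hu.2]
  have hv0 : 0 < v / 3 := by linarith [hv.1]
  have hv1 : v / 3 < 2 * Real.pi / 3 := by linarith [hv.2]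
  have key := h.sum_bipyramid isSimplePolygon_regularTriangle
    (axisPoint_inverseHeight_pos hu0 hu1) (axisPoint_neg_inverseHeight_neg hv0 hv1)
  have e1 := triangularBipyramid_top hu0 hu1 hv0 hv1
  have e2 := triangularBipyramid_bottom hu0 hu1 hv0 hv1
  have e3 := triangularBipyramid_base hu0 hu1 hv0 hv1
  rw [triangularBipyramid] at e1 e2 e3
  simp only [e1, e2, e3, Finset.sum_const, Finset.card_univ, Fintype.card_fin, nsmul_eq_mul] at key
  rw [show 3 * (u / 3) = u by ring, show 3 * (v / 3) = v by ring,
    show 2 * Real.pi - u / 3 - v / 3 = 2 * Real.pi - (u + v) / 3 by ring] at key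
  exact_mod_cast key

/-- One apex of a bipyramid over the regular triangle moves along the axis, and continuity of `φ` at
this apex is continuity of `f`. -/
theorem continuousOn (h : IsAngleFunction S φ c f) :
    ContinuousOn f (Set.Ioo 0 (2 * Real.pi)) := by
  rw [continuousOn_iff_continuous_domRestrict]
  refine SeqContinuous.continuous (fun t u htu => ?_)
  have h0 : ∀ z : Set.Ioo 0 (2 * Real.pi), 0 < z.1 / 3 := fun z => by linarith [z.2.1]
  have h1 : ∀ z : Set.Ioo 0 (2 * Real.pi), z.1 / 3 < 2 * Real.pi / 3 := fun z => by
    linarith [z.2.2]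
  -- The other apex stays fixed; its face angle `1` is any admissible value.
  have hβ1 : (1 : ℝ) < 2 * Real.pi / 3 := by linarith [Real.pi_gt_three]
  have hlim : Tendsto (fun j => axisPoint (inverseHeight ((t j).1 / 3))⁻¹) atTop
      (𝓝 (axisPoint (inverseHeight (u.1 / 3))⁻¹)) := by
    have hc : ContinuousAt (fun z : ℝ => axisPoint (inverseHeight z)⁻¹) (u.1 / 3) := by
      have : Continuous axisPoint := by
        unfold axisPoint
        refine (PiLp.continuous_toLp 2 _).comp (continuous_pi fun i => ?_)
        fin_cases i <;> simp <;> fun_prop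
      exact this.continuousAt.comp ((continuousAt_inverseHeight (h0 u) (h1 u)).inv₀
        (inverseHeight_pos (h0 u) (h1 u)).ne')
    refine hc.tendsto.comp ?_
    exact ((continuous_subtype_val.tendsto u).comp htu).div_const 3
  have hconv := convergesTo_bipyramid isSimplePolygon_regularTriangle
    (axisPoint_inverseHeight_pos (h0 u) (h1 u)) (axisPoint_neg_inverseHeight_neg one_pos hβ1)
    (fun j => axisPoint_inverseHeight_pos (h0 (t j)) (h1 (t j))) hlim
  have hmem : ∀ z : Set.Ioo 0 (2 * Real.pi),
      triangularBipyramid (h0 z) (h1 z) one_pos hβ1 ∈ S 3 :=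
    fun z => h.bipyramid_mem _ (isBipyramid_bipyramid _ _ _)
  have hvert : ∀ z : Set.Ioo 0 (2 * Real.pi), axisPoint (inverseHeight (z.1 / 3))⁻¹ ∈
      (triangularBipyramid (h0 z) (h1 z) one_pos hβ1).vertices := by
    intro z
    rw [triangularBipyramid, bipyramid_vertices]
    simp
  have hval : ∀ z : Set.Ioo 0 (2 * Real.pi),
      φ 3 (triangularBipyramid (h0 z) (h1 z) one_pos hβ1) (axisPoint (inverseHeight (z.1 / 3))⁻¹) =
        f z := by
    intro z
    rw [h.apply_eq 3 _ (hmem z) _ (hvert z), triangularBipyramid_top]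
    congr 1
    ring
  have key := h.isContinuous 3 _ _ _ (hmem u) (fun j => hmem (t j)) hconv _ (hvert u)
  simp only [Function.update_self, hval] at key
  exact key

/-- Comparing the relation for `(u, v)` with that for the mean taken twice cancels the base terms
and leaves Jensen's equation. The relation between the constants is the case `u = v = π`. -/
theorem exists_affine (h : IsAngleFunction S φ c f) :
    ∃ k m : ℝ, (∀ u ∈ Set.Ioo 0 (2 * Real.pi), f u = k * u + m) ∧
      6 * Real.pi * k + 5 * m = c := by
  have hpi := Real.pi_pos
  obtain ⟨k, m, hkm⟩ := exists_affine_of_midpoint (by linarith) h.continuousOn (by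
    intro u hu v hv
    have e1 := h.triangular hu hv
    have hw : (u + v) / 2 ∈ Set.Ioo 0 (2 * Real.pi) :=
      ⟨by linarith [hu.1, hv.1], by linarith [hu.2, hv.2]⟩
    have e2 := h.triangular hw hw
    rw [show (u + v) / 2 + (u + v) / 2 = u + v by ring] at e2
    linarith)
  refine ⟨k, m, hkm, ?_⟩
  have hmem : Real.pi ∈ Set.Ioo 0 (2 * Real.pi) := ⟨hpi, by linarith⟩
  have e := h.triangular hmem hmem
  rw [hkm _ hmem, hkm _ ⟨by linarith, by linarith⟩] at e
  linarith

end IsAngleFunction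

/-! ### Comb-shaped polygons, with arbitrarily large apex angles. -/

/-- The vertices of a comb: `2 m + 1` points alternating between the lines `z 0 = -1` and `z 0 = 1`,
at increasing heights in `[0, 1 / 2)`, then two far points that close the polygon, and the first two
points again. -/
noncomputable def combPoint (m j : ℕ) : Euc 2 :=
  if j ≤ 2 * m then !₂[(-1) ^ (j + 1), j / (4 * m + 2)]
  else if j = 2 * m + 1 then !₂[10, 1]
  else if j = 2 * m + 2 then !₂[0, -20]
  else if j = 2 * m + 3 then !₂[-1, 0]
  else !₂[1, 1 / (4 * m + 2)]

section Comb

variable {m : ℕ}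

theorem combPoint_of_le {j : ℕ} (h : j ≤ 2 * m) :
    combPoint m j = (!₂[(-1) ^ (j + 1), j / (4 * m + 2)] : Euc 2) := if_pos h

theorem combPoint_right (m : ℕ) : combPoint m (2 * m + 1) = (!₂[10, 1] : Euc 2) := by simp [combPoint]

theorem combPoint_bottom (m : ℕ) : combPoint m (2 * m + 2) = (!₂[0, -20] : Euc 2) := by simp [combPoint]

theorem combPoint_zero (m : ℕ) : combPoint m 0 = (!₂[-1, 0] : Euc 2) := by simp [combPoint]

theorem combPoint_one (hm : 1 ≤ m) : combPoint m 1 = (!₂[1, 1 / (4 * m + 2)] : Euc 2) := by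
  rw [combPoint_of_le (by omega)]
  simp

theorem combPoint_last (m : ℕ) : combPoint m (2 * m) = (!₂[-1, 2 * m / (4 * m + 2)] : Euc 2) := by
  rw [combPoint_of_le le_rfl, pow_succ, pow_mul]
  simp

theorem combPoint_period (m : ℕ) : combPoint m (2 * m + 3) = combPoint m 0 := by
  rw [combPoint_zero]
  simp [combPoint]

theorem combPoint_period_one (hm : 1 ≤ m) : combPoint m (2 * m + 3 + 1) = combPoint m 1 := by
  rw [combPoint_one hm]
  simp [combPoint]

theorem combPoint_zero_sq {j : ℕ} (h : j ≤ 2 * m) : combPoint m j 0 ^ 2 = 1 := by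
  rw [combPoint_of_le h]
  simp [← pow_mul, mul_comm _ 2]

theorem combPoint_succ_zero {j : ℕ} (h : j < 2 * m) : combPoint m (j + 1) 0 = -combPoint m j 0 := by
  rw [combPoint_of_le h.le, combPoint_of_le h]
  simp [pow_succ]

theorem combPoint_height {j : ℕ} (h : j ≤ 2 * m) : combPoint m j 1 = j / (4 * m + 2) := by
  rw [combPoint_of_le h]
  simp

theorem combPoint_height_lt {i j : ℕ} (hij : i < j) (h : j ≤ 2 * m) :
    combPoint m i 1 < combPoint m j 1 := by
  rw [combPoint_height h, combPoint_height (hij.le.trans h)]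
  gcongr

theorem combPoint_height_nonneg {j : ℕ} (h : j ≤ 2 * m) : 0 ≤ combPoint m j 1 := by
  rw [combPoint_height h]
  positivity

theorem combPoint_height_lt_half {j : ℕ} (h : j ≤ 2 * m) : combPoint m j 1 < 1 / 2 := by
  rw [combPoint_height h, div_lt_iff₀ (by positivity)]
  have : (j : ℝ) ≤ 2 * m := by exact_mod_cast h
  linarith

theorem combPoint_det (hm : 1 ≤ m) {i : ℕ} (hi : i < 2 * m + 3) :
    (combPoint m (i + 1) 0 - combPoint m i 0) * (combPoint m (i + 2) 1 - combPoint m i 1) -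
      (combPoint m (i + 1) 1 - combPoint m i 1) * (combPoint m (i + 2) 0 - combPoint m i 0) ≠ 0 := by
  obtain h | h | rfl | rfl | rfl : i + 2 ≤ 2 * m ∨ i + 1 = 2 * m ∨ i = 2 * m ∨ i = 2 * m + 1 ∨
      i = 2 * m + 2 := by omega
  · have e1 := combPoint_succ_zero (m := m) (j := i) (by omega)
    have e2 := combPoint_succ_zero (m := m) (j := i + 1) (by omega)
    have e3 := combPoint_height_lt (m := m) (i := i) (j := i + 2) (by omega) h
    have e4 := combPoint_zero_sq (m := m) (j := i) (by omega)
    have e5 : combPoint m i 0 ≠ 0 := by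
      intro h0; rw [h0] at e4; norm_num at e4
    rw [show combPoint m (i + 2) 0 = combPoint m i 0 by rw [e2, e1, neg_neg], e1, sub_self, mul_zero,
      sub_zero]
    refine mul_ne_zero ?_ (sub_pos.2 e3).ne'
    intro h0
    exact e5 (by linarith)
  · have e1 := combPoint_succ_zero (m := m) (j := i) (by omega)
    have e2 := combPoint_height_lt (m := m) (i := i) (j := i + 1) (by omega) (by omega)
    have e3 := combPoint_height_lt_half (m := m) (j := i) (by omega)
    have e4 : combPoint m (i + 1) 0 = -1 := by rw [h, combPoint_last]; simp
    have e5 : combPoint m (i + 2) = (!₂[10, 1] : Euc 2) := by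
      rw [show i + 2 = 2 * m + 1 by omega, combPoint_right]
    rw [e5]
    simp
    nlinarith
  · have e1 := combPoint_height_nonneg (m := m) (j := 2 * m) le_rfl
    have e4 : combPoint m (2 * m) 0 = -1 := by rw [combPoint_last]; simp
    rw [combPoint_right, combPoint_bottom, e4]
    simp
    nlinarith
  · rw [combPoint_right, combPoint_bottom, combPoint_period, combPoint_zero]
    norm_num
  · rw [combPoint_bottom, show 2 * m + 2 + 2 = 2 * m + 3 + 1 by ring, combPoint_period_one hm,
      combPoint_period, combPoint_zero, combPoint_one hm]
    have : (0 : ℝ) < 4 * m + 2 := by positivity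
    have := inv_pos.2 this
    simp
    nlinarith

theorem mem_segment_apply {a b z : Euc 2} (hz : z ∈ segment ℝ a b) :
    ∃ s : ℝ, 0 ≤ s ∧ s ≤ 1 ∧ ∀ i, z i = a i + s * (b i - a i) := by
  rw [segment_eq_image'] at hz
  obtain ⟨s, ⟨h0, h1⟩, rfl⟩ := hz
  exact ⟨s, h0, h1, fun i => by simp⟩

theorem le_height_of_mem_segment {j : ℕ} (hj : j ≤ 2 * m) {z : Euc 2}
    (hz : z ∈ segment ℝ (combPoint m j) (combPoint m (j + 1))) : combPoint m j 1 ≤ z 1 := by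
  obtain ⟨s, h0, h1, h⟩ := mem_segment_apply hz
  have : combPoint m j 1 ≤ combPoint m (j + 1) 1 := by
    rcases hj.eq_or_lt with rfl | hj
    · rw [combPoint_right]
      have := combPoint_height_lt_half (m := m) (j := 2 * m) le_rfl
      simp
      linarith
    · exact (combPoint_height_lt (by omega) hj).le
  rw [h]
  nlinarith

theorem height_le_of_mem_segment {j : ℕ} (hj : j < 2 * m) {z : Euc 2}
    (hz : z ∈ segment ℝ (combPoint m j) (combPoint m (j + 1))) : z 1 ≤ combPoint m (j + 1) 1 := by
  obtain ⟨s, h0, h1, h⟩ := mem_segment_apply hz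
  have := combPoint_height_lt (m := m) (i := j) (by omega) hj
  rw [h]
  nlinarith

theorem apply_zero_le_of_mem_segment {j : ℕ} (hj : j < 2 * m) {z : Euc 2}
    (hz : z ∈ segment ℝ (combPoint m j) (combPoint m (j + 1))) : z 0 ≤ 1 := by
  obtain ⟨s, h0, h1, h⟩ := mem_segment_apply hz
  have e1 := combPoint_succ_zero hj
  have e2 : combPoint m j 0 = 1 ∨ combPoint m j 0 = -1 :=
    sq_eq_one_iff.1 (combPoint_zero_sq hj.le)
  rw [h, e1]
  rcases e2 with e | e <;> rw [e] <;> linarith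

/-- Nonadjacent edges of the zigzag, and the edge leaving it, are separated by height. The edge from
`(10, 1)` to `(0, -20)` has abscissa above `1` wherever its height is nonnegative, and the closing
edge from `(0, -20)` has height at most `0`. -/
theorem combPoint_disjoint {i j : ℕ} (hij : i + 1 < j) (hj : j < 2 * m + 3)
    (h0 : i = 0 → j + 1 ≠ 2 * m + 3) :
    Disjoint (segment ℝ (combPoint m i) (combPoint m (i + 1)))
      (segment ℝ (combPoint m j) (combPoint m (j + 1))) := by
  rw [Set.disjoint_left]
  intro z hi hz
  obtain h | rfl | rfl : j ≤ 2 * m ∨ j = 2 * m + 1 ∨ j = 2 * m + 2 := by omega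
  · have e1 := le_height_of_mem_segment h hz
    have e2 := height_le_of_mem_segment (by omega) hi
    have e3 := combPoint_height_lt hij h
    linarith
  · have e1 := le_height_of_mem_segment (by omega) hi
    have e2 := combPoint_height_nonneg (m := m) (j := i) (by omega)
    have e3 := apply_zero_le_of_mem_segment (by omega) hi
    obtain ⟨s, h0, h1, h⟩ := mem_segment_apply hz
    rw [combPoint_bottom, combPoint_right] at h
    have hx := h 0
    have hy := h 1
    simp at hx hy
    linarith
  · have e1 := le_height_of_mem_segment (by omega) hi
    have e2 := combPoint_height_lt (m := m) (i := 0) (j := i) (by omega) (by omega)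
    obtain ⟨s, h0, h1, h⟩ := mem_segment_apply hz
    rw [combPoint_bottom, combPoint_period, combPoint_zero] at h
    rw [combPoint_zero] at e2
    have hy := h 1
    simp at hy e2
    linarith

/-- The foot of the perpendicular from the origin to each edge falls inside that edge, so the faces
below an apex on the axis have acute base angles. -/
theorem inner_combPoint {j : ℕ} (hj : j < 2 * m + 3) :
    inner ℝ (combPoint m j) (combPoint m (j + 1)) < ‖combPoint m j‖ ^ 2 ∧
      inner ℝ (combPoint m j) (combPoint m (j + 1)) < ‖combPoint m (j + 1)‖ ^ 2 := by
  simp only [PiLp.inner_apply, EuclideanSpace.real_norm_sq_eq, Fin.sum_univ_two]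
  obtain h | rfl | rfl | rfl : j < 2 * m ∨ j = 2 * m ∨ j = 2 * m + 1 ∨ j = 2 * m + 2 := by omega
  · have e1 := combPoint_succ_zero h
    have e2 := combPoint_zero_sq h.le
    have e3 := combPoint_height_nonneg h.le
    have e4 := combPoint_height_lt_half h.le
    have e5 := combPoint_height_nonneg h
    have e6 := combPoint_height_lt_half h
    rw [e1]
    simp
    constructor <;> nlinarith
  · have e3 := combPoint_height_nonneg (m := m) (j := 2 * m) le_rfl
    have e4 := combPoint_height_lt_half (m := m) (j := 2 * m) le_rfl
    have e5 : combPoint m (2 * m) 0 = -1 := by rw [combPoint_last]; simp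
    rw [combPoint_right, e5]
    simp
    constructor <;> nlinarith
  · rw [combPoint_right, combPoint_bottom]
    norm_num
  · rw [combPoint_bottom, combPoint_period, combPoint_zero]
    norm_num

/-- The abscissas contribute `-1` and the heights, both below `1 / 2`, less than `1 / 4`. -/
theorem inner_combPoint_le {j : ℕ} (h : j < 2 * m) :
    inner ℝ (combPoint m j) (combPoint m (j + 1)) ≤ -(3 / 4 : ℝ) := by
  simp only [PiLp.inner_apply, Fin.sum_univ_two]
  have e1 := combPoint_succ_zero h
  have e2 := combPoint_zero_sq h.le
  have e3 := combPoint_height_nonneg h.le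
  have e4 := combPoint_height_lt_half h.le
  have e5 := combPoint_height_nonneg h
  have e6 := combPoint_height_lt_half h
  rw [e1]
  simp
  nlinarith

theorem isSimplePolygon_comb (hm : 1 ≤ m) :
    IsSimplePolygon (polygonOfSeq (2 * m + 3) (combPoint m)) :=
  isSimplePolygon_polygonOfSeq (by omega) (combPoint_period m) (combPoint_period_one hm)
    (fun _ hi => combPoint_det hm hi) (fun _ _ hij hj h0 => combPoint_disjoint hij hj h0)

end Comb

/-- The angle under which the segment between two points of the plane is seen from the points at
height `u⁻¹` and `-u⁻¹` on the axis. -/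
noncomputable def axisAngle (p q : Euc 2) (u : ℝ) : ℝ :=
  Real.arccos ((u ^ 2 * inner ℝ p q + 1) / (√(u ^ 2 * ‖p‖ ^ 2 + 1) * √(u ^ 2 * ‖q‖ ^ 2 + 1)))

theorem continuous_axisAngle (p q : Euc 2) : Continuous (axisAngle p q) := by
  refine Real.continuous_arccos.comp (Continuous.div (by fun_prop) (by fun_prop) fun u => ?_)
  exact (mul_pos (Real.sqrt_pos.2 (by positivity)) (Real.sqrt_pos.2 (by positivity))).ne'

theorem axisAngle_zero (p q : Euc 2) : axisAngle p q 0 = 0 := by simp [axisAngle]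

theorem axisAngle_nonneg (p q : Euc 2) (u : ℝ) : 0 ≤ axisAngle p q u := Real.arccos_nonneg _

theorem axisAngle_neg (p q : Euc 2) (u : ℝ) : axisAngle p q (-u) = axisAngle p q u := by
  simp [axisAngle]

/-- At `u = 2` the numerator of the cosine is at most `4 · (-3/4) + 1 < 0`. -/
theorem pi_div_two_le_axisAngle {p q : Euc 2} (h : inner ℝ p q ≤ -(3 / 4 : ℝ)) :
    Real.pi / 2 ≤ axisAngle p q 2 := by
  rw [axisAngle, ← not_lt, Real.arccos_lt_pi_div_two, not_lt]
  refine div_nonpos_of_nonpos_of_nonneg ?_ (by positivity)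
  linarith

/-- The apex angle varies continuously from `0` at `u = 0` to at least `m π` at `u = 2`, where each
of the `2 m` zigzag edges is seen under at least a right angle. -/
theorem exists_sum_axisAngle_eq (m : ℕ) {θ : ℝ} (h0 : 0 < θ) (h1 : θ ≤ m * Real.pi) :
    ∃ u : ℝ, 0 < u ∧
      ∑ i ∈ Finset.range (2 * m + 3), axisAngle (combPoint m i) (combPoint m (i + 1)) u = θ := by
  set G : ℝ → ℝ := fun u =>
    ∑ i ∈ Finset.range (2 * m + 3), axisAngle (combPoint m i) (combPoint m (i + 1)) u with hG
  have hcont : Continuous G := continuous_finsetSum _ fun i _ => continuous_axisAngle _ _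
  have hG0 : G 0 = 0 := by simp [hG, axisAngle_zero]
  have hG2 : m * Real.pi ≤ G 2 := by
    calc (m : ℝ) * Real.pi = ∑ i ∈ Finset.range (2 * m), Real.pi / 2 := by
          rw [Finset.sum_const, Finset.card_range, nsmul_eq_mul]; push_cast; ring
      _ ≤ ∑ i ∈ Finset.range (2 * m), axisAngle (combPoint m i) (combPoint m (i + 1)) 2 :=
          Finset.sum_le_sum fun i hi =>
            pi_div_two_le_axisAngle (inner_combPoint_le (Finset.mem_range.1 hi))
      _ ≤ G 2 := Finset.sum_le_sum_of_subset_of_nonneg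
          (Finset.range_subset_range.2 (by omega)) (fun _ _ _ => axisAngle_nonneg _ _ _)
  obtain ⟨u, ⟨hu0, -⟩, hu⟩ := intermediate_value_Icc (zero_le_two (α := ℝ)) hcont.continuousOn
    (show θ ∈ Set.Icc (G 0) (G 2) from ⟨by linarith, by linarith⟩)
  refine ⟨u, hu0.lt_of_ne ?_, hu⟩
  rintro rfl
  linarith

namespace IsAngleFunction

variable {S : ComplexSet} {φ : VertexFunction} {c : ℝ} {f : ℝ → ℝ}

/-- With symmetric apexes of angle `θ`, every base angle is a sum of four acute angles, hence in the
range where `f` is affine. The base angles add up to `2 n π - 2 θ` with `n = 2 m + 3`, so `f θ` is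
the only unknown. -/
theorem comb (h : IsAngleFunction S φ c f) {k b : ℝ}
    (hf : ∀ u ∈ Set.Ioo 0 (2 * Real.pi), f u = k * u + b) {m : ℕ} (hm : 1 ≤ m) {θ : ℝ}
    (h0 : 0 < θ) (h1 : θ ≤ m * Real.pi) :
    2 * f θ + k * (2 * (2 * m + 3) * Real.pi - 2 * θ) + (2 * m + 3) * b = c := by
  obtain ⟨u, hu, hθ⟩ := exists_sum_axisAngle_eq m h0 h1
  have hP := isSimplePolygon_comb hm
  set P := polygonOfSeq (2 * m + 3) (combPoint m) with hPdef
  have hsucc : ∀ i : Fin (2 * m + 3), P (i + 1) = combPoint m (i + 1) :=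
    polygonOfSeq_add_one (combPoint_period m)
  have hx : 0 < axisPoint u⁻¹ 2 := by rw [axisPoint_two]; positivity
  have hy : axisPoint (-u)⁻¹ 2 < 0 := by
    rw [axisPoint_two]; exact inv_lt_zero.2 (by linarith)
  have hapex : ∀ v : ℝ, v = u ∨ v = -u →
      (bipyramid hP hx hy).totalAngle (axisPoint v⁻¹) = θ := by
    intro v hv
    have hv0 : v ≠ 0 := by rcases hv with rfl | rfl; exacts [hu.ne', neg_ne_zero.2 hu.ne']
    rw [bipyramid_totalAngle_apex hP hx hy (by rcases hv with rfl | rfl <;> simp), ← hθ,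
      Finset.sum_range]
    refine Finset.sum_congr rfl fun i _ => ?_
    rw [hsucc, angle_axisPoint _ _ hv0]
    change axisAngle (combPoint m i) _ v = _
    rcases hv with rfl | rfl
    · rfl
    · rw [axisAngle_neg]
  have hin : ∀ i : Fin (2 * m + 3), inner ℝ (P i) (P (i + 1)) < ‖P i‖ ^ 2 ∧
      inner ℝ (P i) (P (i + 1)) < ‖P (i + 1)‖ ^ 2 := by
    intro i
    rw [hsucc]
    exact inner_combPoint i.2
  have hin' : ∀ i : Fin (2 * m + 3), inner ℝ (P i) (P (i - 1)) < ‖P i‖ ^ 2 := by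
    intro i
    have := (hin (i - 1)).2
    rwa [sub_add_cancel, real_inner_comm] at this
  have hbase : ∀ i, (bipyramid hP hx hy).totalAngle (planeInclusion (P i)) ∈
      Set.Ioo 0 (2 * Real.pi) := by
    intro i
    have hpos := ((bipyramid_linkAdj_base hP hx hy (i := i)).2
      ⟨_, Or.inl rfl, i + 1, Or.inl rfl, Or.inl ⟨rfl, rfl⟩⟩).angle_pos
    rw [bipyramid_totalAngle_base]
    have a1 := angle_planeInclusion_lt _ _ u⁻¹ (hin i).1
    have a2 := angle_planeInclusion_lt _ _ u⁻¹ (hin' i)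
    have a3 := angle_planeInclusion_lt _ _ (-u)⁻¹ (hin i).1
    have a4 := angle_planeInclusion_lt _ _ (-u)⁻¹ (hin' i)
    have b2 := angle_nonneg (axisPoint u⁻¹) (planeInclusion (P i)) (planeInclusion (P (i - 1)))
    have b3 := angle_nonneg (axisPoint (-u)⁻¹) (planeInclusion (P i)) (planeInclusion (P (i + 1)))
    have b4 := angle_nonneg (axisPoint (-u)⁻¹) (planeInclusion (P i)) (planeInclusion (P (i - 1)))
    constructor <;> linarith
  have hsum := h.sum_bipyramid hP hx hy
  have hang := bipyramid_sum_totalAngle hP hx hy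
  rw [hapex u (Or.inl rfl), hapex (-u) (Or.inr rfl)] at hsum hang
  rw [Finset.sum_congr rfl (fun i _ => hf _ (hbase i)), Finset.sum_add_distrib, ← Finset.mul_sum,
    Finset.sum_const, Finset.card_univ, Fintype.card_fin, nsmul_eq_mul] at hsum
  push_cast at hsum hang
  rw [← hsum]
  linear_combination -k * hang

/-- A vertex function of the total angle that sums to `c` on bipyramids is the multiple `c / (4 π)`
of the curvature. -/
theorem eq_curvature (h : IsAngleFunction S φ c f) {θ : ℝ} (hθ : 0 < θ) :
    f θ = c / (4 * Real.pi) * (2 * Real.pi - θ) := by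
  have hpi := Real.pi_pos
  obtain ⟨k, b, hf, hkb⟩ := h.exists_affine
  -- At `θ = π`, `m = 1` the value `f π` is known too, so this is a second linear relation between
  -- `k`, `b` and `c`; together they give `b = -2πk` and `c = -4πk`.
  have e1 := h.comb hf le_rfl hpi (by simp)
  rw [hf _ ⟨hpi, by linarith⟩] at e1
  push_cast at e1
  have hb : b = -2 * Real.pi * k := by linarith
  obtain ⟨m, hm⟩ := exists_nat_ge (θ / Real.pi)
  -- With `b = -2πk` the terms that depend on the number of base vertices cancel, and `f θ` no
  -- longer involves `m`.
  have e2 := h.comb hf (Nat.le_add_left 1 m) hθ (by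
    rw [div_le_iff₀ hpi] at hm
    push_cast
    linarith)
  push_cast at e2
  rw [hb] at e2 hkb
  rw [div_mul_eq_mul_div, eq_div_iff (by positivity)]
  have hc : c = -4 * Real.pi * k := by linarith
  have hfθ : f θ = k * θ - 2 * Real.pi * k := by linarith
  rw [hfθ, hc]
  ring

end IsAngleFunction

/-! ### The vertex function as a multiple of the curvature, and the theorem. -/

theorem TwoComplex.totalAngle_pos {N : ℕ} {K : TwoComplex N} (hK : K.IsSimplicialSurface)
    {v : Euc N} (hv : v ∈ K.vertices) : 0 < K.totalAngle v := by
  obtain ⟨a, ha⟩ := exists_neighbor hK hv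
  obtain ⟨b, hb⟩ := exists_linkAdj hK ha
  refine div_pos (Finset.sum_pos' (fun x _ => angle_nonneg _ _ _)
    ⟨(a, b), mem_linkPairs.2 hb, hb.angle_pos⟩) two_pos

theorem exists_isAngleFunction {S : ComplexSet}
    (hsurf : ∀ (N : ℕ), ∀ K ∈ S N, K.IsSimplicialSurface) (hsub : S.ClosedUnderSubdivision)
    (hbipyr : ∀ K : TwoComplex 3, K.IsBipyramid → K ∈ S 3) {φ : VertexFunction}
    (hiso : φ.InvariantUnderStarIsometries S) (hdiv : φ.InvariantUnderSubdivision S)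
    (hcont : φ.IsContinuous S) {c : ℝ}
    (hsum : ∀ K : TwoComplex 3, K.IsBipyramid → ∑ᶠ v ∈ K.vertices, φ 3 K v = c) :
    ∃ f, IsAngleFunction S φ c f := by
  -- The value of `φ` at any vertex with total angle `θ` is taken; `TwoComplex.eq_of_totalAngle_eq`
  -- makes the choice irrelevant. Angles that do not occur get the value `0`.
  let f : ℝ → ℝ := fun θ =>
    if h : ∃ (r : ℝ) (N : ℕ) (K : TwoComplex N) (v : Euc N), K ∈ S N ∧ v ∈ K.vertices ∧
      K.totalAngle v = θ ∧ φ N K v = r then h.choose else 0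
  refine ⟨f, ⟨fun N K hK v hv => ?_, hcont, hbipyr, hsum⟩⟩
  have h : ∃ (r : ℝ) (N' : ℕ) (L : TwoComplex N') (w : Euc N'), L ∈ S N' ∧ w ∈ L.vertices ∧
      L.totalAngle w = K.totalAngle v ∧ φ N' L w = r := ⟨_, N, K, v, hK, hv, rfl, rfl⟩
  have hfv : f (K.totalAngle v) = h.choose := dif_pos h
  obtain ⟨N', L, w, hL, hw, hang, hr⟩ := h.choose_spec
  rw [hfv, ← hr]
  exact TwoComplex.eq_of_totalAngle_eq hsurf hsub hiso hdiv hK hL hv hw hang.symm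

theorem corollary2p6 (S : ComplexSet)
    (hsurf : ∀ (N : ℕ), ∀ K ∈ S N, K.IsSimplicialSurface)
    (hsub : S.ClosedUnderSubdivision)
    (hpyr : ∀ K : TwoComplex 3, K.IsPyramid → K ∈ S 3)
    (hbipyr : ∀ K : TwoComplex 3, K.IsBipyramid → K ∈ S 3)
    (Λ : ComplexFunction) (hΛ : GeometricallyLocallyDetermined S Λ)
    (c : ℝ) (hconst : ∀ K : TwoComplex 3, K.IsPyramid ∨ K.IsBipyramid → Λ 3 K = c) :
    ∀ (N : ℕ), ∀ K ∈ S N, Λ N K = (1 / 2 : ℝ) * c * (K.eulerChar : ℝ) := by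
  intro N K hK
  obtain ⟨φ, hiso, hdiv, hcont, hgb⟩ := hΛ
  obtain ⟨f, hf⟩ := exists_isAngleFunction hsurf hsub hbipyr hiso hdiv hcont
    (fun K hK => (hgb 3 K (hbipyr K hK)).trans (hconst K (Or.inr hK)))
  rw [← hgb N K hK, finsum_mem_eq_finite_toFinset_sum _ K.finite_vertices]
  have hv : ∀ v ∈ K.finite_vertices.toFinset,
      φ N K v = c / (4 * Real.pi) * (2 * Real.pi - K.totalAngle v) := by
    intro v hv
    have hv := K.finite_vertices.mem_toFinset.1 hv
    rw [hf.apply_eq N K hK v hv, hf.eq_curvature (TwoComplex.totalAngle_pos (hsurf N K hK) hv)]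
  rw [Finset.sum_congr rfl hv, ← Finset.mul_sum,
    TwoComplex.sum_two_pi_sub_totalAngle (hsurf N K hK)]
  field_simp
  ring
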